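/- **Setting.** $G$ is a graph with $n\ge 2$ nodes. Fix a constant $C$. Every node has a unique identifier in $\{0,\dots,n^C-1\}$, and every edge $e$ has a length $\ell(e)\in\{1,\dots,n^C\}$. For a subgraph $H\subseteq G$ (with the lengths of $G$), $d_H$ is the shortest-path distance in $H$ ($\infty$ if there is no path). For $Q\subseteq V(H)$ and delays $\mathrm{del}(q)\ge 0$, put $d_{H,\mathrm{del}}(q,v)=\mathrm{del}(q)+d_H(q,v)$ and $d_{H,\mathrm{del}}(Q,v)=\min_{q\in Q} d_{H,\mathrm{del}}(q,v)$. **Oracles.** The distance oracle with precision $\varepsilon'\ge 0$ and distance parameter $D\geq 0$ receives a subgraph $H'\subseteq G$, a set $Q_0\subseteq V(H')$ and real delays $\mathrm{del}_0\ge 0$. It returns some rooted forest $F\subseteq H'$ (each node learns whether it is in $F$, and its parent) with roots in $Q_0$, such that $\mathrm{del}_0(\mathrm{root}_F(v))+d_F(\mathrm{root}_F(v),v)\le(1+\varepsilon')\,d_{H',\mathrm{del}_0}(Q_0,v)$ for all $v\in V(F)$, and such that every $v\in V(H')$ with $d_{H',\mathrm{del}_0}(Q_0,v)\le D$ lies in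 $F$. The forest aggregation oracle with distance parameter $D$ receives a rooted forest $F\subseteq G$ in which each node has distance at most $D$ to its root, and an $O(\log n)$-bit number $x_v$ at each node. It tells each $v\in V(F)$ the sum of $x_u$ over the ancestors $u$ of $v$ and the sum over the descendants $u$ of $v$ ($v$ included in both). The global aggregation oracle receives an $O(\log n)$-bit number at each node and tells all nodes the sum. In the randomized version the oracles' answers are fixed functions of the step number and the input of the call; they do not otherwise depend on the coins. **Algorithms.** All nodes run the same synchronous program, which depends only on $C$. At the beginning a node knows $n$, $R$, $\varepsilon$, its identifier, the identifiers of its neighbors, the lengths of its incident edges, its part of the input ($H$, $Q$, $\mathrm{del}$, and $\mu$ in the deterministic version) and, in the randomized version, finitely many private fair coins. In one step, every node exchanges $O(\log n)$-bit messages with its neighbors in $G$, and each of the three oracles is called at most once; local computation is free. At the end every node of $H$ outputs the name of its cluster and whether it belongs to $Q'$. **Problem.** The input consists of a subgraph $H\subseteq G$; in the deterministic version, a weight $\mu(e)\in\{0,\dots,n^C\}$ for each $e\in E(H)$; a set of centers $Q\subseteq V(H)$ with delays $\mathrm{del}(q)\ge0$; a real $R\in[0,n^C]$ with $d_{H,\mathrm{del}}(Q,v)\le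 R$ for all $v\in V(H)$; and $\varepsilon\in[0,1]$. The output consists of a partition $\mathcal C$ of $V(H)$ and a set $Q'\subseteq Q$. Let $E^{bad}$ be the set of edges of $H$ whose endpoints lie in different clusters. **Statement.** For every $C$ there are a deterministic and a randomized algorithm that run in $O(\log^3 n)$ steps, with all oracle calls having precision parameter $\varepsilon'=\Omega(\varepsilon/\log^2 n)$ and distance parameter at most $2R$, and whose output satisfies, whatever the answers of the oracles allowed above (and, in the randomized version, for every outcome of the coins): 1. each cluster $C\in\mathcal C$ contains exactly one node $q'_C$ of $Q'$; 2. $d_{H[C],\mathrm{del}}(q'_C,v)\le d_{H,\mathrm{del}}(Q,v)+\varepsilon R$ for each $C\in\mathcal C$ and $v\in C$; and moreover 3. for the deterministic algorithm, $\varepsilon R\cdot\mu(E^{bad})\le O(\log^3 n)\cdot\sum_{e\in E(H)}\mu(e)\ell(e)$; 4. for the randomized algorithm, $\varepsilon R\cdot\Pr[e\in E^{bad}]\le O(\log^3 n)\cdot\ell(e)$ for every $e\in E(H)$. The constants hidden in $O(\cdot)$ and $\Omega(\cdot)$ depend only on $C$. -/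

import Mathlib

open scoped NNReal ENNReal

noncomputable section

namespace EdgeCutting

/-! ### Weighted graphs, distances, delays -/

/-- A network: a graph with edge lengths whose nodes carry identifiers. -/
structure Network (V : Type) where
  graph : SimpleGraph V
  len : Sym2 V → ℕ
  id : V → ℕ

variable {V : Type}

/-- The standing assumptions on a network with `n` nodes: identifiers are distinct and at most
polynomial, edge lengths are positive integers and at most polynomial, with exponent `C`. -/
structure Network.PolyBounded [Fintype V] (N : Network V) (C : ℕ) : Prop where
  id_injective : Function.Injective N.id
  id_lt : ∀ v, N.id v < Fintype.card V ^ C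
  len_pos : ∀ e ∈ N.graph.edgeSet, 1 ≤ N.len e
  len_le : ∀ e ∈ N.graph.edgeSet, N.len e ≤ Fintype.card V ^ C

/-- The distance `d_H(u, v)` in a weighted subgraph `H`: the least length of a walk in `H`
(infinite if there is none). -/
def Network.dist (N : Network V) (H : N.graph.Subgraph) (u v : V) : ℝ≥0∞ :=
  ⨅ p : H.spanningCoe.Walk u v, (((p.edges.map N.len).sum : ℕ) : ℝ≥0∞)

/-- `d_{H,del}(q, v) = del(q) + d_H(q, v)`. -/
def Network.delDist (N : Network V) (H : N.graph.Subgraph) (del : V → ℝ≥0) (q v : V) : ℝ≥0∞ :=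
  (del q : ℝ≥0∞) + N.dist H q v

/-- `d_{H,del}(Q, v)`, the minimum of `d_{H,del}(q, v)` over `q ∈ Q` (infinite for `Q = ∅`). -/
def Network.delDistSet (N : Network V) (H : N.graph.Subgraph) (del : V → ℝ≥0) (Q : Set V)
    (v : V) : ℝ≥0∞ :=
  ⨅ q ∈ Q, N.delDist H del q v

/-! ### Rooted forests -/

/-- A forest presented by parent pointers; the nodes of `verts` with no parent are the roots. -/
structure RootedForest (V : Type) where
  verts : Set V
  parent : V → Option V

/-- `F.Climb len v u d`: following parent pointers from `v` one arrives at `u`, over edges of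
total length `d`. So `u` is an ancestor of `v` (possibly `v` itself) and `d = d_F(u, v)`. -/
inductive RootedForest.Climb (F : RootedForest V) (len : Sym2 V → ℕ) : V → V → ℕ → Prop
  | refl (v : V) : RootedForest.Climb F len v v 0
  | step {v w u : V} {d : ℕ} (h : F.parent v = some w) (hc : RootedForest.Climb F len w u d) :
      RootedForest.Climb F len v u (len s(v, w) + d)

/-- All tree edges of `F` are edges of the subgraph `H` between nodes of `F`, and `F ⊆ H`. -/
def RootedForest.InSubgraph {G : SimpleGraph V} (F : RootedForest V) (H : G.Subgraph) : Prop :=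
  F.verts ⊆ H.verts ∧ ∀ v ∈ F.verts, ∀ w, F.parent v = some w → w ∈ F.verts ∧ H.Adj v w

/-- `F` is a rooted forest in the network in which every node has distance at most `D` from its
root. -/
def RootedForest.HasDepthLE (F : RootedForest V) (N : Network V) (D : ℝ≥0) : Prop :=
  F.InSubgraph (⊤ : N.graph.Subgraph) ∧
    ∀ v ∈ F.verts, ∃ r d, F.Climb N.len v r d ∧ F.parent r = none ∧ (d : ℝ≥0) ≤ D

/-! ### Oracles -/

/-- Input of the approximate distance oracle: a subgraph, centers, delays. -/
structure DistQuery (N : Network V) where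
  sub : N.graph.Subgraph
  centers : Set V
  delay : V → ℝ≥0

/-- `F` is a correct answer of the distance oracle with precision `prec` and distance parameter
`D`: a forest in `H` rooted at centers, with `del(root(v)) + d_F(root(v), v)` at most
`(1 + prec) d_{H,del}(Q, v)` for each of its nodes `v`, that contains every node `v` of `H` with
`d_{H,del}(Q, v) ≤ D`. -/
def DistQuery.Answer {N : Network V} (q : DistQuery N) (prec : ℝ) (D : ℝ≥0)
    (F : RootedForest V) : Prop :=
  F.InSubgraph q.sub ∧
  (∀ v ∈ F.verts, ∃ r ∈ q.centers, ∃ d, F.Climb N.len v r d ∧ F.parent r = none ∧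
    (q.delay r : ℝ≥0∞) + (d : ℝ≥0∞) ≤
      (1 + ENNReal.ofReal prec) * N.delDistSet q.sub q.delay q.centers v) ∧
  ∀ v ∈ q.sub.verts, N.delDistSet q.sub q.delay q.centers v ≤ (D : ℝ≥0∞) → v ∈ F.verts

/-- The answers given to the oracle calls (the first argument is the number of the step in which
the call is made): the distance oracle returns a forest, the forest aggregation oracle, for a
forest and a number at each node, returns to each node a pair of numbers. -/
structure Oracles (N : Network V) where
  dist : ℕ → DistQuery N → RootedForest V
  agg : ℕ → RootedForest V → (V → ℕ) → V → ℕ × ℕ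

open Classical in
/-- The oracles are correct, with precision `prec` and distance parameter `D`. The forest
aggregation oracle returns to each node of the forest the sum over its ancestors and the sum over
its descendants (the node itself included in both), provided that the forest has depth at most
`D`; nothing is promised about calls that violate this. -/
structure Oracles.Correct [Fintype V] {N : Network V} (O : Oracles N) (prec : ℝ) (D : ℝ≥0) :
    Prop where
  dist_answer : ∀ t (q : DistQuery N), q.centers ⊆ q.sub.verts → q.Answer prec D (O.dist t q)
  agg_answer : ∀ t (F : RootedForest V) (x : V → ℕ), F.HasDepthLE N D → ∀ v ∈ F.verts,
    O.agg t F x v =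
      (∑ u : V with ∃ d, F.Climb N.len v u d, x u,
       ∑ u : V with u ∈ F.verts ∧ ∃ d, F.Climb N.len u v d, x u)

/-! ### Distributed algorithms with oracles -/

/-- What a node knows at the beginning. Neighbors are referred to by their identifiers. -/
structure LocalInput where
  /-- number of nodes of the network -/
  n : ℕ
  id : ℕ
  nbrs : Set ℕ
  /-- length of the edge to the neighbor with the given identifier -/
  len : ℕ → ℕ
  /-- does the node belong to `H`, and which neighbors does it have there -/
  inSub : Prop
  subNbrs : Set ℕ
  isCenter : Prop
  delay : ℝ≥0
  radius : ℝ≥0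
  eps : ℝ≥0
  /-- weight of the edge to the neighbor with the given identifier -/
  weight : ℕ → ℕ

/-- What a node submits in one step. -/
structure Request where
  /-- message to the neighbor with the given identifier -/
  msg : ℕ → ℕ
  /-- the node's part of the input of the distance oracle: membership in the subgraph, neighbors
  there, membership in the set of centers, delay -/
  inSub : Prop
  subNbrs : Set ℕ
  isCenter : Prop
  delay : ℝ≥0
  /-- the node's part of the input of the forest aggregation oracle: membership in the forest,
  identifier of the parent, value -/
  inForest : Prop
  parent : Option ℕ
  forestValue : ℕ
  /-- the node's value for the global aggregation oracle -/
  globalValue : ℕ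

/-- What a node receives in one step. -/
structure Response where
  /-- message from the neighbor with the given identifier -/
  msg : ℕ → ℕ
  /-- answer of the distance oracle: membership in the forest, identifier of the parent -/
  inForest : Prop
  parent : Option ℕ
  /-- answer of the forest aggregation oracle -/
  ancestorSum : ℕ
  descendantSum : ℕ
  /-- answer of the global aggregation oracle: the sum of the values of all nodes -/
  globalSum : ℕ

/-- A synchronous distributed algorithm, run by every node. It is the same for all networks:
a node sees only its local input, its private coins and the responses it receives. -/
structure Algorithm where
  State : Type
  /-- messages and the values passed to aggregation oracles are numbers below `n ^ bandwidth`,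
  that is, they have `O(log n)` bits -/
  bandwidth : ℕ
  /-- number of steps, and number of fair coins of each node, as functions of `n` -/
  steps : ℕ → ℕ
  coins : ℕ → ℕ
  init : (i : LocalInput) → (Fin (coins i.n) → Bool) → State
  request : State → Request
  next : State → Response → State
  /-- the output of a node: the name of its cluster, and whether it is a chosen center -/
  label : State → ℕ
  chosen : State → Prop

/-- The instance of the clustering problem: the subgraph `H`, the centers `Q` with their delays,
the parameters `R` and `ε`. -/
structure Input (N : Network V) where
  sub : N.graph.Subgraph
  centers : Set V
  delay : V → ℝ≥0
  radius : ℝ≥0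
  eps : ℝ≥0

structure Input.Valid [Fintype V] {N : Network V} (I : Input N) (C : ℕ) : Prop where
  centers_subset : I.centers ⊆ I.sub.verts
  dist_le : ∀ v ∈ I.sub.verts, N.delDistSet I.sub I.delay I.centers v ≤ (I.radius : ℝ≥0∞)
  radius_le : I.radius ≤ (Fintype.card V : ℝ≥0) ^ C
  eps_le : I.eps ≤ 1

open Classical in
/-- The value `f u` for the neighbor `u` of `v` with identifier `k` (and `0` if there is none). -/
def Network.atNbr [Fintype V] (N : Network V) (v : V) (f : V → ℕ) (k : ℕ) : ℕ :=
  ∑ u : V with N.graph.Adj v u ∧ N.id u = k, f u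

open Classical in
/-- The node with identifier `k`, if there is one. -/
def Network.node (N : Network V) (k : ℕ) : Option V :=
  if h : ∃ u, N.id u = k then some h.choose else none

/-- The knowledge of node `v` at the beginning, where `μ` are the edge weights. -/
def Input.localInput [Fintype V] {N : Network V} (I : Input N) (μ : Sym2 V → ℕ) (v : V) :
    LocalInput where
  n := Fintype.card V
  id := N.id v
  nbrs := N.id '' {u | N.graph.Adj v u}
  len := N.atNbr v fun u => N.len s(v, u)
  inSub := v ∈ I.sub.verts
  subNbrs := N.id '' {u | I.sub.Adj v u}
  isCenter := v ∈ I.centers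
  delay := I.delay v
  radius := I.radius
  eps := I.eps
  weight := N.atNbr v fun u => μ s(v, u)

/-- The input of the distance oracle submitted by all nodes together. An edge belongs to the
subgraph if both of its endpoints say so. -/
def distQuery (N : Network V) (req : V → Request) : DistQuery N where
  sub :=
    { verts := {v | (req v).inSub}
      Adj := fun u v => N.graph.Adj u v ∧ ((req u).inSub ∧ (req v).inSub) ∧
        (N.id v ∈ (req u).subNbrs ∧ N.id u ∈ (req v).subNbrs)
      adj_sub := fun h => h.1
      edge_vert := fun h => h.2.1.1
      symm := ⟨fun _ _ h => ⟨h.1.symm, h.2.1.symm, h.2.2.symm⟩⟩ }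
  centers := {v | (req v).inSub ∧ (req v).isCenter}
  delay := fun v => (req v).delay

/-- The forest submitted to the forest aggregation oracle by all nodes together. -/
def forestQuery (N : Network V) (req : V → Request) : RootedForest V where
  verts := {v | (req v).inForest}
  parent := fun v => (req v).parent.bind N.node

/-- The response to node `v` in step `t`, when the nodes submit `req` and numbers are restricted
to those below `B`. One step consists of one round of messages between neighbors and one call of
each of the three oracles. -/
def response [Fintype V] {N : Network V} (O : Oracles N) (B t : ℕ) (req : V → Request) (v : V) :
    Response where
  msg := N.atNbr v fun u => (req u).msg (N.id v) % B
  inForest := v ∈ (O.dist t (distQuery N req)).verts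
  parent := ((O.dist t (distQuery N req)).parent v).map N.id
  ancestorSum := (O.agg t (forestQuery N req) (fun u => (req u).forestValue % B) v).1
  descendantSum := (O.agg t (forestQuery N req) (fun u => (req u).forestValue % B) v).2
  globalSum := ∑ u : V, (req u).globalValue % B

/-- The states of all nodes after `t` steps, where `coin v` are the coins of node `v`. -/
def Algorithm.run [Fintype V] (A : Algorithm) {N : Network V} (O : Oracles N) (I : Input N)
    (μ : Sym2 V → ℕ) (coin : V → Fin (A.coins (Fintype.card V)) → Bool) : ℕ → V → A.State
  | 0 => fun v => A.init (I.localInput μ v) (coin v)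
  | t + 1 => fun v =>
      A.next (A.run O I μ coin t v)
        (response O (Fintype.card V ^ A.bandwidth) t
          (fun u => A.request (A.run O I μ coin t u)) v)

/-- The cluster names at the end. -/
def Algorithm.finalLabel [Fintype V] (A : Algorithm) {N : Network V} (O : Oracles N)
    (I : Input N) (μ : Sym2 V → ℕ) (coin : V → Fin (A.coins (Fintype.card V)) → Bool)
    (v : V) : ℕ :=
  A.label (A.run O I μ coin (A.steps (Fintype.card V)) v)

/-- The set `Q'` of chosen centers at the end. -/
def Algorithm.finalCenters [Fintype V] (A : Algorithm) {N : Network V} (O : Oracles N)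
    (I : Input N) (μ : Sym2 V → ℕ) (coin : V → Fin (A.coins (Fintype.card V)) → Bool) : Set V :=
  {v | v ∈ I.sub.verts ∧ A.chosen (A.run O I μ coin (A.steps (Fintype.card V)) v)}

/-! ### Clusterings -/

/-- The cluster of `v`: the nodes of `H` with the same label. The clusters of the nodes of `H` are
the classes of a partition of the node set of `H`. -/
def Input.cluster {N : Network V} (I : Input N) (label : V → ℕ) (v : V) : Set V :=
  {u | u ∈ I.sub.verts ∧ label u = label v}

/-- The requirements on the partition given by `label` and on the set `Q'` of chosen centers:
`Q' ⊆ Q`, each cluster `C` contains exactly one node `q` of `Q'`, and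
`d_{H[C],del}(q, u) ≤ d_{H,del}(Q, u) + ε R` for each `u ∈ C`. -/
def Input.IsClustering {N : Network V} (I : Input N) (label : V → ℕ) (Q' : Set V) : Prop :=
  Q' ⊆ I.centers ∧
  ∀ v ∈ I.sub.verts, ∃ q, I.cluster label v ∩ Q' = {q} ∧
    ∀ u ∈ I.cluster label v,
      N.delDist (I.sub.induce (I.cluster label v)) I.delay q u ≤
        N.delDistSet I.sub I.delay I.centers u + (I.eps : ℝ≥0∞) * (I.radius : ℝ≥0∞)

/-- `E^bad`: the edges of `H` whose endpoints lie in different clusters. -/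
def Input.badEdges {N : Network V} (I : Input N) (label : V → ℕ) : Set (Sym2 V) :=
  {e | e ∈ I.sub.edgeSet ∧ ∃ u v, e = s(u, v) ∧ label u ≠ label v}

open Classical in
/-- The probability that an edge is in `E^bad`, over independent fair coins of the nodes. -/
def Algorithm.cutProb [Fintype V] (A : Algorithm) {N : Network V} (O : Oracles N)
    (I : Input N) (μ : Sym2 V → ℕ) (e : Sym2 V) : ℝ :=
  (Finset.card {coin : V → Fin (A.coins (Fintype.card V)) → Bool |
      e ∈ I.badEdges (A.finalLabel O I μ coin)} : ℝ) /
    (Fintype.card (V → Fin (A.coins (Fintype.card V)) → Bool) : ℝ)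

/-- The precision parameter `c ε / log² n` of the oracle calls. -/
def Input.precision [Fintype V] {N : Network V} (I : Input N) (c : ℝ) : ℝ :=
  c * I.eps / Real.log (Fintype.card V) ^ 2

end EdgeCutting

end

/-! Write `J` for `levels C n`, so that `2 ^ J ≥ n ^ C`, and `D` for the growth per step, about `ε R
/ (8 J²)`. Cluster names are identifiers of centers, fixed bit by bit. In phase `i` the available
centers of a current cluster are colored by bit `i` of their identifier, and the nodes are split
into two colors such that every node can still be reached, inside its color class, from an available
center of that color. After `J` phases a name is a complete identifier, so every cluster keeps
exactly one center.

A phase consists of `J` steps. A step takes an approximate shortest-path forest of the undecided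
nodes, chooses a color `c`, and lets the union `S` of the trees with root color `c` grow by at most
`D`; the grown `S` receives color `c` for good. A node whose parent falls into `S` becomes an entry:
a new root, whose delay dominates the length of a route from a center of color `c` through decided
nodes. This costs `5 D` in distance per step (`LevelInv.finish`), and at the end of a phase another
`D` (`StepInv.endPhase`), in total at most `7 J² D ≤ ε R`.

The amount of growth is found by halving. At level `j` there is a set `Z` that contains everything
within `restRadius J D j` of `S`. One oracle query produces a set `M` between them, and the decision
is either to shrink `Z` to `M` or to enlarge `S` to `M`; both options leave about half of the
radius.

Cuts are controlled by a potential for each edge, in which a cut edge costs `D * 2 ^ J`. For each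
decision the average over both options is at most the current potential
(`Inv.optionPotential_add_le`), and carrying out the chosen option does not increase it
(`Inv.potential_next_le`). Two effects balance. An edge between trees of the same root color is
settled uncut by one choice of the color, so the price `D * 2 ^ t` of being undecided may double in
each step; after `J` steps it pays for cutting the edge. And when the radius is halved, the edge
stays a candidate for the boundary in essentially one option, so its price proportional to the
length may double as well.

The potential starts at `O(J 2 ^ J ℓ(e))` and is at least `D * 2 ^ J` if the edge is cut. With a
fair coin for each decision its expectation does not increase (`Good.sum_potential_le`); the
deterministic version computes the weighted potentials of both options by global sums and takes the
cheaper one (`Good.total_next_le`). Thus `D` times the cut probability is `O(J ℓ(e))`, which is the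
claim since `ε R = O(J² D)`. If `D = 0`, then `ε R < 8 J²`, the bound on cuts is trivial, and the
trees of a single forest serve as clusters. -/

noncomputable section

namespace EdgeCutting

variable {V : Type}

/-! ### Node programs -/

/-- The program of a node, as a tree of interactions with its environment. -/
inductive Proc (α : Type) : Type
  | ret : α → Proc α
  | step : Request → (Response → Proc α) → Proc α

namespace Proc

variable {α β : Type}

def bind : Proc α → (α → Proc β) → Proc β
  | ret a, f => f a
  | step q k, f => step q fun x => (k x).bind f

/-- A request that asks for nothing. -/
def idle : Request where
  msg := fun _ => 0
  inSub := False
  subNbrs := ∅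
  isCenter := False
  delay := 0
  inForest := False
  parent := none
  forestValue := 0
  globalValue := 0

def request : Proc α → Request
  | ret _ => idle
  | step q _ => q

def advance : Proc α → Response → Proc α
  | ret a, _ => ret a
  | step _ k, x => k x

def output (d : α) : Proc α → α
  | ret a => a
  | step _ _ => d

/-- A single request, returning the response. -/
def call (q : Request) : Proc Response := step q ret

/-- The loop that runs `body 0`, …, `body (m - 1)`. -/
def loop (body : ℕ → α → Proc α) : ℕ → α → Proc α
  | 0, a => ret a
  | m + 1, a => (loop body m a).bind (body m)

end Proc

/-- `Exec O B t p t' a`: if all nodes run their programs `p` from time `t` on, then all of them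
terminate at time `t'`, with results `a`. -/
inductive Exec [Fintype V] {N : Network V} (O : Oracles N) (B : ℕ) {α : Type} :
    ℕ → (V → Proc α) → ℕ → (V → α) → Prop
  | ret (t : ℕ) (a : V → α) : Exec O B t (fun v => .ret (a v)) t a
  | step (t t' : ℕ) (q : V → Request) (k : V → Response → Proc α) (a : V → α)
      (h : Exec O B (t + 1) (fun v => k v (response O B t q v)) t' a) :
      Exec O B t (fun v => .step (q v) (k v)) t' a

section

variable [Fintype V] {N : Network V} {O : Oracles N} {B : ℕ} {α β : Type}

theorem Exec.bind {t t' t'' : ℕ} {p : V → Proc α} {a : V → α} {f : V → α → Proc β} {b : V → β}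
    (h : Exec O B t p t' a) (h' : Exec O B t' (fun v => f v (a v)) t'' b) :
    Exec O B t (fun v => (p v).bind (f v)) t'' b := by
  induction h with
  | ret t a => exact h'
  | step t t' q k a _ ih => exact .step _ _ _ _ _ (ih h')

theorem Exec.call (t : ℕ) (q : V → Request) :
    Exec O B t (fun v => Proc.call (q v)) (t + 1) (response O B t q) :=
  .step _ _ _ _ _ (.ret _ _)

theorem Exec.loop {body : V → ℕ → α → Proc α} {d : ℕ} {g : ℕ → (V → α) → V → α}
    (h : ∀ m a, Exec O B (d * m) (fun v => body v m (a v)) (d * (m + 1)) (g m a)) (a : V → α)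
    (m : ℕ) :
    Exec O B 0 (fun v => Proc.loop (body v) m (a v)) (d * m)
      (Nat.rec a (fun m a => g m a) m) := by
  induction m with
  | zero => exact .ret _ _
  | succ m ih => exact ih.bind (h m _)

/-- The algorithm that runs a program. -/
def Proc.toAlgorithm (bandwidth : ℕ) (steps coins : ℕ → ℕ)
    (prog : (i : LocalInput) → (Fin (coins i.n) → Bool) → Proc (ℕ × Prop)) : Algorithm where
  State := Proc (ℕ × Prop)
  bandwidth := bandwidth
  steps := steps
  coins := coins
  init := prog
  request := Proc.request
  next := Proc.advance
  label := fun p => (p.output (0, False)).1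
  chosen := fun p => (p.output (0, False)).2

/-- A terminated program idles without changing its state. Hence programs of different duration can
share one number of steps `T`. -/
theorem run_toAlgorithm {bandwidth : ℕ} {steps coins : ℕ → ℕ}
    {prog : (i : LocalInput) → (Fin (coins i.n) → Bool) → Proc (ℕ × Prop)}
    {I : Input N} {μ : Sym2 V → ℕ} {coin : V → Fin (coins (Fintype.card V)) → Bool}
    {t t' : ℕ} {p : V → Proc (ℕ × Prop)} {a : V → ℕ × Prop}
    (h : Exec O (Fintype.card V ^ bandwidth) t p t' a)
    (hp : (Proc.toAlgorithm bandwidth steps coins prog).run O I μ coin t = p)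
    (T : ℕ) (hT : t' ≤ T) :
    (Proc.toAlgorithm bandwidth steps coins prog).run O I μ coin T = fun v => .ret (a v) := by
  induction h with
  | ret t a =>
    induction T, hT using Nat.le_induction with
    | base => exact hp
    | succ T _ ih =>
      funext v
      simp only [Algorithm.run]
      rw [ih]
      rfl
  | step t t' q k a _ ih =>
    refine ih ?_ hT
    funext v
    simp only [Algorithm.run]
    rw [hp]
    rfl

end

/-! ### Paths -/

/-- There is a path of length `d` from `u` to `v` along the relation `A`. -/
inductive Reach (A : V → V → Prop) (len : Sym2 V → ℕ) : V → V → ℕ → Prop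
  | refl (v : V) : Reach A len v v 0
  | tail {u v w : V} {d : ℕ} (h : Reach A len u v d) (hA : A v w) :
      Reach A len u w (d + len s(v, w))

section Reach

variable {A A' : V → V → Prop} {len : Sym2 V → ℕ} {u v w : V} {d d' : ℕ}

theorem Reach.mono (h : Reach A len u v d) (hA : ∀ a b, A a b → A' a b) :
    Reach A' len u v d := by
  induction h with
  | refl => exact .refl _
  | tail _ h ih => exact ih.tail (hA _ _ h)

theorem Reach.trans (h : Reach A len u v d) (h' : Reach A len v w d') :
    Reach A len u w (d + d') := by
  induction h' with
  | refl => exact h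
  | tail _ hA ih => rw [← add_assoc]; exact ih.tail hA

theorem Reach.single (h : A u v) : Reach A len u v (len s(u, v)) := by
  simpa using (Reach.refl (A := A) (len := len) u).tail h

theorem Reach.symm (hs : ∀ a b, A a b → A b a) (h : Reach A len u v d) :
    Reach A len v u d := by
  induction h with
  | refl => exact .refl _
  | @tail v w d _ hA ih =>
    rw [Sym2.eq_swap, add_comm]
    exact (Reach.single (hs _ _ hA)).trans ih

/-- Along a path, a property preserved by every step is preserved. -/
theorem Reach.preserves {p : V → Prop} (hp : ∀ a b, A a b → p a → p b)
    (h : Reach A len u v d) (hu : p u) : p v := by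
  induction h with
  | refl => exact hu
  | tail _ hA ih => exact hp _ _ hA ih

theorem Reach.of_walk {G : SimpleGraph V} (p : G.Walk u v) :
    Reach G.Adj len u v (p.edges.map len).sum := by
  induction p with
  | nil => exact .refl _
  | cons h p ih => simpa using (Reach.single h).trans ih

theorem Reach.exists_walk {G : SimpleGraph V} (h : Reach G.Adj len u v d) :
    ∃ p : G.Walk u v, (p.edges.map len).sum = d := by
  induction h with
  | refl => exact ⟨.nil, rfl⟩
  | tail _ hA ih =>
    obtain ⟨p, hp⟩ := ih
    exact ⟨p.concat hA, by simp [SimpleGraph.Walk.edges_concat, hp]⟩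

variable {N : Network V}

theorem Network.dist_le_of_reach {H : N.graph.Subgraph} (h : Reach A N.len u v d)
    (hA : ∀ a b, A a b → H.Adj a b) : N.dist H u v ≤ d := by
  obtain ⟨p, hp⟩ := Reach.exists_walk (G := H.spanningCoe) (h.mono hA)
  exact (iInf_le _ p).trans (by rw [hp])

theorem Network.delDistSet_le_of_reach {H : N.graph.Subgraph} {del : V → ℝ≥0} {Q : Set V}
    (hu : u ∈ Q) (h : Reach A N.len u v d) (hA : ∀ a b, A a b → H.Adj a b) :
    N.delDistSet H del Q v ≤ del u + d :=
  (iInf₂_le u hu).trans (add_le_add le_rfl (N.dist_le_of_reach h hA))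

theorem Network.exists_reach_of_delDistSet_lt {H : N.graph.Subgraph} {del : V → ℝ≥0}
    {Q : Set V} {x : ℝ≥0∞} (h : N.delDistSet H del Q v < x) :
    ∃ q ∈ Q, ∃ d : ℕ, Reach H.Adj N.len q v d ∧ (del q : ℝ≥0∞) + d < x := by
  simp only [Network.delDistSet, iInf_lt_iff] at h
  obtain ⟨q, hq, h⟩ := h
  rw [Network.delDist, Network.dist, ENNReal.add_iInf, iInf_lt_iff] at h
  obtain ⟨p, hp⟩ := h
  exact ⟨q, hq, _, Reach.of_walk p, hp⟩

/-- Lengths are natural numbers and there are finitely many nodes, so only finitely many pairs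
(center, length) lie below a given bound and the infimum is attained. -/
theorem Network.exists_reach_le_delDistSet [Finite V] {H : N.graph.Subgraph} {del : V → ℝ≥0}
    {Q : Set V} (h : N.delDistSet H del Q v ≠ ⊤) :
    ∃ q ∈ Q, ∃ d : ℕ, Reach H.Adj N.len q v d ∧
      (del q : ℝ≥0∞) + d ≤ N.delDistSet H del Q v := by
  obtain ⟨n, hn⟩ := ENNReal.exists_nat_gt h
  set P : Set (V × ℕ) := {x | x.1 ∈ Q ∧ Reach H.Adj N.len x.1 v x.2 ∧ x.2 < n} with hP
  have hfin : P.Finite := ((Set.toFinite (Set.univ : Set V)).prod (Set.finite_lt_nat n)).subset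
    fun x hx => ⟨trivial, hx.2.2⟩
  have hmem : ∀ y, N.delDistSet H del Q v < y → y ≤ n →
      ∃ x ∈ P, (del x.1 : ℝ≥0∞) + x.2 < y := by
    intro y hy hyn
    obtain ⟨q, hq, d, hd, hlt⟩ := N.exists_reach_of_delDistSet_lt hy
    refine ⟨(q, d), ⟨hq, hd, ?_⟩, hlt⟩
    have h1 : (d : ℝ≥0∞) < n := (le_add_self.trans_lt hlt).trans_le hyn
    exact_mod_cast h1
  obtain ⟨x, hx, hxlt⟩ := hmem n hn le_rfl
  obtain ⟨m, hm, hmin⟩ := Set.exists_min_image P (fun x => (del x.1 : ℝ≥0∞) + x.2) hfin ⟨x, hx⟩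
  refine ⟨m.1, hm.1, m.2, hm.2.1, not_lt.1 fun hlt => ?_⟩
  obtain ⟨y, hy, hylt⟩ := hmem _ hlt ((hmin x hx).trans hxlt.le)
  exact absurd hylt (not_lt.2 (hmin y hy))

end Reach

/-! ### Forests -/

/-- A rooted forest spanning `W` along the relation `A`, with roots in `cen`, that approximates
distances from `cen` with delays `del`: `par`, `root` and `dep` are the parent, the root and
the distance to the root. -/
structure SpanningForest (A : V → V → Prop) (len : Sym2 V → ℕ) (W cen : Set V) (del : V → ℝ≥0)
    (η : ℝ) (par : V → Option V) (root : V → V) (dep : V → ℕ) : Prop where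
  root_mem : ∀ v ∈ W, root v ∈ cen
  of_none : ∀ v ∈ W, par v = none → root v = v ∧ dep v = 0
  of_some : ∀ v ∈ W, ∀ p, par v = some p →
    p ∈ W ∧ A v p ∧ root v = root p ∧ dep v = dep p + len s(p, v) ∧ dep p < dep v
  par_root : ∀ v ∈ W, par (root v) = none
  acc : ∀ v ∈ W, ∀ q ∈ cen, ∀ d, Reach A len q v d →
    (del (root v) : ℝ) + dep v ≤ (1 + η) * (del q + d)

section Forest

variable {A : V → V → Prop} {len : Sym2 V → ℕ} {W cen : Set V} {del : V → ℝ≥0}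
    {η : ℝ} {par : V → Option V} {root : V → V} {dep : V → ℕ}

/-- `dep` strictly decreases towards the parent. This is how facts about a root are transported to
its whole tree. -/
theorem SpanningForest.induct (h : SpanningForest A len W cen del η par root dep)
    {P : V → Prop} (h0 : ∀ v ∈ W, par v = none → P v)
    (h1 : ∀ v ∈ W, ∀ p ∈ W, par v = some p → P p → P v) : ∀ v ∈ W, P v := by
  suffices H : ∀ n, ∀ v ∈ W, dep v < n → P v from fun v hv => H _ v hv (Nat.lt_succ_self _)
  intro n
  induction n with
  | zero => intro v _ h; omega
  | succ n ih =>
    intro v hv hn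
    rcases hp : par v with _ | p
    · exact h0 v hv hp
    · obtain ⟨hpW, -, -, -, hd⟩ := h.of_some v hv p hp
      exact h1 v hv p hpW hp (ih p hpW (by omega))

/-- The tree path from the root. -/
theorem SpanningForest.reach (h : SpanningForest A len W cen del η par root dep)
    (hs : ∀ a b, A a b → A b a) : ∀ v ∈ W,
    Reach (fun a b => A a b ∧ root a = root b) len (root v) v (dep v) := by
  refine h.induct (fun v hv hp => ?_) fun v hv p hpW hp ih => ?_
  · obtain ⟨h1, h2⟩ := h.of_none v hv hp
    rw [h1, h2]
    exact .refl _
  · obtain ⟨-, hA, hr, hd, -⟩ := h.of_some v hv p hp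
    rw [hr, hd]
    exact ih.tail ⟨hs _ _ hA, hr.symm⟩

/-- Parent pointers are deterministic. Hence the root and depth obtained for a node and those
obtained for its parent fit together. -/
theorem RootedForest.Climb.unique {F : RootedForest V} {v r r' : V} {d d' : ℕ}
    (h : F.Climb len v r d) (hr : F.parent r = none) (h' : F.Climb len v r' d')
    (hr' : F.parent r' = none) : r = r' ∧ d = d' := by
  induction h generalizing d' with
  | refl v =>
    cases h' with
    | refl => exact ⟨rfl, rfl⟩
    | step h _ => simp [hr] at h
  | step h hc ih =>
    cases h' with
    | refl => simp [hr'] at h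
    | step h2 hc2 =>
      rw [h] at h2
      cases h2
      obtain ⟨h3, h4⟩ := ih hr hc2
      exact ⟨h3, by rw [h4]⟩

theorem RootedForest.Climb.trans {F : RootedForest V} {u v w : V} {d d' : ℕ}
    (h : F.Climb len u v d) (h' : F.Climb len v w d') : F.Climb len u w (d + d') := by
  induction h with
  | refl => simpa using h'
  | step h _ ih => rw [add_assoc]; exact .step h (ih h')

open Classical in
/-- The sum of `x` over the ancestors of `v`. -/
def RootedForest.ancestorSum [Fintype V] (F : RootedForest V) (len : Sym2 V → ℕ) (x : V → ℕ)
    (v : V) : ℕ :=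
  ∑ u : V with ∃ d, F.Climb len v u d, x u

theorem RootedForest.ancestorSum_of_none [Fintype V] {F : RootedForest V} {x : V → ℕ}
    {v : V} (h : F.parent v = none) : F.ancestorSum len x v = x v := by
  classical
  rw [RootedForest.ancestorSum, Finset.sum_eq_single v]
  · intro u hu huv
    obtain ⟨d, hd⟩ := (Finset.mem_filter.1 hu).2
    cases hd with
    | refl => exact absurd rfl huv
    | step h' _ => simp [h] at h'
  · intro hv
    exact absurd (Finset.mem_filter.2 ⟨Finset.mem_univ _, 0, .refl v⟩) hv

/-- The hypothesis `hv` excludes a cycle of parent pointers, on which `v` would be one of its own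
proper ancestors and `x v` would be counted twice. -/
theorem RootedForest.ancestorSum_of_some [Fintype V] {F : RootedForest V} {x : V → ℕ}
    {v p : V} (h : F.parent v = some p) (hv : ¬ ∃ d, F.Climb len p v d) :
    F.ancestorSum len x v = x v + F.ancestorSum len x p := by
  classical
  have hs : (Finset.univ.filter fun u => ∃ d, F.Climb len v u d) =
      insert v (Finset.univ.filter fun u => ∃ d, F.Climb len p u d) := by
    ext u
    simp only [Finset.mem_filter, Finset.mem_univ, true_and, Finset.mem_insert]
    constructor
    · rintro ⟨d, hd⟩
      cases hd with
      | refl => exact .inl rfl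
      | step h' hc =>
        rw [h] at h'
        cases h'
        exact .inr ⟨_, hc⟩
    · rintro (rfl | ⟨d, hd⟩)
      · exact ⟨0, .refl _⟩
      · exact ⟨_, .step h hd⟩
  rw [RootedForest.ancestorSum, hs, Finset.sum_insert]
  · rfl
  · simpa using hv

/-- A correct answer of the distance oracle to a query all of whose nodes are close to the
centers is a spanning forest of bounded depth. -/
theorem DistQuery.Answer.spanningForest {N : Network V} {q : DistQuery N} {prec : ℝ} {D : ℝ≥0}
    {F : RootedForest V} (h : q.Answer prec D F) (hprec : 0 ≤ prec)
    (hlen : ∀ e ∈ N.graph.edgeSet, 1 ≤ N.len e)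
    (hcov : ∀ v ∈ q.sub.verts, ∃ c ∈ q.centers, ∃ d, Reach q.sub.Adj N.len c v d ∧
      (1 + prec) * (q.delay c + d) ≤ D) :
    F.verts = q.sub.verts ∧ F.HasDepthLE N D ∧ ∃ root dep,
      SpanningForest q.sub.Adj N.len q.sub.verts q.centers q.delay prec F.parent root dep ∧
      (∀ v ∈ q.sub.verts, (q.delay (root v) : ℝ) + dep v ≤ D) ∧
      ∀ v ∈ q.sub.verts, ∀ p, F.parent v = some p → ¬ ∃ d, F.Climb N.len p v d := by
  obtain ⟨⟨hsub, hpar⟩, hroot, hmem⟩ := h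
  have hverts : F.verts = q.sub.verts := by
    refine hsub.antisymm fun v hv => hmem v hv ?_
    obtain ⟨c, hc, d, hr, hd⟩ := hcov v hv
    refine (N.delDistSet_le_of_reach hc hr fun _ _ h => h).trans ?_
    have : q.delay c + (d : ℝ≥0) ≤ D := by
      rw [← NNReal.coe_le_coe]
      push_cast
      have h1 : (0 : ℝ) ≤ q.delay c + d := by positivity
      nlinarith
    exact_mod_cast this
  rw [hverts] at hroot hpar
  have hchoice : ∀ v, ∃ r d, v ∈ q.sub.verts → r ∈ q.centers ∧ F.Climb N.len v r d ∧
      F.parent r = none ∧ ∀ c ∈ q.centers, ∀ d', Reach q.sub.Adj N.len c v d' →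
      (q.delay r : ℝ) + d ≤ (1 + prec) * (q.delay c + d') := by
    intro v
    by_cases hv : v ∈ q.sub.verts
    · obtain ⟨r, hr, d, hc, hn, hle⟩ := hroot v hv
      refine ⟨r, d, fun _ => ⟨hr, hc, hn, fun c hc d' hd' => ?_⟩⟩
      have h1 := hle.trans (mul_le_mul_right
        (N.delDistSet_le_of_reach (del := q.delay) hc hd' fun _ _ h => h) _)
      have h2 : q.delay r + (d : ℝ≥0) ≤ (1 + prec.toNNReal) * (q.delay c + d') := by
        have : ENNReal.ofReal prec = (prec.toNNReal : ℝ≥0∞) := rfl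
        rw [this] at h1
        exact_mod_cast h1
      have h3 := NNReal.coe_le_coe.2 h2
      push_cast at h3
      rwa [Real.coe_toNNReal _ hprec] at h3
    · exact ⟨v, 0, fun h => absurd h hv⟩
  choose root dep hrd using hchoice
  have hsome : ∀ v ∈ q.sub.verts, ∀ p, F.parent v = some p →
      p ∈ q.sub.verts ∧ q.sub.Adj v p ∧ root v = root p ∧ dep v = dep p + N.len s(p, v) ∧
        dep p < dep v := by
    intro v hv p hp
    obtain ⟨hpW, hA⟩ := hpar v hv p hp
    obtain ⟨-, h1, h2, -⟩ := hrd v hv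
    obtain ⟨-, h3, h4, -⟩ := hrd p hpW
    -- Two climbs from `v` to a root are compared: the chosen one and the one through the parent.
    obtain ⟨h5, h6⟩ := h1.unique h2 (.step hp h3) h4
    have := hlen s(v, p) (q.sub.adj_sub hA)
    refine ⟨hpW, hA, h5, ?_, by omega⟩
    rw [Sym2.eq_swap, h6, add_comm]
  have hle : ∀ v ∈ q.sub.verts, (q.delay (root v) : ℝ) + dep v ≤ D := by
    intro v hv
    obtain ⟨c, hc, d, hr, hd⟩ := hcov v hv
    exact ((hrd v hv).2.2.2 c hc d hr).trans hd
  refine ⟨hverts, ⟨⟨fun v _ => trivial, fun v hv w hw => ⟨?_, ?_⟩⟩, fun v hv => ?_⟩,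
    root, dep, ⟨fun v hv => (hrd v hv).1, fun v hv hp => ?_, hsome, fun v hv => (hrd v hv).2.2.1,
      fun v hv => (hrd v hv).2.2.2⟩, hle, fun v hv p hp => ?_⟩
  · rw [hverts] at hv ⊢
    exact (hpar v hv w hw).1
  · rw [hverts] at hv
    exact q.sub.adj_sub (hpar v hv w hw).2
  · rw [hverts] at hv
    refine ⟨root v, dep v, (hrd v hv).2.1, (hrd v hv).2.2.1, ?_⟩
    have := hle v hv
    have h0 : (0 : ℝ) ≤ q.delay (root v) := NNReal.coe_nonneg _
    rw [← NNReal.coe_le_coe]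
    push_cast
    linarith
  · obtain ⟨-, h1, h2, -⟩ := hrd v hv
    obtain ⟨h3, h4⟩ := (RootedForest.Climb.refl v).unique hp h1 h2
    exact ⟨h3.symm, h4.symm⟩
  -- A climb from the parent `p` back to `v`, continued to the root, would give `dep p ≥ dep v`.
  · rintro ⟨d, hd⟩
    obtain ⟨hpW, hA, -, h6, h7⟩ := hsome v hv p hp
    obtain ⟨-, h1, h2, -⟩ := hrd v hv
    obtain ⟨-, h3, h4, -⟩ := hrd p hpW
    have := ((hd.trans h1).unique h2 h3 h4).2
    omega

end Forest

/-! ### Forest queries -/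

/-- The data that a node submits to a forest query: its part of the input of the distance oracle
and the number to be summed up along the tree, given the identifier of its parent. -/
structure QueryArg where
  inSub : Prop
  nbrs : Set ℕ
  isCenter : Prop
  delay : ℝ≥0
  value : Option ℕ → ℕ

def QueryArg.distRequest (a : QueryArg) : Request :=
  { Proc.idle with inSub := a.inSub, subNbrs := a.nbrs, isCenter := a.isCenter, delay := a.delay }

def QueryArg.aggRequest (a : QueryArg) (x : Response) : Request :=
  { Proc.idle with inForest := x.inForest, parent := x.parent, forestValue := a.value x.parent }

/-- Ask the distance oracle for a forest and sum up numbers over the ancestors; returns the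
parent and the sum. -/
def query (a : QueryArg) : Proc (Option ℕ × ℕ) :=
  (Proc.call a.distRequest).bind fun x =>
    (Proc.call (a.aggRequest x)).bind fun y => .ret (x.parent, y.ancestorSum)

section

variable [Fintype V] {N : Network V} 

def queryResult (O : Oracles N) (B t : ℕ) (a : V → QueryArg) (v : V) : Option ℕ × ℕ :=
  let x := response O B t fun v => (a v).distRequest
  ((x v).parent, (response O B (t + 1) (fun v => (a v).aggRequest (x v)) v).ancestorSum)

variable {O : Oracles N} {B : ℕ}

theorem Exec.query (t : ℕ) (a : V → QueryArg) :
    Exec O B t (fun v => EdgeCutting.query (a v)) (t + 2) (queryResult O B t a) :=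
  (Exec.call t _).bind <| (Exec.call (t + 1) _).bind <| .ret _ _

omit [Fintype V] in
theorem Network.node_id (hid : Function.Injective N.id) (v : V) : N.node (N.id v) = some v := by
  have h : ∃ u, N.id u = N.id v := ⟨v, rfl⟩
  rw [Network.node, dif_pos h]
  exact congrArg some (hid h.choose_spec)

/-- The covering hypothesis `hcov` activates both oracles: every submitted node is close enough to
be in the forest, and the forest is shallow enough to be aggregated. `hval` is needed only for
single values, because submitted numbers are truncated below `B` but their sums are not. The result
is a recursion along the tree, to be solved by `SpanningForest.induct`. -/
theorem queryResult_spec {prec : ℝ} {D : ℝ≥0} (hO : O.Correct prec D) (hprec : 0 ≤ prec)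
    (hid : Function.Injective N.id) (hlen : ∀ e ∈ N.graph.edgeSet, 1 ≤ N.len e)
    (t : ℕ) (a : V → QueryArg) {A : V → V → Prop}
    (hA : ∀ u v, A u v ↔ N.graph.Adj u v ∧ ((a u).inSub ∧ (a v).inSub) ∧
      (N.id v ∈ (a u).nbrs ∧ N.id u ∈ (a v).nbrs))
    (hc : ∀ v, (a v).isCenter → (a v).inSub)
    (hcov : ∀ v, (a v).inSub → ∃ c, (a c).isCenter ∧ ∃ d, Reach A N.len c v d ∧
      (1 + prec) * ((a c).delay + d) ≤ D)
    (hval : ∀ v, (a v).inSub → ((a v).isCenter → (a v).delay ≤ D → (a v).value none < B) ∧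
      ∀ p, A v p → (a v).value (some (N.id p)) < B) :
    ∃ par root dep,
      SpanningForest A N.len {v | (a v).inSub} {v | (a v).isCenter} (fun v => (a v).delay) prec
        par root dep ∧
      (∀ v, (queryResult O B t a v).1 = (par v).map N.id) ∧
      (∀ v, (a v).inSub → par v = none → (queryResult O B t a v).2 = (a v).value none) ∧
      ∀ v, (a v).inSub → ∀ p, par v = some p → (queryResult O B t a v).2 =
        (a v).value (some (N.id p)) + (queryResult O B t a p).2 := by
  set q := distQuery N fun v => (a v).distRequest with hq
  have hAdj : q.sub.Adj = A := by
    funext u v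
    exact propext (hA u v).symm
  have hcen : q.centers = {v | (a v).isCenter} := by
    ext v
    exact ⟨fun h => h.2, fun h => ⟨hc v h, h⟩⟩
  have hans := hO.dist_answer t q fun v hv => hv.1
  obtain ⟨hverts, hdepth, root, dep, hF, hle, hcl⟩ := hans.spanningForest hprec hlen (by
    intro v hv
    obtain ⟨c, h1, d, h2, h3⟩ := hcov v hv
    exact ⟨c, ⟨hc c h1, h1⟩, d, by rwa [hAdj], h3⟩)
  rw [hAdj, hcen] at hF
  set F := O.dist t q with hFdef
  set x := response O B t fun v => (a v).distRequest with hx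
  have hfq : forestQuery N (fun v => (a v).aggRequest (x v)) = F := by
    have h1 : ∀ v, (x v).parent = (F.parent v).map N.id := fun v => rfl
    have h2 : ∀ v, (x v).inForest = (v ∈ F.verts) := fun v => rfl
    have h3 : (fun v => ((x v).parent).bind N.node) = F.parent := by
      funext v
      rw [h1]
      rcases F.parent v with _ | p
      · rfl
      · exact N.node_id hid p
    have h4 : {v | (x v).inForest} = F.verts := rfl
    show RootedForest.mk {v | (x v).inForest} (fun v => ((x v).parent).bind N.node) = F
    rw [h3, h4]
  set y : V → ℕ := fun v => (a v).value ((F.parent v).map N.id) % B with hy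
  have hsum : ∀ v, (a v).inSub → (queryResult O B t a v).2 = F.ancestorSum N.len y v := by
    intro v hv
    have h1 : (queryResult O B t a v).2 =
      (O.agg (t + 1) (forestQuery N fun v => (a v).aggRequest (x v)) y v).1 := rfl
    rw [h1, hfq, hO.agg_answer (t + 1) F y hdepth v (by rw [hverts]; exact hv)]
    rfl
  refine ⟨F.parent, root, dep, hF, fun v => rfl, fun v hv hn => ?_, fun v hv p hp => ?_⟩
  · rw [hsum v hv, RootedForest.ancestorSum_of_none hn]
    obtain ⟨h1, h2⟩ := hF.of_none v hv hn
    have h3 := hle v hv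
    have h4 := hF.root_mem v hv
    rw [h1] at h4 h3
    rw [h2] at h3
    have h5 : (a v).delay ≤ D := by
      have h6 : (((a v).delay : ℝ≥0) : ℝ) + ((0 : ℕ) : ℝ) ≤ D := h3
      rw [← NNReal.coe_le_coe]
      simpa only [Nat.cast_zero, add_zero] using h6
    simp only [hy, hn, Option.map_none]
    exact Nat.mod_eq_of_lt ((hval v hv).1 h4 h5)
  · obtain ⟨h1, h2, -⟩ := hF.of_some v hv p hp
    rw [hsum v hv, hsum p h1, RootedForest.ancestorSum_of_some hp (hcl v hv p hp)]
    simp only [hy, hp, Option.map_some]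
    rw [Nat.mod_eq_of_lt ((hval v hv).2 p h2)]

end

open Classical

/-! ### Parameters of the algorithm -/

/-- The number of phases, of steps in a phase and of levels in a step. -/
def levels (C n : ℕ) : ℕ := C * (Nat.log 2 n + 1) + 1

/-- The total growth of a set in one step. -/
def growth (C : ℕ) (i : LocalInput) : ℕ :=
  ⌊i.eps * i.radius / (8 * (levels C i.n : ℝ≥0) ^ 2)⌋₊

/-- The growth that is left at level `j`. -/
def restRadius (J D j : ℕ) : ℝ := D / 2 ^ j * (1 - j / (2 * J))

/-- The delay of the nodes outside of the set that grows at level `j`. -/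
def growDelay (J D j : ℕ) : ℝ≥0 :=
  ((restRadius J D j - restRadius J D (j + 1)) / (1 + 1 / (3 * J))).toNNReal

/-- The position in the algorithm: phase, step, and the number of decisions already made in this
step. -/
structure Pos where
  i : ℕ
  t : ℕ
  j : ℕ

def Pos.next (J : ℕ) (p : Pos) : Pos :=
  if p.j < J then ⟨p.i, p.t, p.j + 1⟩ else if p.t + 1 < J then ⟨p.i, p.t + 1, 0⟩ else ⟨p.i + 1, 0, 0⟩

def pos (J : ℕ) : ℕ → Pos
  | 0 => ⟨0, 0, 0⟩
  | k + 1 => (pos J k).next J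

/-! ### The program of a node -/

/-- What a node remembers between decisions. -/
structure Loc where
  /-- the bits of the cluster name fixed in earlier phases -/
  label : ℕ
  /-- the neighbors in the current graph -/
  live : Set ℕ
  /-- is the color in the current phase still undecided -/
  act : Prop
  color : Bool
  /-- entries are the centers of the distance queries; they come with a color and a delay -/
  entry : Prop
  ecol : Bool
  edel : ℝ≥0
  /-- position in the forest of the current step: parent, rounded distance, color of the root -/
  par : Option ℕ
  fhat : ℕ
  tcol : Bool
  /-- the color that grows in the current step -/
  ccol : Bool
  /-- the set that grows, and a bound for its growth -/
  S : Prop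
  Z : Prop

/-- A name consists of the low `i` bits of an identifier. A center is available if its own
identifier ends in these bits, and bit `i` is its color in this phase. -/
def startPhase (inp : LocalInput) (i label : ℕ) (live : Set ℕ) : Loc where
  label := label
  live := live
  act := inp.inSub
  color := false
  entry := inp.isCenter ∧ inp.id % 2 ^ i = label
  ecol := inp.id.testBit i
  edel := inp.delay
  par := none
  fhat := 0
  tcol := false
  ccol := false
  S := False
  Z := False

/-- The query for a forest rooted at the entries. -/
def mainArg (inp : LocalInput) (s : Loc) : QueryArg where
  inSub := s.act
  nbrs := s.live
  isCenter := s.entry ∧ s.act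
  delay := s.edel
  value := fun k => k.elim (2 * ⌈s.edel⌉₊ + s.ecol.toNat) fun k => 2 * inp.len k

/-- The query for the nodes close to `S`. -/
def growArg (J D j : ℕ) (s : Loc) : QueryArg where
  inSub := s.act
  nbrs := s.live
  isCenter := s.act
  delay := if s.S then 0 else growDelay J D j
  value := fun k => if k = none ∧ s.S then 1 else 0

def arg (J D : ℕ) (p : Pos) (inp : LocalInput) (s : Loc) : QueryArg :=
  if p.j = 0 then mainArg inp s else growArg J D (p.j - 1) s

/-- The two options between which all nodes decide. -/
def candidate (p : Pos) (s : Loc) (r : Option ℕ × ℕ) (b : Bool) : Loc :=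
  if p.j = 0 then
    { s with par := r.1, fhat := r.2 / 2, tcol := r.2.testBit 0, ccol := b,
             S := s.act ∧ r.2.testBit 0 = b, Z := s.act }
  else if b then { s with S := s.act ∧ r.2 = 1 }
  else { s with Z := s.act ∧ r.2 = 1 }

/-- Codes: 0 for nodes that are not undecided; among the undecided ones, 1 for `S`, 2 for `Z`
without `S`, 3 for the rest. -/
def kind (s : Loc) : ℕ := if s.act then if s.S then 1 else if s.Z then 2 else 3 else 0

/-- The potential of an edge of length `l` between undecided nodes at the beginning of step
`t`. -/
def stepCost (J D t l : ℕ) : ℕ := D * 2 ^ t + 8 * 2 ^ J * l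

/-- The potential of an edge of length `l` between undecided nodes of kinds `a` and `b` at
level `j` of step `t`. -/
def levelCost (J D t j l a b : ℕ) : ℕ :=
  if a = 1 ∧ b = 1 then 0
  else if a = 1 ∨ b = 1 then min (D * 2 ^ J) (2 ^ j * (4 * 2 ^ J * l))
  else min (D * 2 ^ J)
      (2 ^ j * (4 * 2 ^ J * l) * ((if a = 2 then 1 else 0) + if b = 2 then 1 else 0)) +
    stepCost J D (t + 1) l

/-- The contribution of a node to the weighted potential of an option. -/
def contribution (C J D : ℕ) (p : Pos) (inp : LocalInput) (s : Loc) (kinds : ℕ → ℕ) : ℕ :=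
  ∑ k ∈ Finset.range (inp.n ^ C), if k ∈ s.live then
    (if kind s = 0 ∨ kinds k = 0 then 0
      else inp.weight k * levelCost J D p.t p.j (inp.len k) (kind s) (kinds k)) else 0

/-- The kinds under both options are sent in one message, as two digits in base 4; `readKind`
extracts one of them. -/
def kindRequest (p : Pos) (s : Loc) (r : Option ℕ × ℕ) : Request :=
  { Proc.idle with
    msg := fun _ => kind (candidate p s r false) + 4 * kind (candidate p s r true) }

def readKind (b : Bool) (m : ℕ → ℕ) (k : ℕ) : ℕ := if b then m k / 4 else m k % 4

/-- At the end of a step, the grown set gets its color, and the nodes cut off from their root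
become entries. -/
def finish (J D : ℕ) (p : Pos) (s : Loc) (kinds : ℕ → ℕ) : Loc :=
  if p.j = J then
    { s with
      act := s.act ∧ ¬ s.S
      color := if s.act ∧ s.S then s.ccol else s.color
      entry := s.entry ∨ ∃ k, s.par = some k ∧ kinds k = 1
      ecol := if ∃ k, s.par = some k ∧ kinds k = 1 then s.ccol else s.ecol
      edel := if ∃ k, s.par = some k ∧ kinds k = 1 then s.fhat + 3 * D else s.edel }
  else s

/-- The color at the end of a phase; nodes that are still undecided take the color of their
root. -/
def lastColor (s : Loc) (r : Option ℕ × ℕ) : Bool := if s.act then r.2.testBit 0 else s.color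

def colorRequest (s : Loc) (r : Option ℕ × ℕ) : Request :=
  { Proc.idle with msg := fun _ => (lastColor s r).toNat }

/-- At the end of a phase, the colors become part of the cluster names. -/
def endPhase (J : ℕ) (p : Pos) (inp : LocalInput) (s : Loc) (r : Option ℕ × ℕ) (m : ℕ → ℕ) : Loc :=
  if p.j = J ∧ p.t + 1 = J then
    startPhase inp (p.i + 1) (s.label + 2 ^ p.i * (lastColor s r).toNat)
      {k | k ∈ s.live ∧ m k = (lastColor s r).toNat}
  else s

def valueRequest (x : ℕ) : Request := { Proc.idle with globalValue := x }

/-- How the two global sums determine the decision. -/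
def decision (det : Bool) (x y : ℕ) : Bool := if det then decide (y ≤ x) else x.testBit 0

/-- The numbers submitted for the first of the two global sums. -/
def firstValue (C J D : ℕ) (det coin : Bool) (p : Pos) (inp : LocalInput) (s : Loc)
    (r : Option ℕ × ℕ) (m : ℕ → ℕ) : ℕ :=
  if det then contribution C J D p inp (candidate p s r false) (readKind false m) else coin.toNat

/-- One decision, with everything that has to be done before and after it. -/
def body (C : ℕ) (det : Bool) (inp : LocalInput) (coin : ℕ → Bool) (k : ℕ) (s : Loc) : Proc Loc :=
  let J := levels C inp.n
  let D := growth C inp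
  let p := pos J k
  (query (arg J D p inp s)).bind fun r =>
  (Proc.call (kindRequest p s r)).bind fun m =>
  (Proc.call (valueRequest (firstValue C J D det (coin k) p inp s r m.msg))).bind fun x =>
  (Proc.call (valueRequest (contribution C J D p inp (candidate p s r true)
    (readKind true m.msg)))).bind fun y =>
  let b := decision det x.globalSum y.globalSum
  let s' := finish J D p (candidate p s r b) (readKind b m.msg)
  (query (mainArg inp s')).bind fun r' =>
  (Proc.call (colorRequest s' r')).bind fun m' =>
  .ret (endPhase J p inp s' r' m'.msg)

/-- The program for the case that `ε R` is small: the clusters are the trees of a forest. -/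
def treeProgram (inp : LocalInput) : Proc (ℕ × Prop) :=
  (query ⟨inp.inSub, inp.subNbrs, inp.isCenter, inp.delay, fun k => k.elim inp.id fun _ => 0⟩).bind
    fun r => .ret (r.2, r.1 = none)

/-- There are `J` phases of `J` steps, and a step has one decision about the color and `J` about the
growth. -/
def numDecisions (C n : ℕ) : ℕ := levels C n * levels C n * (levels C n + 1)

/-- The test depends only on `n`, `R` and `ε`, which all nodes know, so all nodes take the same
branch. -/
def program (C : ℕ) (det : Bool) (inp : LocalInput) (coin : ℕ → Bool) : Proc (ℕ × Prop) :=
  if growth C inp = 0 then treeProgram inp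
  else (Proc.loop (body C det inp coin) (numDecisions C inp.n)
    (startPhase inp 0 0 inp.subNbrs)).bind fun s => .ret (s.label, inp.isCenter ∧ inp.id = s.label)

/-! ### The joint execution -/

section

variable [Fintype V] {N : Network V}

/-- All parameters of an execution but the coins. -/
structure Setup (V : Type) [Fintype V] (N : Network V) where
  O : Oracles N
  B : ℕ
  C : ℕ
  I : Input N
  μ : Sym2 V → ℕ

namespace Setup

variable (E : Setup V N)

def inp (v : V) : LocalInput := E.I.localInput E.μ v

def J : ℕ := levels E.C (Fintype.card V)

def D : ℕ := ⌊E.I.eps * E.I.radius / (8 * (E.J : ℝ≥0) ^ 2)⌋₊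

def result (t : ℕ) (p : Pos) (s : V → Loc) : V → Option ℕ × ℕ :=
  queryResult E.O E.B t fun v => arg E.J E.D p (E.inp v) (s v)

def option (t : ℕ) (p : Pos) (s : V → Loc) (b : Bool) (v : V) : Loc :=
  candidate p (s v) (E.result t p s v) b

def kindMsg (t : ℕ) (p : Pos) (s : V → Loc) (v : V) : ℕ → ℕ :=
  (response E.O E.B (t + 2) (fun v => kindRequest p (s v) (E.result t p s v)) v).msg

def finished (t : ℕ) (p : Pos) (s : V → Loc) (b : Bool) (v : V) : Loc :=
  finish E.J E.D p (E.option t p s b v) (readKind b (E.kindMsg t p s v))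

def mainResult (t : ℕ) (s : V → Loc) : V → Option ℕ × ℕ :=
  queryResult E.O E.B t fun v => mainArg (E.inp v) (s v)

def colorMsg (t : ℕ) (s : V → Loc) (v : V) : ℕ → ℕ :=
  (response E.O E.B (t + 2) (fun v => colorRequest (s v) (E.mainResult t s v)) v).msg

def ended (t : ℕ) (p : Pos) (s : V → Loc) (v : V) : Loc :=
  endPhase E.J p (E.inp v) (s v) (E.mainResult t s v) (E.colorMsg t s v)

/-- The states of all nodes after the decision `b`. -/
def step (t : ℕ) (p : Pos) (s : V → Loc) (b : Bool) : V → Loc :=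
  -- The offset 5 counts the query (2), the exchange of kinds (1) and the two global sums (2).
  E.ended (t + 5) p (E.finished t p s b)

/-- The decision. -/
def decide (det : Bool) (coin : V → Bool) (t : ℕ) (p : Pos) (s : V → Loc) : Bool :=
  decision det
    (∑ v, firstValue E.C E.J E.D det (coin v) p (E.inp v) (s v) (E.result t p s v)
      (E.kindMsg t p s v) % E.B)
    (∑ v, contribution E.C E.J E.D p (E.inp v) (E.option t p s true v)
      (readKind true (E.kindMsg t p s v)) % E.B)

/-- The states of all nodes after `k` decisions made according to `dec`. -/
def states (dec : ℕ → (V → Loc) → Bool) : ℕ → V → Loc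
  | 0 => fun v => startPhase (E.inp v) 0 0 (E.inp v).subNbrs
  | k + 1 => E.step (8 * k) (pos E.J k) (states dec k) (dec k (states dec k))

/-- The 8 steps are 2 for each of the two queries and 1 for each of the four calls. The schedule is
the same for every decision; the second query and the exchange of colors have an effect only at the
end of a phase. -/
theorem exec_body (det : Bool) (coin : V → ℕ → Bool) (k : ℕ) (s : V → Loc) :
    Exec E.O E.B (8 * k) (fun v => body E.C det (E.inp v) (coin v) k (s v)) (8 * (k + 1))
      (E.step (8 * k) (pos E.J k) s
        (E.decide det (fun v => coin v k) (8 * k) (pos E.J k) s)) := by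
  refine (Exec.query _ _).bind ?_
  refine (Exec.call _ _).bind ?_
  refine (Exec.call _ _).bind ?_
  refine (Exec.call _ _).bind ?_
  refine (Exec.query _ _).bind ?_
  refine (Exec.call _ _).bind ?_
  exact Exec.ret _ _

theorem exec_program (det : Bool) (coin : V → ℕ → Bool) (hD : E.D ≠ 0) :
    Exec E.O E.B 0 (fun v => program E.C det (E.inp v) (coin v))
      (8 * numDecisions E.C (Fintype.card V))
      (fun v =>
        let s := E.states (fun k => E.decide det (fun v => coin v k) (8 * k) (pos E.J k))
          (numDecisions E.C (Fintype.card V))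
        ((s v).label, v ∈ E.I.centers ∧ N.id v = (s v).label)) := by
  have h : ∀ v, growth E.C (E.inp v) ≠ 0 := fun v => hD
  simp only [program, if_neg (h _)]
  refine Exec.bind (a := E.states (fun k => E.decide det (fun v => coin v k) (8 * k) (pos E.J k))
          (numDecisions E.C (Fintype.card V))) ?_ (Exec.ret _ _)
  have h1 := Exec.loop (d := 8) (fun m a => E.exec_body det coin m a)
    (fun v => startPhase (E.inp v) 0 0 (E.inp v).subNbrs) (numDecisions E.C (Fintype.card V))
  have h2 : ∀ m, E.states (fun k => E.decide det (fun v => coin v k) (8 * k) (pos E.J k)) m =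
      Nat.rec (fun v => startPhase (E.inp v) 0 0 (E.inp v).subNbrs)
        (fun m a => E.step (8 * m) (pos E.J m) a
          (E.decide det (fun v => coin v m) (8 * m) (pos E.J m) a)) m := by
    intro m
    induction m with
    | zero => rfl
    | succ m ih => simp only [states, ih]
  rw [h2]
  exact h1

theorem exec_treeProgram (det : Bool) (coin : V → ℕ → Bool) (hD : E.D = 0) :
    Exec E.O E.B 0 (fun v => program E.C det (E.inp v) (coin v)) 2
      (fun v =>
        let r := queryResult E.O E.B 0 fun v => ⟨(E.inp v).inSub, (E.inp v).subNbrs,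
          (E.inp v).isCenter, (E.inp v).delay, fun k => k.elim (E.inp v).id fun _ => 0⟩
        ((r v).2, (r v).1 = none)) := by
  have h : ∀ v, growth E.C (E.inp v) = 0 := fun v => hD
  simp only [program, if_pos (h _)]
  exact (Exec.query _ _).bind (Exec.ret _ _)

end Setup

end

/-! ### Growth rates -/

theorem restRadius_zero (J D : ℕ) : restRadius J D 0 = D := by simp [restRadius]

theorem half_le_restRadius {J D j : ℕ} (hj : j ≤ J) :
    (D : ℝ) / 2 ^ (j + 1) ≤ restRadius J D j := by
  have h : (j : ℝ) / (2 * J) ≤ 1 / 2 := by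
    rcases Nat.eq_zero_or_pos J with rfl | hJ
    · simp
    · have : (0 : ℝ) < J := by exact_mod_cast hJ
      rw [div_le_div_iff₀ (by positivity) (by norm_num)]
      have : (j : ℝ) ≤ J := by exact_mod_cast hj
      linarith
  rw [restRadius, pow_succ, ← div_div, div_eq_mul_inv _ (2 : ℝ)]
  exact mul_le_mul_of_nonneg_left (by linarith) (by positivity)

/-- The factor `1 - j / (2 J)` makes the radius decrease by slightly more than a half. The surplus
`D / 2 ^ (j + 1) / J` absorbs the error of the distance oracle. -/
theorem restRadius_sub {J D j : ℕ} (hJ : 0 < J) :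
    restRadius J D j - restRadius J D (j + 1) = restRadius J D (j + 1) + D / 2 ^ (j + 1) / J := by
  have : (J : ℝ) ≠ 0 := by positivity
  simp only [restRadius, pow_succ]
  push_cast
  field_simp
  ring

theorem growDelay_eq {J D j : ℕ} (hj : j < J) : (growDelay J D j : ℝ) =
    (restRadius J D j - restRadius J D (j + 1)) / (1 + 1 / (3 * J)) := by
  have h1 : (0 : ℝ) ≤ restRadius J D (j + 1) :=
    le_trans (by positivity) (half_le_restRadius (D := D) (Nat.succ_le_of_lt hj))
  rw [growDelay, Real.coe_toNNReal]
  rw [restRadius_sub (by omega)]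
  positivity

/-- With this delay, nodes captured by `S` are near enough to `S` that the remaining collar still
fits into `Z`. -/
theorem mul_growDelay_le {J D j : ℕ} {η : ℝ} (hj : j < J) (hη : η ≤ 1 / (3 * J)) :
    (1 + η) * growDelay J D j ≤ restRadius J D j - restRadius J D (j + 1) := by
  have h0 := NNReal.coe_nonneg (growDelay J D j)
  have h1 : (0 : ℝ) < 1 + 1 / (3 * J) := by positivity
  have h2 := growDelay_eq (D := D) hj
  rw [eq_div_iff h1.ne'] at h2
  nlinarith

/-- With this delay, a node within the next radius of `S` cannot be assigned to a root outside `S`.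
-/
theorem mul_restRadius_lt {J D j : ℕ} {η : ℝ} (hj : j < J) (hη : η ≤ 1 / (3 * J)) (hD : 0 < D) :
    (1 + η) * restRadius J D (j + 1) < growDelay J D j := by
  have hJ : (0 : ℝ) < J := by exact_mod_cast (by omega : 0 < J)
  have hD' : (0 : ℝ) < D := by exact_mod_cast hD
  have h1 : (0 : ℝ) < 1 + 1 / (3 * J) := by positivity
  rw [growDelay_eq hj, lt_div_iff₀ h1, restRadius_sub (by omega)]
  set θ : ℝ := 1 / (3 * J) with hθ
  have h3 : (1 : ℝ) / J = 3 * θ := by rw [hθ]; field_simp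
  have hθ0 : 0 < θ := by positivity
  have hθ1 : θ ≤ 1 / 3 := by
    rw [hθ, div_le_div_iff₀ (by positivity) (by norm_num)]
    have : (1 : ℝ) ≤ J := by exact_mod_cast (by omega : 1 ≤ J)
    linarith
  set X : ℝ := D / 2 ^ (j + 1) with hX
  have hX0 : 0 < X := by positivity
  have h4 : restRadius J D (j + 1) ≤ X := by
    rw [restRadius]
    have : (0 : ℝ) ≤ ((j + 1 : ℕ) : ℝ) / (2 * J) := by positivity
    nlinarith
  have h5 : (0 : ℝ) ≤ restRadius J D (j + 1) :=
    le_trans (by positivity) (half_le_restRadius (D := D) (Nat.succ_le_of_lt hj))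
  have h6 : X / J = 3 * θ * X := by rw [div_eq_mul_one_div, h3]; ring
  rw [h6]
  have h7 : (1 + η) * restRadius J D (j + 1) * (1 + θ) ≤
      restRadius J D (j + 1) * ((1 + θ) * (1 + θ)) := by
    have : (1 + η) ≤ 1 + θ := by linarith
    nlinarith [mul_nonneg h5 hθ0.le]
  -- It remains to see that `(1 + θ)² r < r + 3 θ X` for `r = restRadius J D (j + 1) ≤ X`; this
  -- holds because `2 θ + θ² < 3 θ`.
  nlinarith [mul_le_mul_of_nonneg_right h4 (by positivity : (0:ℝ) ≤ 2 * θ + θ * θ),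
    mul_pos hθ0 hX0, mul_pos (mul_pos hθ0 hθ0) hX0]

/-! ### Invariants -/

/-- The part of the state of a node that matters between the steps. -/
structure Core where
  label : ℕ
  live : Set ℕ
  act : Prop
  color : Bool
  entry : Prop
  ecol : Bool
  edel : ℝ≥0

def Loc.core (s : Loc) : Core := ⟨s.label, s.live, s.act, s.color, s.entry, s.ecol, s.edel⟩

namespace Setup

variable [Fintype V] {N : Network V} (E : Setup V N)

/-- The assumptions on an execution, where `η` is the precision of the distance oracle. -/
structure Good (η : ℝ) : Prop where
  correct : E.O.Correct η (2 * E.I.radius)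
  nonneg : 0 ≤ η
  poly : N.PolyBounded E.C
  valid : E.I.Valid E.C
  two_le : 2 ≤ Fintype.card V
  growth_pos : 0 < E.D
  le_third : η ≤ 1 / (3 * E.J)
  mul_le : η * (4 * E.I.radius) ≤ E.D
  budget : 7 * (E.J : ℝ) ^ 2 * E.D ≤ E.I.eps * E.I.radius
  bandwidth : E.B = Fintype.card V ^ (5 * E.C + 6)

/-- Adjacency in the graph of the current phase. -/
def Adj (k : V → Core) (u v : V) : Prop := E.I.sub.Adj u v ∧ (k u).label = (k v).label

/-- Adjacency of undecided nodes. -/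
def ActAdj (k : V → Core) (u v : V) : Prop := E.Adj k u v ∧ (k u).act ∧ (k v).act

/-- The node `v` has been assigned the color `c`. -/
def Decided (k : V → Core) (c : Bool) (v : V) : Prop :=
  v ∈ E.I.sub.verts ∧ ¬ (k v).act ∧ (k v).color = c

/-- The centers of color `c` that are still available in phase `i`. -/
def Terminal (k : V → Core) (i : ℕ) (c : Bool) (q : V) : Prop :=
  q ∈ E.I.centers ∧ N.id q % 2 ^ i = (k q).label ∧ (N.id q).testBit i = c

def baseDist (v : V) : ℝ := (N.delDistSet E.I.sub E.I.delay E.I.centers v).toReal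

/-- The invariant at the beginning of a step of phase `i`; distances have grown by at most
`x`. -/
structure StepInv (i : ℕ) (x : ℝ) (k : V → Core) : Prop where
  label_lt : ∀ v, (k v).label < 2 ^ i
  live : ∀ v ∈ E.I.sub.verts, (k v).live = N.id '' {u | E.Adj k v u}
  act_mem : ∀ v, (k v).act → v ∈ E.I.sub.verts
  act_reach : ∀ v, (k v).act → ∃ r, (k r).entry ∧ (k r).act ∧ ∃ d,
    Reach (E.ActAdj k) N.len r v d ∧ ((k r).edel : ℝ) + d ≤ E.baseDist v + x
  -- An entry stands for a center: its delay pays for a route on which every node except possibly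
  -- the entry itself is already decided with the color of the entry. Such a route cannot be cut any
  -- more once the entry takes that color.
  entry_reach : ∀ r, (k r).entry → (k r).act → ∃ q d, E.Terminal k i (k r).ecol q ∧
    (E.Decided k (k r).ecol q ∨ q = r) ∧
    Reach (fun a b => E.Adj k a b ∧ (E.Decided k (k r).ecol a ∨ a = r) ∧
      (E.Decided k (k r).ecol b ∨ b = r)) N.len q r d ∧
    (E.I.delay q : ℝ) + d ≤ (k r).edel
  decided_reach : ∀ v ∈ E.I.sub.verts, ¬ (k v).act → ∃ q d, E.Terminal k i (k v).color q ∧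
    E.Decided k (k v).color q ∧
    Reach (fun a b => E.Adj k a b ∧ E.Decided k (k v).color a ∧ E.Decided k (k v).color b)
      N.len q v d ∧ (E.I.delay q : ℝ) + d ≤ E.baseDist v + x

variable {E} {η : ℝ}

theorem Adj.symm {k : V → Core} {u v : V} (h : E.Adj k u v) : E.Adj k v u :=
  ⟨h.1.symm, h.2.symm⟩

theorem ActAdj.symm {k : V → Core} {u v : V} (h : E.ActAdj k u v) : E.ActAdj k v u :=
  ⟨h.1.symm, h.2.2, h.2.1⟩

theorem delDistSet_ne_top (h : E.I.Valid E.C) {v : V} (hv : v ∈ E.I.sub.verts) :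
    N.delDistSet E.I.sub E.I.delay E.I.centers v ≠ ⊤ :=
  ((h.dist_le v hv).trans_lt ENNReal.coe_lt_top).ne

theorem baseDist_le (h : E.I.Valid E.C) {v : V} (hv : v ∈ E.I.sub.verts) :
    E.baseDist v ≤ E.I.radius :=
  ENNReal.toReal_le_of_le_ofReal (NNReal.coe_nonneg _) (by simpa using h.dist_le v hv)

theorem exists_reach_baseDist (h : E.I.Valid E.C) {v : V} (hv : v ∈ E.I.sub.verts) :
    ∃ q ∈ E.I.centers, ∃ d : ℕ, Reach E.I.sub.Adj N.len q v d ∧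
      (E.I.delay q : ℝ) + d ≤ E.baseDist v := by
  have hne := delDistSet_ne_top h hv
  obtain ⟨q, hq, d, hd, hle⟩ := N.exists_reach_le_delDistSet hne
  refine ⟨q, hq, d, hd, ?_⟩
  have h1 := ENNReal.toReal_mono hne hle
  rw [ENNReal.toReal_add (by simp) (by simp)] at h1
  simpa [baseDist] using h1

theorem Good.baseDist_le (h : E.Good η) {v : V} (hv : v ∈ E.I.sub.verts) :
    E.baseDist v ≤ E.I.radius :=
  Setup.baseDist_le h.valid hv

theorem Good.levels_pos (_ : E.Good η) : 0 < E.J := by simp [J, levels]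

theorem Good.growth_le (h : E.Good η) : (E.D : ℝ) ≤ E.I.radius := by
  have h1 : (1 : ℝ) ≤ E.J := by exact_mod_cast h.levels_pos
  have h2 : (E.I.eps : ℝ) ≤ 1 := by exact_mod_cast h.valid.eps_le
  have h3 := h.budget
  have h4 : (0 : ℝ) ≤ E.D := by positivity
  have h5 := NNReal.coe_nonneg E.I.radius
  have h6 : (1 : ℝ) ≤ (E.J : ℝ) ^ 2 := one_le_pow₀ h1
  nlinarith [mul_le_mul_of_nonneg_right h6 h4, mul_le_mul_of_nonneg_right h2 h5]

theorem Good.eps_mul_le (h : E.Good η) : (E.I.eps : ℝ) * E.I.radius ≤ E.I.radius := by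
  have h2 : (E.I.eps : ℝ) ≤ 1 := by exact_mod_cast h.valid.eps_le
  nlinarith [NNReal.coe_nonneg E.I.radius]

theorem Good.one_le_growth (h : E.Good η) : (1 : ℝ) ≤ E.D := by exact_mod_cast h.growth_pos

/-- Every distance to which this is applied is at most `4 R`, so a use of the oracle costs an
additive `D` instead of a factor. -/
theorem Good.approx (h : E.Good η) {y : ℝ} (hy : y ≤ 4 * E.I.radius) :
    (1 + η) * y ≤ y + E.D := by
  have h1 := h.mul_le
  have h2 := h.nonneg
  nlinarith [mul_le_mul_of_nonneg_left hy h2]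

theorem Good.radius_le (h : E.Good η) : (E.I.radius : ℝ) ≤ (Fintype.card V : ℝ) ^ E.C := by
  exact_mod_cast h.valid.radius_le

theorem Good.le_bandwidth (h : E.Good η) : 8 * Fintype.card V ^ E.C ≤ E.B := by
  rw [h.bandwidth]
  have h2 := h.two_le
  calc 8 * Fintype.card V ^ E.C = 2 ^ 3 * Fintype.card V ^ E.C := by norm_num
    _ ≤ Fintype.card V ^ 3 * Fintype.card V ^ E.C := by gcongr
    _ = Fintype.card V ^ (3 + E.C) := (pow_add _ _ _).symm
    _ ≤ _ := Nat.pow_le_pow_right (by omega) (by omega)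

theorem Good.len_pos (h : E.Good η) {u v : V} (huv : E.I.sub.Adj u v) : 1 ≤ N.len s(u, v) :=
  h.poly.len_pos _ (E.I.sub.adj_sub huv)

theorem Good.len_le (h : E.Good η) {u v : V} (huv : E.I.sub.Adj u v) :
    N.len s(u, v) ≤ Fintype.card V ^ E.C :=
  h.poly.len_le _ (E.I.sub.adj_sub huv)

theorem atNbr_id (hid : Function.Injective N.id) {u v : V} (huv : N.graph.Adj v u)
    (f : V → ℕ) : N.atNbr v f (N.id u) = f u := by
  rw [Network.atNbr, Finset.sum_eq_single u]
  · intro w hw hwu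
    exact absurd (hid (Finset.mem_filter.1 hw).2.2) hwu
  · intro hu
    exact absurd (Finset.mem_filter.2 ⟨Finset.mem_univ _, huv, rfl⟩) hu

theorem Good.msg_eq (h : E.Good η) {u v : V} (huv : E.I.sub.Adj v u) (t : ℕ)
    {q : V → Request} (hq : (q u).msg (N.id v) < 16) :
    (response E.O E.B t q v).msg (N.id u) = (q u).msg (N.id v) := by
  have h1 : (response E.O E.B t q v).msg (N.id u) = (q u).msg (N.id v) % E.B :=
    atNbr_id h.poly.id_injective (E.I.sub.adj_sub huv) _
  rw [h1, Nat.mod_eq_of_lt]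
  refine hq.trans_le ?_
  rw [h.bandwidth]
  calc 16 ≤ 2 ^ (5 * E.C + 6) := by
        rw [pow_add]
        have := Nat.one_le_two_pow (n := 5 * E.C)
        omega
    _ ≤ _ := Nat.pow_le_pow_left h.two_le _

theorem Good.inp_len (h : E.Good η) {u v : V} (huv : E.I.sub.Adj v u) :
    (E.inp v).len (N.id u) = N.len s(v, u) :=
  atNbr_id h.poly.id_injective (E.I.sub.adj_sub huv) _

theorem Good.inp_weight (h : E.Good η) {u v : V} (huv : E.I.sub.Adj v u) :
    (E.inp v).weight (N.id u) = E.μ s(v, u) :=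
  atNbr_id h.poly.id_injective (E.I.sub.adj_sub huv) _

/-! ### Meaning of the two kinds of forest queries -/

section Spec

variable {i : ℕ} {x : ℝ} {s : V → Loc}

theorem StepInv.mem_live (h : E.Good η) (hs : E.StepInv i x k) {u v : V}
    (hv : v ∈ E.I.sub.verts) : N.id u ∈ (k v).live ↔ E.Adj k v u := by
  rw [hs.live v hv]
  exact h.poly.id_injective.mem_set_image

theorem StepInv.actAdj_iff (h : E.Good η) (hs : E.StepInv i x k) (u v : V) :
    E.ActAdj k u v ↔ N.graph.Adj u v ∧ ((k u).act ∧ (k v).act) ∧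
      (N.id v ∈ (k u).live ∧ N.id u ∈ (k v).live) := by
  constructor
  · rintro ⟨h1, h2, h3⟩
    exact ⟨E.I.sub.adj_sub h1.1, ⟨h2, h3⟩, (hs.mem_live h (hs.act_mem u h2)).2 h1,
      (hs.mem_live h (hs.act_mem v h3)).2 h1.symm⟩
  · rintro ⟨-, ⟨h2, h3⟩, h4, -⟩
    exact ⟨(hs.mem_live h (hs.act_mem u h2)).1 h4, h2, h3⟩

/-- The set of nodes that a growth query adds to `S`. -/
theorem grow_spec (h : E.Good η) (hs : E.StepInv i x fun v => (s v).core)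
    (hS : ∀ v, (s v).S → (s v).act) {j : ℕ} (hj : j < E.J) (t : ℕ) {r : V → Option ℕ × ℕ}
    (hr : r = queryResult E.O E.B t fun v => growArg E.J E.D j (s v)) :
    (∀ u v d, (s u).S → Reach (E.ActAdj fun v => (s v).core) N.len u v d →
      (d : ℝ) ≤ restRadius E.J E.D (j + 1) → (s v).act ∧ (r v).2 = 1) ∧
    ∀ v, (s v).act → (r v).2 = 1 → ∃ b, (s b).S ∧ ∃ d,
      Reach (fun a b => E.ActAdj (fun v => (s v).core) a b ∧ ((s a).act ∧ (r a).2 = 1) ∧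
        ((s b).act ∧ (r b).2 = 1)) N.len b v d ∧
      (d : ℝ) ≤ restRadius E.J E.D j - restRadius E.J E.D (j + 1) := by
  have hρ := mul_growDelay_le (D := E.D) hj h.le_third
  have hρ' := mul_restRadius_lt hj h.le_third h.growth_pos
  have hρ0 := NNReal.coe_nonneg (growDelay E.J E.D j)
  have hη := h.nonneg
  have hρD : (1 + η) * (growDelay E.J E.D j : ℝ) ≤ E.D := by
    have h1 : restRadius E.J E.D j ≤ E.D := by
      rw [restRadius]
      have h2 : (0 : ℝ) ≤ j / (2 * E.J) := by positivity
      have h3 : (E.D : ℝ) / 2 ^ j ≤ E.D := div_le_self (by positivity) (one_le_pow₀ (by norm_num))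
      have h4 : (0 : ℝ) ≤ (E.D : ℝ) / 2 ^ j := by positivity
      nlinarith
    have h2 : (0 : ℝ) ≤ restRadius E.J E.D (j + 1) :=
      le_trans (by positivity) (half_le_restRadius (D := E.D) (Nat.succ_le_of_lt hj))
    linarith
  have hdel : ∀ v, ((growArg E.J E.D j (s v)).delay : ℝ) ≤ growDelay E.J E.D j := by
    intro v
    simp only [growArg]
    split_ifs
    · exact hρ0
    · exact le_rfl
  have hB : 1 < E.B := by
    have := h.le_bandwidth
    have : 1 ≤ Fintype.card V ^ E.C := Nat.one_le_pow _ _ (by have := h.two_le; omega)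
    omega
  obtain ⟨par, root, dep, hF, -, hnone, hsome⟩ := queryResult_spec (B := E.B) h.correct h.nonneg
    h.poly.id_injective h.poly.len_pos t (fun v => growArg E.J E.D j (s v))
    (hs.actAdj_iff h) (fun v hv => hv)
    (fun v hv => ⟨v, hv, 0, .refl v, by
      have h1 := h.growth_le
      have h2 := mul_le_mul_of_nonneg_left (hdel v) (by linarith : 0 ≤ 1 + η)
      have h3 := NNReal.coe_nonneg E.I.radius
      push_cast
      rw [add_zero]
      linarith⟩)
    (fun v hv => ⟨fun _ _ => by simp only [growArg]; split_ifs <;> omega,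
      fun p _ => by simp only [growArg, reduceCtorEq, false_and, if_false]; omega⟩)
  -- Only roots submit nonzero values, so the sum over the ancestors tells whether the root lies in
  -- `S`.
  have hsum : ∀ v, (s v).act → (r v).2 = if (s (root v)).S then 1 else 0 := by
    refine hF.induct (fun v hv hn => ?_) fun v hv p hp hvp ih => ?_
    · rw [hr, hnone v hv hn, (hF.of_none v hv hn).1]
      simp [growArg]
    · rw [hr, hsome v hv p hvp, ← hr, ih, (hF.of_some v hv p hvp).2.2.1]
      simp [growArg]
  constructor
  · intro u v d hu hd hdle
    have hv : (s v).act := hd.preserves (p := fun v => (s v).act) (fun a b hab _ => hab.2.2) (hS u hu)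
    refine ⟨hv, ?_⟩
    rw [hsum v hv, if_pos]
    -- A root outside `S` has delay `growDelay`, which exceeds `(1 + η)` times the distance from
    -- `S`.
    by_contra hroot
    have h1 := hF.acc v hv u (hS u hu) d hd
    simp only [growArg, if_neg hroot, if_pos hu] at h1
    have h2 : (0 : ℝ) ≤ dep v := by positivity
    have h3 := mul_le_mul_of_nonneg_left hdle (by linarith : 0 ≤ 1 + η)
    push_cast at h1
    linarith
  · intro v hv hv1
    have hroot : (s (root v)).S := by
      rw [hsum v hv] at hv1
      by_contra hc
      simp [hc] at hv1
    refine ⟨root v, hroot, dep v, ?_, ?_⟩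
    · have hvr : root (root v) = root v :=
        (hF.of_none _ (hS _ hroot) (hF.par_root v hv)).1
      have h1 : ∀ a, root a = root v → (s a).act → (r a).2 = 1 := by
        intro a ha haa
        rw [hsum a haa, ha, if_pos hroot]
      have h2 := hF.reach (fun a b => ActAdj.symm) v hv
      clear hv1
      have : ∀ w d, Reach (fun a b => E.ActAdj (fun v => (s v).core) a b ∧ root a = root b)
          N.len (root v) w d → root w = root v ∧
          Reach (fun a b => E.ActAdj (fun v => (s v).core) a b ∧ ((s a).act ∧ (r a).2 = 1) ∧
            ((s b).act ∧ (r b).2 = 1)) N.len (root v) w d := by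
        intro w d hd
        induction hd with
        | refl => exact ⟨hvr, .refl _⟩
        | tail _ hA ih =>
          exact ⟨hA.2.symm.trans ih.1, ih.2.tail ⟨hA.1, ⟨hA.1.2.1, h1 _ ih.1 hA.1.2.1⟩,
            ⟨hA.1.2.2, h1 _ (hA.2.symm.trans ih.1) hA.1.2.2⟩⟩⟩
      exact (this v _ h2).2
    -- Every undecided node is itself a center of this query, with delay at most `growDelay`;
    -- compared with it, the root in `S` cannot be far.
    · have h1 := hF.acc v hv v hv 0 (.refl v)
      have h2 := mul_le_mul_of_nonneg_left (hdel v) (by linarith : 0 ≤ 1 + η)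
      have h3 := NNReal.coe_nonneg (growArg E.J E.D j (s (root v))).delay
      push_cast at h1
      rw [add_zero] at h1
      linarith

/-- What the nodes learn from a query for a forest rooted at the entries. -/
theorem main_spec (h : E.Good η) {k : V → Core} (hs : E.StepInv i x k)
    (hk : ∀ v, (s v).core = k v)
    (hx : x + E.D ≤ E.I.eps * E.I.radius) (t : ℕ) :
    ∃ par root dep,
      SpanningForest (E.ActAdj k) N.len {v | (k v).act} {v | (k v).entry ∧ (k v).act}
        (fun v => (k v).edel) η par root dep ∧
      (∀ v, (E.mainResult t s v).1 = (par v).map N.id) ∧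
      ∀ v, (k v).act → (E.mainResult t s v).2 =
        2 * (⌈(k (root v)).edel⌉₊ + dep v) + (k (root v)).ecol.toNat := by
  have hB := h.le_bandwidth
  have hC : 1 ≤ Fintype.card V ^ E.C := Nat.one_le_pow _ _ (by have := h.two_le; omega)
  have hk' : (fun v => (s v).core) = k := funext hk
  subst hk'
  obtain ⟨par, root, dep, hF, hpar, hnone, hsome⟩ := queryResult_spec (B := E.B) h.correct h.nonneg
    h.poly.id_injective h.poly.len_pos t (fun v => mainArg (E.inp v) (s v))
    (hs.actAdj_iff h) (fun v hv => hv.2)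
    (fun v hv => by
      obtain ⟨r, hr1, hr2, d, hd, hle⟩ := hs.act_reach v hv
      refine ⟨r, ⟨hr1, hr2⟩, d, hd, ?_⟩
      have h1 := h.baseDist_le (hs.act_mem v hv)
      have h2 := h.eps_mul_le
      have h3 := h.growth_le
      have h4 := NNReal.coe_nonneg E.I.radius
      -- One `D` is kept free for the error of the oracle, so that the tree distances stay within
      -- the distance parameter `2 R`.
      have h5 : ((s r).core.edel : ℝ) + d ≤ 2 * E.I.radius - E.D := by linarith
      have h6 := h.approx (y := ((s r).core.edel : ℝ) + d) (by linarith [h.one_le_growth])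
      refine h6.trans ?_
      push_cast
      linarith)
    (fun v hv => ⟨fun _ hle => by
        have h1 : (s v).edel ≤ 2 * (Fintype.card V : ℝ≥0) ^ E.C :=
          le_trans hle (mul_le_mul_of_nonneg_left h.valid.radius_le (by positivity))
        have h2 : ⌈(s v).edel⌉₊ ≤ 2 * Fintype.card V ^ E.C :=
          Nat.ceil_le.2 (by exact_mod_cast h1)
        have h3 : (s v).ecol.toNat ≤ 1 := Bool.toNat_le _
        simp only [mainArg, Option.elim_none]
        omega,
      fun p hp => by
        have h1 := h.inp_len hp.1.1
        have h2 := h.len_le hp.1.1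
        simp only [mainArg, Option.elim_some]
        rw [h1]
        omega⟩)
  refine ⟨par, root, dep, hF, hpar, ?_⟩
  refine hF.induct (fun v hv hn => ?_) fun v hv p hp hvp ih => ?_
  · obtain ⟨h1, h2⟩ := hF.of_none v hv hn
    rw [mainResult, hnone v hv hn, h1, h2]
    simp [mainArg, Loc.core]
  · obtain ⟨h1, h2, h3, h4, -⟩ := hF.of_some v hv p hvp
    rw [mainResult, hsome v hv p hvp]
    rw [mainResult] at ih
    rw [ih, h3, h4]
    simp only [mainArg, Option.elim_some]
    rw [h.inp_len h2.1.1, Sym2.eq_swap]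
    ring

end Spec

end Setup

theorem kind_lt (s : Loc) : kind s < 4 := by unfold kind; split_ifs <;> omega

theorem kind_eq_one {s : Loc} : kind s = 1 ↔ s.act ∧ s.S := by
  unfold kind; split_ifs <;> simp_all

theorem kind_eq_zero {s : Loc} : kind s = 0 ↔ ¬ s.act := by
  unfold kind; split_ifs <;> simp_all

@[simp] theorem core_candidate (p : Pos) (s : Loc) (r : Option ℕ × ℕ) (b : Bool) :
    (candidate p s r b).core = s.core := by
  unfold candidate; split_ifs <;> rfl

namespace Setup

variable [Fintype V] {N : Network V} {E : Setup V N} {η : ℝ} {i : ℕ} {x : ℝ}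

theorem Good.readKind (h : E.Good η) {u v : V} (huv : E.I.sub.Adj v u) (t : ℕ) (p : Pos)
    (s : V → Loc) (b : Bool) :
    readKind b (E.kindMsg t p s v) (N.id u) = kind (E.option t p s b u) := by
  have h0 := kind_lt (E.option t p s false u)
  have h1 := kind_lt (E.option t p s true u)
  have h2 : E.kindMsg t p s v (N.id u) =
      kind (E.option t p s false u) + 4 * kind (E.option t p s true u) :=
    h.msg_eq huv _ (by
      show kind (E.option t p s false u) + 4 * kind (E.option t p s true u) < 16
      omega)
  cases b <;> simp only [EdgeCutting.readKind, h2] <;> simp <;> omega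

theorem Good.colorMsg (h : E.Good η) {u v : V} (huv : E.I.sub.Adj v u) (t : ℕ) (s : V → Loc) :
    E.colorMsg t s v (N.id u) = (lastColor (s u) (E.mainResult t s u)).toNat :=
  h.msg_eq huv _ (by
    show (lastColor (s u) (E.mainResult t s u)).toNat < 16
    have := Bool.toNat_le (lastColor (s u) (E.mainResult t s u))
    omega)

/-! ### Invariants within a step -/

/-- The invariant after a decision: the nodes know a forest, color `c` grows, and at most
`restRadius J D j` of growth is left. -/
structure LevelInv (E : Setup V N) (η : ℝ) (i : ℕ) (x : ℝ) (c : Bool) (j : ℕ) (s : V → Loc) :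
    Prop where
  step : E.StepInv i x fun v => (s v).core
  forest : ∃ par root dep,
    SpanningForest (E.ActAdj fun v => (s v).core) N.len {v | (s v).act}
      {v | (s v).entry ∧ (s v).act} (fun v => (s v).edel) η par root dep ∧
    ∀ v, (s v).act → (s v).par = (par v).map N.id ∧
      (s v).fhat = ⌈(s (root v)).edel⌉₊ + dep v ∧ (s v).tcol = (s (root v)).ecol
  ccol_eq : ∀ v, (s v).act → (s v).ccol = c
  act_of_S : ∀ v, (s v).S → (s v).act
  S_of_tcol : ∀ v, (s v).act → (s v).tcol = c → (s v).S
  S_reach : ∀ v, (s v).S → ∃ b, (s b).act ∧ (s b).tcol = c ∧ ∃ d,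
    Reach (fun a b => E.ActAdj (fun v => (s v).core) a b ∧ (s a).S ∧ (s b).S) N.len b v d ∧
    (d : ℝ) ≤ E.D - restRadius E.J E.D j
  Z_of_reach : ∀ u v d, (s u).S → Reach (E.ActAdj fun v => (s v).core) N.len u v d →
    (d : ℝ) ≤ restRadius E.J E.D j → (s v).Z

/-- Initially `S` is the union of the trees of color `b` and `Z` contains all undecided nodes.
Nothing of the growth `D` is used up, since `restRadius` is `D` at level 0. -/
theorem LevelInv.of_color (h : E.Good η) {s : V → Loc} (hs : E.StepInv i x fun v => (s v).core)
    (hx : x + E.D ≤ E.I.eps * E.I.radius) {p : Pos} (hp : p.j = 0) (t : ℕ) (b : Bool) :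
    E.LevelInv η i x b 0 (E.option t p s b) := by
  have hr : E.result t p s = E.mainResult t s := by
    simp only [result, mainResult, arg, if_pos hp]
  obtain ⟨par, root, dep, hF, h1, h2⟩ := main_spec h hs (fun v => rfl) hx t
  have hc : (fun v => (E.option t p s b v).core) = fun v => (s v).core := by
    funext v
    exact core_candidate _ _ _ _
  have he : ∀ v, E.option t p s b v = { s v with
      par := (E.mainResult t s v).1, fhat := (E.mainResult t s v).2 / 2,
      tcol := (E.mainResult t s v).2.testBit 0, ccol := b,
      S := (s v).act ∧ (E.mainResult t s v).2.testBit 0 = b, Z := (s v).act } := by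
    intro v
    simp only [option, candidate, if_pos hp, hr]
  constructor
  · rw [hc]; exact hs
  · refine ⟨par, root, dep, ?_, fun v hv => ?_⟩
    · simp only [he]; exact hF
    · rw [he v] at hv ⊢
      simp only [he, h1, h2 v hv, true_and]
      have := Bool.toNat_le (s (root v)).ecol
      refine ⟨by simp only [Loc.core]; omega, ?_⟩
      simp only [Loc.core]
      rw [Nat.testBit_zero]
      cases (s (root v)).ecol <;> simp
  · intro v _; rw [he v]
  · intro v hv; rw [he v] at hv ⊢; exact hv.1
  · intro v hv ht; rw [he v] at hv ht ⊢; exact ⟨hv, ht⟩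
  · intro v hv
    refine ⟨v, ?_, ?_, 0, .refl v, by rw [restRadius_zero]; simp⟩
    · rw [he v] at hv ⊢; exact hv.1
    · rw [he v] at hv ⊢; exact hv.2
  · rw [hc]
    intro u v d hu hd _
    rw [he] at hu ⊢
    exact hd.preserves (p := fun v => (s v).act) (fun a b hab _ => hab.2.2) hu.1

/-- The data of the growth query of a level. -/
theorem LevelInv.grow (h : E.Good η) {s : V → Loc} {c : Bool} {j : ℕ}
    (hs : E.LevelInv η i x c j s) (hj : j < E.J) {p : Pos} (hp : p.j = j + 1) (t : ℕ) :
    (∀ u v d, (s u).S → Reach (E.ActAdj fun v => (s v).core) N.len u v d →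
      (d : ℝ) ≤ restRadius E.J E.D (j + 1) → (s v).act ∧ (E.result t p s v).2 = 1) ∧
    ∀ v, (s v).act → (E.result t p s v).2 = 1 → ∃ b, (s b).S ∧ ∃ d,
      Reach (fun a b => E.ActAdj (fun v => (s v).core) a b ∧
        ((s a).act ∧ (E.result t p s a).2 = 1) ∧ ((s b).act ∧ (E.result t p s b).2 = 1))
        N.len b v d ∧ (d : ℝ) ≤ restRadius E.J E.D j - restRadius E.J E.D (j + 1) := by
  refine grow_spec h hs.step hs.act_of_S hj t ?_
  have h1 : p.j - 1 = j := by omega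
  simp only [result, arg, if_neg (by omega : ¬ p.j = 0), h1]

theorem restRadius_nonneg {J D j : ℕ} (hj : j ≤ J) : 0 ≤ restRadius J D j :=
  le_trans (by positivity) (half_le_restRadius hj)

/-- The set `M` of nodes captured by `S` contains the collar of width `restRadius (j + 1)` around
`S`, which allows `Z := M`. It also lies within `restRadius j - restRadius (j + 1)` of `S`, so a
collar of the new width around `M` is contained in the old one, which allows `S := M`. -/
theorem LevelInv.of_grow (h : E.Good η) {s : V → Loc} {c : Bool} {j : ℕ}
    (hs : E.LevelInv η i x c j s) (hj : j < E.J) {p : Pos} (hp : p.j = j + 1) (t : ℕ) (b : Bool) :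
    E.LevelInv η i x c (j + 1) (E.option t p s b) := by
  obtain ⟨hM, hM'⟩ := hs.grow h hj hp t
  have hr := restRadius_nonneg (D := E.D) (Nat.succ_le_of_lt hj)
  have hr' := restRadius_sub (D := E.D) (j := j) (by omega : 0 < E.J)
  have hr2 : (0 : ℝ) ≤ (E.D : ℝ) / 2 ^ (j + 1) / E.J := by positivity
  have hc : (fun v => (E.option t p s b v).core) = fun v => (s v).core := by
    funext v
    exact core_candidate _ _ _ _
  have hp0 : ¬ p.j = 0 := by omega
  obtain ⟨par, root, dep, hF, hpar⟩ := hs.forest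
  cases b with
  | false =>
    have he : ∀ v, E.option t p s false v =
        { s v with Z := (s v).act ∧ (E.result t p s v).2 = 1 } := by
      intro v
      simp only [option, candidate, if_neg hp0, Bool.false_eq_true, if_false]
    constructor
    · rw [hc]; exact hs.step
    · refine ⟨par, root, dep, ?_⟩
      simp only [he]; exact ⟨hF, hpar⟩
    · simp only [he]; exact hs.ccol_eq
    · simp only [he]; exact hs.act_of_S
    · simp only [he]; exact hs.S_of_tcol
    · simp only [he]
      intro v hv
      obtain ⟨b, h1, h2, d, h3, h4⟩ := hs.S_reach v hv
      exact ⟨b, h1, h2, d, h3, by linarith⟩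
    · simp only [he]
      exact hM
  | true =>
    have he : ∀ v, E.option t p s true v =
        { s v with S := (s v).act ∧ (E.result t p s v).2 = 1 } := by
      intro v
      simp only [option, candidate, if_neg hp0, if_true]
    have hSM : ∀ v, (s v).S → (s v).act ∧ (E.result t p s v).2 = 1 :=
      fun v hv => hM v v 0 hv (.refl v) (by simpa using hr)
    constructor
    · rw [hc]; exact hs.step
    · refine ⟨par, root, dep, ?_⟩
      simp only [he]; exact ⟨hF, hpar⟩
    · simp only [he]; exact hs.ccol_eq
    · simp only [he]; exact fun v hv => hv.1
    · simp only [he]; exact fun v hv ht => hSM v (hs.S_of_tcol v hv ht)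
    · simp only [he]
      intro v hv
      obtain ⟨u, hu, d, h1, h2⟩ := hM' v hv.1 hv.2
      obtain ⟨b, h3, h4, d', h5, h6⟩ := hs.S_reach u hu
      refine ⟨b, h3, h4, d' + d, (h5.mono fun a b hab => ⟨hab.1, hSM a hab.2.1, hSM b hab.2.2⟩).trans
        h1, ?_⟩
      push_cast
      linarith
    · simp only [he]
      intro u v d hu hd hle
      obtain ⟨w, hw, d', h1, h2⟩ := hM' u hu.1 hu.2
      refine hs.Z_of_reach w v (d' + d) hw ((h1.mono fun a b hab => hab.1).trans hd) ?_
      push_cast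
      linarith

/-! ### The end of a step -/

theorem Terminal.congr {k k' : V → Core} (hl : ∀ v, (k' v).label = (k v).label) {c : Bool} {q : V}
    (h : E.Terminal k i c q) : E.Terminal k' i c q :=
  ⟨h.1, by rw [hl]; exact h.2.1, h.2.2⟩

/-- The loss `5 D` is composed of `D` for the approximate forest, at most `D` for rounding entry
delays up to integers, and `3 D` by which the delays of new entries exceed their rounded tree
distances. These `3 D` consist of going from a competing root out to `S` and back (twice the growth,
at most `2 D`) and one more error of the oracle. -/
theorem LevelInv.finish (h : E.Good η) {s : V → Loc} {c : Bool}
    (hs : E.LevelInv η i x c E.J s) (hx : x + E.D ≤ E.I.eps * E.I.radius) {p : Pos}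
    (hp : p.j = E.J) {kinds : V → ℕ → ℕ}
    (hk : ∀ v u, E.I.sub.Adj v u → kinds v (N.id u) = kind (s u)) :
    E.StepInv i (x + 5 * E.D) fun v => (finish E.J E.D p (s v) (kinds v)).core := by
  obtain ⟨par, root, dep, hF, hpar⟩ := hs.forest
  set k : V → Core := fun v => (s v).core with hkdef
  set k' : V → Core := fun v => (EdgeCutting.finish E.J E.D p (s v) (kinds v)).core with hk'def
  set new : V → Prop := fun v => ∃ l, (s v).par = some l ∧ kinds v l = 1 with hnew
  have hk' : ∀ v, k' v = ⟨(s v).label, (s v).live, (s v).act ∧ ¬ (s v).S,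
      if (s v).act ∧ (s v).S then (s v).ccol else (s v).color, (s v).entry ∨ new v,
      if new v then (s v).ccol else (s v).ecol,
      if new v then (s v).fhat + 3 * E.D else (s v).edel⟩ := by
    intro v
    simp only [hk'def, EdgeCutting.finish, if_pos hp, Loc.core, hnew]
  have hlabel : ∀ v, (k' v).label = (k v).label := fun v => by rw [hk']; rfl
  have hAdj : ∀ u v, E.Adj k' u v ↔ E.Adj k u v := fun u v => by
    simp only [Adj, hlabel]
  have hnew' : ∀ v, (s v).act → (new v ↔ ∃ w, par v = some w ∧ (s w).S) := by
    intro v hv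
    have h1 := (hpar v hv).1
    constructor
    · rintro ⟨l, hl, hl1⟩
      rw [h1] at hl
      rcases hw : par v with _ | w
      · rw [hw] at hl; cases hl
      · rw [hw] at hl
        cases hl
        refine ⟨w, rfl, ?_⟩
        rw [hk v w (hF.of_some v hv w hw).2.1.1.1] at hl1
        exact (kind_eq_one.1 hl1).2
    · rintro ⟨w, hw, hwS⟩
      refine ⟨N.id w, by rw [h1, hw]; rfl, ?_⟩
      rw [hk v w (hF.of_some v hv w hw).2.1.1.1, kind_eq_one]
      exact ⟨hs.act_of_S w hwS, hwS⟩
  have hact : ∀ v, (k' v).act ↔ (s v).act ∧ ¬ (s v).S := fun v => by rw [hk']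
  have hActAdj : ∀ u v, E.ActAdj k u v → (k' u).act → (k' v).act → E.ActAdj k' u v :=
    fun u v huv hu hv => ⟨(hAdj u v).2 huv.1, hu, hv⟩
  have hDec : ∀ c' v, E.Decided k c' v → E.Decided k' c' v := by
    intro c' v ⟨h1, h2, h3⟩
    refine ⟨h1, fun h4 => h2 ((hact v).1 h4).1, ?_⟩
    rw [hk']
    rw [← h3]
    exact if_neg fun h4 => h2 h4.1
  have hDecS : ∀ v, (s v).S → E.Decided k' c v := by
    intro v hv
    have hv' := hs.act_of_S v hv
    refine ⟨hs.step.act_mem v hv', fun h4 => ((hact v).1 h4).2 hv, ?_⟩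
    rw [hk']
    simp only [if_pos (And.intro hv' hv)]
    exact hs.ccol_eq v hv'
  have hJ := restRadius_nonneg (D := E.D) (le_refl E.J)
  have heps := h.eps_mul_le
  have hgr := h.growth_le
  have hD1 := h.one_le_growth
  -- distances to the grown set
  have hS : ∀ v, (s v).S → ∃ q d, E.Terminal k i c q ∧ E.Decided k' c q ∧
      Reach (fun a b => E.Adj k' a b ∧ E.Decided k' c a ∧ E.Decided k' c b) N.len q v d ∧
      ∀ r, (s r).entry → (s r).act → ∀ d', Reach (E.ActAdj k) N.len r v d' →
        ((s r).edel : ℝ) + d' ≤ 3 * E.I.radius →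
        (E.I.delay q : ℝ) + d ≤ (s r).edel + d' + 3 * E.D := by
    intro v hv
    obtain ⟨b, hb, htb, db, hdb, hdbD⟩ := hs.S_reach v hv
    have hroot := hF.root_mem b hb
    have hcol : (s (root b)).ecol = c := by rw [← (hpar b hb).2.2, htb]
    -- The whole tree of `b` has root color `c` and thus lies in `S`: the route from the center to
    -- `b` is decided with color `c` from now on.
    have htree : ∀ a, (s a).act → root a = root b → (s a).S := fun a ha hab =>
      hs.S_of_tcol a ha (by rw [(hpar a ha).2.2, hab, hcol])
    have hrr : root (root b) = root b := (hF.of_none _ hroot.2 (hF.par_root b hb)).1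
    obtain ⟨q, d, hq1, hq2, hq3, hq4⟩ := hs.step.entry_reach (root b) hroot.1 hroot.2
    have hdec : ∀ a, E.Decided k (s (root b)).ecol a ∨ a = root b → E.Decided k' c a := by
      rintro a (ha | rfl)
      · rw [hcol] at ha; exact hDec _ _ ha
      · exact hDecS _ (htree _ hroot.2 hrr)
    have htr : ∀ w e, Reach (fun a b => E.ActAdj k a b ∧ root a = root b) N.len (root b) w e →
        root w = root b ∧
        Reach (fun a b => E.Adj k' a b ∧ E.Decided k' c a ∧ E.Decided k' c b)
          N.len (root b) w e := by
      intro w e he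
      induction he with
      | refl => exact ⟨hrr, .refl _⟩
      | tail _ hA ih =>
        exact ⟨hA.2.symm.trans ih.1, ih.2.tail ⟨(hAdj _ _).2 hA.1.1,
          hDecS _ (htree _ hA.1.2.1 ih.1), hDecS _ (htree _ hA.1.2.2 (hA.2.symm.trans ih.1))⟩⟩
    refine ⟨q, d + dep b + db, ?_, hdec q hq2, ((hq3.mono fun a b' hab => ⟨(hAdj _ _).2 hab.1,
      hdec a hab.2.1, hdec b' hab.2.2⟩).trans (htr _ _ (hF.reach (fun a b => ActAdj.symm) b hb)).2).trans
      (hdb.mono fun a b' hab => ⟨(hAdj _ _).2 hab.1.1, hDecS a hab.2.1, hDecS b' hab.2.2⟩), ?_⟩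
    · rw [← hcol]; exact hq1
    · intro r hr hr' d' hd' hle
      -- The root of `b` competes with `r`, whose path to `v` is continued backwards along the
      -- growth path to `b`.
      have h1 := hF.acc b hb r ⟨hr, hr'⟩ (d' + db) (hd'.trans
        ((hdb.mono fun a b' hab => hab.1).symm fun a b => ActAdj.symm))
      push_cast at h1 ⊢
      have h2 := h.approx (y := ((s r).edel : ℝ) + (d' + db)) (by linarith)
      have hq4' : (E.I.delay q : ℝ) + d ≤ (s (root b)).edel := hq4
      linarith
  have hbase : ∀ v, (s v).act → ((s (root v)).edel : ℝ) + dep v ≤ E.baseDist v + x + E.D := by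
    intro v hv
    obtain ⟨r, h1, h2, d, h3, h4⟩ := hs.step.act_reach v hv
    have h4' : ((s r).edel : ℝ) + d ≤ E.baseDist v + x := h4
    have h5 := hF.acc v hv r ⟨h1, h2⟩ d h3
    have h6 := h.baseDist_le (hs.step.act_mem v hv)
    have h7 := h.approx (y := ((s r).edel : ℝ) + d) (by linarith)
    linarith
  -- Going up the tree from `v`, either the old root is reached outside `S`, or the last node before
  -- `S` has become an entry.
  have hup : ∀ v, (s v).act → ¬ (s v).S → ∃ r, (k' r).entry ∧ (k' r).act ∧ ∃ d,
      Reach (E.ActAdj k') N.len r v d ∧ ((k' r).edel : ℝ) + d ≤ (s v).fhat + 3 * E.D := by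
    refine hF.induct (fun v hv hn hvS => ?_) fun v hv w hw hvw ih hvS => ?_
    · have h1 : ¬ new v := by
        rw [hnew' v hv, hn]
        rintro ⟨w, hw, -⟩
        cases hw
      obtain ⟨h2, h3⟩ := hF.of_none v hv hn
      have h4 := hF.root_mem v hv
      rw [h2] at h4
      refine ⟨v, ?_, (hact v).2 ⟨hv, hvS⟩, 0, .refl v, ?_⟩
      · rw [hk']; exact .inl h4.1
      · rw [hk', (hpar v hv).2.1, h2, h3]
        simp only [if_neg h1]
        have := NNReal.coe_le_coe.2 (Nat.le_ceil (s v).edel)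
        push_cast at this ⊢
        linarith
    · by_cases hwS : (s w).S
      · have h1 : new v := (hnew' v hv).2 ⟨w, hvw, hwS⟩
        refine ⟨v, ?_, (hact v).2 ⟨hv, hvS⟩, 0, .refl v, ?_⟩
        · rw [hk']; exact .inr h1
        · rw [hk']
          simp only [if_pos h1]
          push_cast
          linarith
      · obtain ⟨r, h1, h2, d, h3, h4⟩ := ih hwS
        obtain ⟨-, h5, h6, h7, -⟩ := hF.of_some v hv w hvw
        refine ⟨r, h1, h2, d + N.len s(w, v), h3.tail (hActAdj _ _ h5.symm
          ((hact w).2 ⟨hw, hwS⟩) ((hact v).2 ⟨hv, hvS⟩)), ?_⟩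
        rw [(hpar v hv).2.1, h6, h7]
        rw [(hpar w hw).2.1] at h4
        push_cast at h4 ⊢
        linarith
  constructor
  · intro v; rw [hlabel]; exact hs.step.label_lt v
  · intro v hv
    simp only [hAdj]
    rw [hk']
    exact hs.step.live v hv
  · intro v hv
    exact hs.step.act_mem v ((hact v).1 hv).1
  · intro v hv
    obtain ⟨h1, h2⟩ := (hact v).1 hv
    obtain ⟨r, h3, h4, d, h5, h6⟩ := hup v h1 h2
    refine ⟨r, h3, h4, d, h5, h6.trans ?_⟩
    have h7 := hbase v h1
    rw [(hpar v h1).2.1]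
    -- The rounding error is below 1, hence below `D`.
    have h8 : (⌈(s (root v)).edel⌉₊ : ℝ) < (s (root v)).edel + 1 := by
      have := NNReal.coe_lt_coe.2 (Nat.ceil_lt_add_one (zero_le (a := (s (root v)).edel)))
      exact_mod_cast this
    push_cast
    linarith
  · intro r hr hra
    obtain ⟨hra1, hrS⟩ := (hact r).1 hra
    by_cases hrn : new r
    · obtain ⟨w, hw, hwS⟩ := (hnew' r hra1).1 hrn
      obtain ⟨hwa, h5, h6, h7, -⟩ := hF.of_some r hra1 w hw
      obtain ⟨q, d, hq1, hq2, hq3, hq4⟩ := hS w hwS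
      have hcol : (k' r).ecol = c := by
        rw [hk']; simp only [if_pos hrn]; exact hs.ccol_eq r hra1
      have hdel : ((k' r).edel : ℝ) = (s r).fhat + 3 * E.D := by
        rw [hk']; simp only [if_pos hrn]; push_cast; rfl
      rw [hcol, hdel]
      refine ⟨q, d + N.len s(w, r), hq1.congr hlabel, .inl hq2, (hq3.mono fun a b hab =>
        ⟨hab.1, .inl hab.2.1, .inl hab.2.2⟩).tail ⟨(hAdj _ _).2 h5.symm.1, .inl (hDecS w hwS),
          .inr rfl⟩, ?_⟩
      have h8 := hbase w hwa
      have h9 := h.baseDist_le (hs.step.act_mem w hwa)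
      have h10 := hq4 (root w) (hF.root_mem w hwa).1 (hF.root_mem w hwa).2 (dep w)
        ((hF.reach (fun a b => ActAdj.symm) w hwa).mono fun a b hab => hab.1) (by linarith)
      rw [(hpar r hra1).2.1, h6, h7]
      have := NNReal.coe_le_coe.2 (Nat.le_ceil (s (root w)).edel)
      push_cast at this ⊢
      linarith
    · have he : (s r).entry := by
        rw [hk'] at hr
        exact hr.resolve_right hrn
      obtain ⟨q, d, hq1, hq2, hq3, hq4⟩ := hs.step.entry_reach r he hra1
      have hcol : (k' r).ecol = (k r).ecol := by rw [hk']; simp only [if_neg hrn]; rfl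
      have hdel : (k' r).edel = (k r).edel := by rw [hk']; simp only [if_neg hrn]; rfl
      rw [hcol, hdel]
      exact ⟨q, d, hq1.congr hlabel, hq2.imp_left (hDec _ _), hq3.mono fun a b hab =>
        ⟨(hAdj _ _).2 hab.1, hab.2.1.imp_left (hDec _ _), hab.2.2.imp_left (hDec _ _)⟩, hq4⟩
  · intro v hv hva
    by_cases hvS : (s v).S
    · have hva1 := hs.act_of_S v hvS
      obtain ⟨q, d, hq1, hq2, hq3, hq4⟩ := hS v hvS
      have hcol : (k' v).color = c := (hDecS v hvS).2.2
      rw [hcol]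
      refine ⟨q, d, hq1.congr hlabel, hq2, hq3, ?_⟩
      obtain ⟨r, h1, h2, d', h3, h4⟩ := hs.step.act_reach v hva1
      have h4' : ((s r).edel : ℝ) + d' ≤ E.baseDist v + x := h4
      have h5 := h.baseDist_le hv
      have h6 := hq4 r h1 h2 d' h3 (by linarith)
      linarith
    · have hva1 : ¬ (s v).act := fun h1 => hva ((hact v).2 ⟨h1, hvS⟩)
      obtain ⟨q, d, hq1, hq2, hq3, hq4⟩ := hs.step.decided_reach v hv hva1
      have hcol : (k' v).color = (k v).color := (hDec (k v).color v ⟨hv, hva1, rfl⟩).2.2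
      rw [hcol]
      exact ⟨q, d, hq1.congr hlabel, hDec _ _ hq2, hq3.mono fun a b hab =>
        ⟨(hAdj _ _).2 hab.1, hDec _ _ hab.2.1, hDec _ _ hab.2.2⟩, by linarith⟩

/-! ### The end of a phase -/

/-- The invariant at the beginning of a phase. -/
theorem StepInv.of_startPhase {label : V → ℕ} {live : V → Set ℕ}
    (h : E.Good η) (hlt : ∀ v, label v < 2 ^ i)
    (hlive : ∀ v ∈ E.I.sub.verts, live v = N.id '' {u | E.I.sub.Adj v u ∧ label v = label u})
    (hreach : ∀ v ∈ E.I.sub.verts, ∃ q ∈ E.I.centers, N.id q % 2 ^ i = label q ∧ ∃ d,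
      Reach (fun a b => E.I.sub.Adj a b ∧ label a = label b) N.len q v d ∧
      (E.I.delay q : ℝ) + d ≤ E.baseDist v + x) :
    E.StepInv i x fun v => (startPhase (E.inp v) i (label v) (live v)).core := by
  constructor
  · exact hlt
  · exact hlive
  · exact fun v hv => hv
  · intro v hv
    obtain ⟨q, hq, hq', d, hd, hle⟩ := hreach v hv
    exact ⟨q, ⟨hq, hq'⟩, h.valid.centers_subset hq, d, hd.mono fun a b hab =>
      ⟨hab, E.I.sub.edge_vert hab.1, E.I.sub.edge_vert hab.1.symm⟩, hle⟩
  · intro r hr _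
    exact ⟨r, 0, ⟨hr.1, hr.2, rfl⟩, .inr rfl, .refl r, by
      simp only [Nat.cast_zero, add_zero]; exact le_rfl⟩
  · intro v hv hva
    exact absurd hv hva

theorem StepInv.init (h : E.Good η) : E.StepInv 0 E.D
    fun v => (startPhase (E.inp v) 0 0 (E.inp v).subNbrs).core := by
  refine StepInv.of_startPhase (label := fun _ => 0) h (fun v => by simp)
    (fun v _ => by simp [inp, Input.localInput]) fun v hv => ?_
  obtain ⟨q, hq, d, hd, hle⟩ := exists_reach_baseDist h.valid hv
  exact ⟨q, hq, by simp [Nat.mod_one], d, hd.mono fun a b hab => ⟨hab, rfl⟩,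
    hle.trans (le_add_of_nonneg_right (by positivity))⟩

theorem testBit_zero_add (a : ℕ) (c : Bool) : (2 * a + c.toNat).testBit 0 = c := by
  cases c <;> simp [Nat.testBit_zero]

theorem label_eq_iff {a b : ℕ} (ha : a < 2 ^ i) (hb : b < 2 ^ i) (c c' : Bool) :
    a + 2 ^ i * c.toNat = b + 2 ^ i * c'.toNat ↔ a = b ∧ c = c' := by
  cases c <;> cases c' <;> simp <;> omega

/-- Undecided nodes take the color of their root. Then the route from a center through decided nodes
to the root, and the tree path from there, are monochromatic, so no route needed by the invariant is
cut; only the error of the last forest is lost. -/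
theorem StepInv.endPhase (h : E.Good η) {s : V → Loc} (hs : E.StepInv i x fun v => (s v).core)
    (hx : x + E.D ≤ E.I.eps * E.I.radius) (t : ℕ) {p : Pos} (hp : p.j = E.J ∧ p.t + 1 = E.J)
    (hpi : p.i = i) : E.StepInv (i + 1) (x + E.D) fun v => (E.ended t p s v).core := by
  obtain ⟨par, root, dep, hF, -, hres⟩ := main_spec h hs (fun v => rfl) hx t
  set k : V → Core := fun v => (s v).core with hk
  set col : V → Bool := fun v => lastColor (s v) (E.mainResult t s v) with hcol
  have hcol_act : ∀ v, (s v).act → col v = (s (root v)).ecol := by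
    intro v hv
    simp only [hcol, lastColor, if_pos hv]
    rw [hres v hv, testBit_zero_add]
    rfl
  have hcol_dec : ∀ c v, E.Decided k c v → col v = c := by
    intro c v hv
    have h1 : ¬ (s v).act := hv.2.1
    simp only [hcol, lastColor, if_neg h1]
    exact hv.2.2
  have he : (fun v => (E.ended t p s v).core) = fun v => (startPhase (E.inp v) (i + 1)
      ((k v).label + 2 ^ i * (col v).toNat)
      {l | l ∈ (k v).live ∧ E.colorMsg t s v l = (col v).toNat}).core := by
    funext v
    simp only [ended, EdgeCutting.endPhase, if_pos hp, hpi]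
    rfl
  have hlab : ∀ u v, (k u).label + 2 ^ i * (col u).toNat = (k v).label + 2 ^ i * (col v).toNat ↔
      (k u).label = (k v).label ∧ col u = col v :=
    fun u v => label_eq_iff (hs.label_lt u) (hs.label_lt v) _ _
  rw [he]
  refine StepInv.of_startPhase (label := fun v => (k v).label + 2 ^ i * (col v).toNat) h ?_ ?_ ?_
  · intro v
    have h1 := hs.label_lt v
    have h2 := Bool.toNat_le (col v)
    have h3 : 2 ^ i * (col v).toNat ≤ 2 ^ i * 1 := Nat.mul_le_mul_left _ h2
    rw [pow_succ]
    omega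
  · intro v hv
    rw [hs.live v hv]
    ext l
    simp only [Set.mem_ofPred_eq, Set.mem_image, hlab]
    constructor
    · rintro ⟨⟨u, hu, rfl⟩, h1⟩
      refine ⟨u, ⟨hu.1, hu.2, ?_⟩, rfl⟩
      rw [h.colorMsg hu.1] at h1
      have h2 : (col u).toNat = (col v).toNat := h1
      revert h2
      cases col u <;> cases col v <;> simp
    · rintro ⟨u, ⟨h1, h2, h3⟩, rfl⟩
      refine ⟨⟨u, ⟨h1, h2⟩, rfl⟩, ?_⟩
      rw [h.colorMsg h1, h3]
  · intro v hv
    -- Appending the color as bit `i` to the name reproduces the low `i + 1` bits of the identifier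
    -- of a center that received its own color.
    have hterm : ∀ q, E.Terminal k i (col q) q → q ∈ E.I.centers ∧ N.id q % 2 ^ (i + 1) =
        (k q).label + 2 ^ i * (col q).toNat := by
      intro q ⟨h1, h2, h3⟩
      exact ⟨h1, by rw [Nat.mod_pow_succ, ← Nat.toNat_testBit, h2, h3]⟩
    simp only [hlab]
    by_cases hva : (s v).act
    · have hr := hF.root_mem v hva
      have hrr : root (root v) = root v := (hF.of_none _ hr.2 (hF.par_root v hva)).1
      obtain ⟨q, d, hq1, hq2, hq3, hq4⟩ := hs.entry_reach (root v) hr.1 hr.2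
      have hc : ∀ a, E.Decided k (k (root v)).ecol a ∨ a = root v →
          col a = (k (root v)).ecol := by
        rintro a (ha | rfl)
        · exact hcol_dec _ _ ha
        · rw [hcol_act _ hr.2, hrr]; rfl
      have hq5 := hc q hq2
      rw [← hq5] at hq1
      obtain ⟨h1, h2⟩ := hterm q hq1
      refine ⟨q, h1, h2, d + dep v, (hq3.mono fun a b hab => ⟨hab.1.1, hab.1.2,
        (hc a hab.2.1).trans (hc b hab.2.2).symm⟩).trans
        ((hF.reach (fun a b => ActAdj.symm) v hva).mono fun a b hab => ⟨hab.1.1.1, hab.1.1.2,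
          by rw [hcol_act a hab.1.2.1, hcol_act b hab.1.2.2, hab.2]⟩), ?_⟩
      · obtain ⟨r, h3, h4, d', h5, h6⟩ := hs.act_reach v hva
        have h7 : ((k (root v)).edel : ℝ) + dep v ≤ (1 + η) * ((k r).edel + d') :=
          hF.acc v hva r ⟨h3, h4⟩ d' h5
        have h8 := h.baseDist_le hv
        have h9 := h.eps_mul_le
        have h10 := h.growth_le
        have h11 := h.one_le_growth
        have h12 := h.approx (y := ((k r).edel : ℝ) + d') (by linarith)
        push_cast
        linarith
    · obtain ⟨q, d, hq1, hq2, hq3, hq4⟩ := hs.decided_reach v hv hva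
      have hq5 := hcol_dec _ _ hq2
      rw [← hq5] at hq1
      obtain ⟨h1, h2⟩ := hterm q hq1
      refine ⟨q, h1, h2, d, hq3.mono fun a b hab => ⟨hab.1.1, hab.1.2, ?_⟩, ?_⟩
      · rw [hcol_dec _ _ hab.2.1, hcol_dec _ _ hab.2.2]
      · have := h.one_le_growth
        linarith

end Setup

/-! ### Costs -/

theorem kind_of_act {s : Loc} (h : s.act) : kind s = if s.S then 1 else if s.Z then 2 else 3 := by
  rw [kind, if_pos h]

/-- The two options of a level together cost at most twice as much as before. -/
theorem levelCost_add_le {J D t j l : ℕ} {S M Z S' M' Z' : Prop} (hS : S → M) (hM : M → Z)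
    (hS' : S' → M') (hM' : M' → Z')
    (h1 : S → ¬ M' → D * 2 ^ J ≤ 2 ^ j * (4 * 2 ^ J * l))
    (h2 : S' → ¬ M → D * 2 ^ J ≤ 2 ^ j * (4 * 2 ^ J * l))
    (h3 : M → ¬ Z' → D * 2 ^ J ≤ 2 ^ j * (4 * 2 ^ J * l))
    (h4 : M' → ¬ Z → D * 2 ^ J ≤ 2 ^ j * (4 * 2 ^ J * l)) :
    levelCost J D t (j + 1) l (if S then 1 else if M then 2 else 3)
        (if S' then 1 else if M' then 2 else 3) +
      levelCost J D t (j + 1) l (if M then 1 else if Z then 2 else 3)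
        (if M' then 1 else if Z' then 2 else 3) ≤
    2 * levelCost J D t j l (if S then 1 else if Z then 2 else 3)
        (if S' then 1 else if Z' then 2 else 3) := by
  have hw : 2 ^ (j + 1) * (4 * 2 ^ J * l) = 2 * (2 ^ j * (4 * 2 ^ J * l)) := by ring
  simp only [levelCost, hw]
  -- Only the length price `w`, the cap `n` and the price `X` of staying undecided matter. An edge
  -- inside `M` outside `S`, for example, costs at most `4 w + X` in one option and nothing in the
  -- other, against `2 * (2 w + X)` when the cap is not active. Edges that skip one of the nested
  -- sets would be charged in both options, but `h1` to `h4` say that they have reached the cap.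
  generalize 2 ^ j * (4 * 2 ^ J * l) = w at *
  generalize D * 2 ^ J = n at *
  generalize stepCost J D (t + 1) l = X
  by_cases a1 : S <;> by_cases a2 : M <;> by_cases a3 : Z <;> by_cases b1 : S' <;>
    by_cases b2 : M' <;> by_cases b3 : Z' <;> simp_all <;> omega

/-- The same for the choice of the color that grows. -/
theorem levelCost_zero_add_le {J D t l : ℕ} (c c' : Bool) :
    levelCost J D t 0 l (if c = false then 1 else 2) (if c' = false then 1 else 2) +
      levelCost J D t 0 l (if c = true then 1 else 2) (if c' = true then 1 else 2) ≤
    2 * stepCost J D t l := by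
  -- This identity fixes the shape of `stepCost`. With equal root colors one option costs nothing
  -- and the other at most `X + 2 w`, where `w = 4 * 2 ^ J * l`; with different root colors both
  -- options cost at most `w`.
  have hX : stepCost J D (t + 1) l + 8 * 2 ^ J * l = 2 * stepCost J D t l := by
    simp only [stepCost]; ring
  have hw : 8 * 2 ^ J * l = 2 * (2 ^ 0 * (4 * 2 ^ J * l)) := by ring
  rw [hw] at hX
  simp only [levelCost]
  generalize 2 ^ 0 * (4 * 2 ^ J * l) = w at *
  generalize D * 2 ^ J = n at *
  generalize stepCost J D (t + 1) l = X at *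
  cases c <;> cases c' <;> simp <;> omega

/-! ### Edge potentials and the invariant at every position -/

namespace Setup

variable [Fintype V] {N : Network V} (E : Setup V N)

/-- The potential of the edge `uv` in phase `i`, where `c` is the potential of an edge between
undecided nodes. -/
def potentialAt (i : ℕ) (k : V → Core) (u v : V) (c : ℕ) : ℕ :=
  if (k u).label ≠ (k v).label then E.D * 2 ^ E.J
  -- This is a reserve for the initial potentials of the phases `i + 1, …, J`, where `J` is the
  -- fictitious phase at which the run ends.
  else (E.J - i) * stepCost E.J E.D 0 (N.len s(u, v)) +
    if (k u).act ∧ (k v).act then c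
    else if ¬ (k u).act ∧ ¬ (k v).act ∧ (k u).color = (k v).color then 0
    else E.D * 2 ^ E.J

/-- The field `p.j` counts the decisions already made in the step, so the stored sets belong to
level `p.j - 1`; for `p.j = 0` no sets have been formed yet. -/
def potential (p : Pos) (s : V → Loc) (u v : V) : ℕ :=
  E.potentialAt p.i (fun v => (s v).core) u v
    (if p.j = 0 then stepCost E.J E.D p.t (N.len s(u, v))
      else levelCost E.J E.D p.t (p.j - 1) (N.len s(u, v)) (kind (s u)) (kind (s v)))

def optionPotential (t : ℕ) (p : Pos) (s : V → Loc) (b : Bool) (u v : V) : ℕ :=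
  E.potentialAt p.i (fun v => (s v).core) u v
    (levelCost E.J E.D p.t p.j (N.len s(u, v)) (kind (E.option t p s b u))
      (kind (E.option t p s b v)))

/-- The bound for the growth of the distances at a position. -/
def growthAt (i t : ℕ) : ℝ := (1 + 6 * E.J * i + 5 * t) * E.D

/-- The invariant before each decision. -/
structure Inv (η : ℝ) (p : Pos) (s : V → Loc) : Prop where
  t_lt : p.t < E.J
  j_le : p.j ≤ E.J
  step : p.j = 0 → E.StepInv p.i (E.growthAt p.i p.t) fun v => (s v).core
  level : p.j ≠ 0 → ∃ c, E.LevelInv η p.i (E.growthAt p.i p.t) c (p.j - 1) s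

variable {E} {η : ℝ}

theorem Good.growthAt_le (h : E.Good η) {i t : ℕ} (hi : i < E.J) (ht : t ≤ E.J) :
    E.growthAt i t + E.D ≤ E.I.eps * E.I.radius := by
  refine le_trans ?_ h.budget
  have h1 : (i : ℝ) + 1 ≤ E.J := by exact_mod_cast hi
  have h2 : (t : ℝ) ≤ E.J := by exact_mod_cast ht
  have h3 : (1 : ℝ) ≤ E.J := by exact_mod_cast h.levels_pos
  have h4 := h.one_le_growth
  have h5 : 1 + 6 * (E.J : ℝ) * i + 5 * t + 1 ≤ 7 * (E.J : ℝ) ^ 2 := by nlinarith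
  rw [growthAt]
  nlinarith

theorem Good.growth_le_pow (h : E.Good η) : E.D ≤ Fintype.card V ^ E.C := by
  have := h.growth_le.trans h.radius_le
  exact_mod_cast this

/-- This is what the number of levels is chosen for: identifiers have at most `J` bits, and lengths
and radii are at most `2 ^ J`. -/
theorem card_pow_le_two_pow : Fintype.card V ^ E.C ≤ 2 ^ E.J := by
  rw [J, levels, pow_succ, mul_comm E.C, pow_mul]
  have h1 := Nat.pow_le_pow_left (Nat.lt_pow_succ_log_self one_lt_two (Fintype.card V)).le E.C
  have h2 : 0 < (2 ^ (Nat.log 2 (Fintype.card V) + 1)) ^ E.C := by positivity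
  rw [Nat.succ_eq_add_one] at h1
  omega

theorem Inv.option (h : E.Good η) {p : Pos} {s : V → Loc} (hs : E.Inv η p s) (hi : p.i < E.J)
    (t : ℕ) (b : Bool) :
    ∃ c, E.LevelInv η p.i (E.growthAt p.i p.t) c p.j (E.option t p s b) := by
  by_cases hj : p.j = 0
  · refine ⟨b, ?_⟩
    have := LevelInv.of_color h (hs.step hj) (h.growthAt_le hi hs.t_lt.le) hj t b
    rwa [← hj] at this
  · obtain ⟨c, hc⟩ := hs.level hj
    refine ⟨c, ?_⟩
    have hj1 : p.j = p.j - 1 + 1 := by omega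
    have := hs.j_le
    have h2 := hc.of_grow h (by omega) hj1 t b
    rwa [← hj1] at h2

theorem StepInv.mono {i : ℕ} {x y : ℝ} {k : V → Core} (h : E.StepInv i x k) (hxy : x ≤ y) :
    E.StepInv i y k where
  label_lt := h.label_lt
  live := h.live
  act_mem := h.act_mem
  act_reach := fun v hv => by
    obtain ⟨r, h1, h2, d, h3, h4⟩ := h.act_reach v hv
    exact ⟨r, h1, h2, d, h3, by linarith⟩
  entry_reach := h.entry_reach
  decided_reach := fun v hv hva => by
    obtain ⟨q, d, h1, h2, h3, h4⟩ := h.decided_reach v hv hva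
    exact ⟨q, d, h1, h2, h3, by linarith⟩

theorem finished_of_lt {t : ℕ} {p : Pos} {s : V → Loc} {b : Bool} (hj : p.j ≠ E.J) :
    E.finished t p s b = E.option t p s b := by
  funext v
  simp only [finished, finish, if_neg hj]

theorem ended_of_not {t : ℕ} {p : Pos} {s : V → Loc} (hj : ¬ (p.j = E.J ∧ p.t + 1 = E.J)) :
    E.ended t p s = s := by
  funext v
  simp only [ended, endPhase, if_neg hj]

theorem Inv.finished (h : E.Good η) {p : Pos} {s : V → Loc} (hs : E.Inv η p s) (hi : p.i < E.J)
    (t : ℕ) (b : Bool) (hj : p.j = E.J) :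
    E.StepInv p.i (E.growthAt p.i (p.t + 1)) fun v => (E.finished t p s b v).core := by
  obtain ⟨c, hc⟩ := hs.option h hi t b
  rw [hj] at hc
  refine StepInv.mono (hc.finish h (h.growthAt_le hi hs.t_lt.le) hj
    fun v u huv => h.readKind huv t p s b) (le_of_eq ?_)
  simp only [growthAt]
  push_cast
  ring

theorem Inv.next (h : E.Good η) {p : Pos} {s : V → Loc} (hs : E.Inv η p s) (hi : p.i < E.J)
    (t : ℕ) (b : Bool) : E.Inv η (p.next E.J) (E.step t p s b) := by
  have hjle := hs.j_le
  have htlt := hs.t_lt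
  by_cases hj : p.j < E.J
  · rw [Setup.step, ended_of_not (by omega), finished_of_lt (by omega), Pos.next, if_pos hj]
    exact ⟨htlt, hj, fun h0 => absurd h0 (by simp), fun _ => hs.option h hi t b⟩
  · have hj' : p.j = E.J := by omega
    have hf := hs.finished h hi t b hj'
    rw [Pos.next, if_neg hj]
    by_cases ht : p.t + 1 < E.J
    · rw [Setup.step, ended_of_not (by omega), if_pos ht]
      exact ⟨ht, Nat.zero_le _, fun _ => hf, fun h0 => absurd rfl h0⟩
    · have ht' : p.t + 1 = E.J := by omega
      rw [if_neg ht]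
      refine ⟨h.levels_pos, Nat.zero_le _, fun _ => ?_, fun h0 => absurd rfl h0⟩
      refine (hf.endPhase h (h.growthAt_le hi ht'.le) _ ⟨hj', ht'⟩ rfl).mono ?_
      have h3 : (1 : ℝ) ≤ E.J := by exact_mod_cast h.levels_pos
      have h4 := h.one_le_growth
      rw [ht']
      simp only [growthAt]
      push_cast
      nlinarith

/-! ### The potential -/

/-- An edge longer than the next radius, which is at least `D / 2 ^ (j + 2)`, already has a length
price at the cap. The factor 4 in `levelCost` comes from here. -/
theorem LevelInv.le_of_lt_len {D J j l : ℕ} (hj : j < J) (hl : restRadius J D (j + 1) < l) :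
    D * 2 ^ J ≤ 2 ^ j * (4 * 2 ^ J * l) := by
  have h1 := (half_le_restRadius (D := D) (Nat.succ_le_of_lt hj)).trans hl.le
  rw [div_le_iff₀ (by positivity)] at h1
  have h2 : D ≤ l * 2 ^ (j + 1 + 1) := by exact_mod_cast h1
  calc D * 2 ^ J ≤ l * 2 ^ (j + 1 + 1) * 2 ^ J := Nat.mul_le_mul_right _ h2
    _ = _ := by ring

theorem kind_option_zero {t : ℕ} {p : Pos} {s : V → Loc} (hj : p.j = 0) (b : Bool) {v : V}
    (hv : (s v).act) : kind (E.option t p s b v) =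
      if (E.result t p s v).2.testBit 0 = b then 1 else 2 := by
  simp [kind, Setup.option, candidate, hj, hv]

theorem kind_option_false {t : ℕ} {p : Pos} {s : V → Loc} (hj : p.j ≠ 0) {v : V}
    (hv : (s v).act) : kind (E.option t p s false v) =
      if (s v).S then 1 else if (s v).act ∧ (E.result t p s v).2 = 1 then 2 else 3 := by
  simp [kind, Setup.option, candidate, hj, hv]

theorem kind_option_true {t : ℕ} {p : Pos} {s : V → Loc} (hj : p.j ≠ 0) {v : V}
    (hv : (s v).act) : kind (E.option t p s true v) =
      if (s v).act ∧ (E.result t p s v).2 = 1 then 1 else if (s v).Z then 2 else 3 := by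
  simp [kind, Setup.option, candidate, hj, hv]

/-- Only an edge between undecided nodes of the same cluster distinguishes the two options. If such
an edge leads from `S` past `M`, or from `M` past `Z`, it is longer than the collar, so
`levelCost_add_le` applies. -/
theorem Inv.optionPotential_add_le (h : E.Good η) {p : Pos} {s : V → Loc} (hs : E.Inv η p s)
    (t : ℕ) {u v : V} (huv : E.I.sub.Adj u v) :
    E.optionPotential t p s false u v + E.optionPotential t p s true u v ≤
      2 * E.potential p s u v := by
  by_cases hlab : (s u).label = (s v).label
  swap
  · have hlab' : (s u).core.label ≠ (s v).core.label := hlab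
    simp only [optionPotential, potential, potentialAt, if_pos hlab']
    omega
  by_cases hact : (s u).act ∧ (s v).act
  swap
  · have hact' : ¬ ((s u).core.act ∧ (s v).core.act) := hact
    simp only [optionPotential, potential, potentialAt, if_neg hact']
    split_ifs <;> omega
  have key : levelCost E.J E.D p.t p.j (N.len s(u, v)) (kind (E.option t p s false u))
        (kind (E.option t p s false v)) +
      levelCost E.J E.D p.t p.j (N.len s(u, v)) (kind (E.option t p s true u))
        (kind (E.option t p s true v)) ≤
      2 * (if p.j = 0 then stepCost E.J E.D p.t (N.len s(u, v))
      else levelCost E.J E.D p.t (p.j - 1) (N.len s(u, v)) (kind (s u)) (kind (s v))) := by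
    obtain ⟨hu, hv⟩ := hact
    by_cases hj : p.j = 0
    · simp only [kind_option_zero hj _ hu, kind_option_zero hj _ hv, hj, if_true]
      exact levelCost_zero_add_le _ _
    · obtain ⟨c, hc⟩ := hs.level hj
      have hj1 : p.j = p.j - 1 + 1 := by omega
      have hjJ : p.j - 1 < E.J := by have := hs.j_le; omega
      obtain ⟨hM, hM'⟩ := hc.grow h hjJ hj1 t
      have hA : E.ActAdj (fun v => (s v).core) u v := ⟨⟨huv, hlab⟩, hu, hv⟩
      rw [if_neg hj, kind_option_false hj hu, kind_option_false hj hv, kind_option_true hj hu,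
        kind_option_true hj hv, kind_of_act hu, kind_of_act hv]
      have h0 := restRadius_nonneg (D := E.D) (Nat.succ_le_of_lt hjJ)
      have hSM : ∀ w, (s w).S → (s w).act ∧ (E.result t p s w).2 = 1 := fun w hw =>
        hM w w 0 hw (.refl w) (by simpa using h0)
      -- The growth path from `S` to `M` and a path of the next radius together are no longer than
      -- the current radius, hence end in `Z`.
      have hMZ : ∀ w w' d, (s w).act ∧ (E.result t p s w).2 = 1 →
          Reach (E.ActAdj fun v => (s v).core) N.len w w' d →
          (d : ℝ) ≤ restRadius E.J E.D (p.j - 1 + 1) → (s w').Z := by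
        intro w w' d hw hd hdle
        obtain ⟨b, hb, d', hd', hle⟩ := hM' w hw.1 hw.2
        refine hc.Z_of_reach b w' (d' + d) hb ((hd'.mono fun a b hab => hab.1).trans hd) ?_
        push_cast
        linarith
      have e1 := Reach.single (len := N.len) hA
      have e2 := Reach.single (len := N.len) hA.symm
      rw [Sym2.eq_swap] at e2
      have key := levelCost_add_le (J := E.J) (D := E.D) (t := p.t) (j := p.j - 1)
        (l := N.len s(u, v)) (hSM u) (fun hw => hMZ u u 0 hw (.refl u) (by simpa using h0)) (hSM v)
        (fun hw => hMZ v v 0 hw (.refl v) (by simpa using h0))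
        (fun a b => LevelInv.le_of_lt_len hjJ (not_le.1 fun hle => b (hM u v _ a e1 hle)))
        (fun a b => LevelInv.le_of_lt_len hjJ (not_le.1 fun hle => b (hM v u _ a e2 hle)))
        (fun a b => LevelInv.le_of_lt_len hjJ (not_le.1 fun hle => b (hMZ u v _ a e1 hle)))
        (fun a b => LevelInv.le_of_lt_len hjJ (not_le.1 fun hle => b (hMZ v u _ a e2 hle)))
      rw [← hj1] at key
      convert key
  have hlab' : ¬ (s u).core.label ≠ (s v).core.label := fun hn => hn hlab
  have hact' : (s u).core.act ∧ (s v).core.act := hact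
  simp only [optionPotential, potential, potentialAt, if_neg hlab', if_pos hact']
  omega

/-- At level `J` the length price is at least `D * 2 ^ J`, because `D ≤ 2 ^ J` and lengths are
positive. So an edge that leaves `S` already carries the full price of a cut, while an edge inside
`S` costs nothing and gets the same color at both ends. -/
theorem Inv.finished_potential_le (h : E.Good η) {p : Pos} {s : V → Loc} (hs : E.Inv η p s)
    (hi : p.i < E.J) (t : ℕ) (b : Bool) (hj : p.j = E.J) {u v : V} (huv : E.I.sub.Adj u v) :
    E.potentialAt p.i (fun v => (E.finished t p s b v).core) u v
      (stepCost E.J E.D (p.t + 1) (N.len s(u, v))) ≤ E.optionPotential t p s b u v := by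
  obtain ⟨c, hc⟩ := hs.option h hi t b
  have hcore : ∀ v, (s v).core = (E.option t p s b v).core := fun v => (core_candidate _ _ _ _).symm
  simp only [optionPotential, hcore, potentialAt]
  set o := E.option t p s b with ho
  have hf : ∀ v, (E.finished t p s b v).core.label = (o v).core.label ∧
      (E.finished t p s b v).core.act = ((o v).act ∧ ¬ (o v).S) ∧
      (E.finished t p s b v).core.color = if (o v).act ∧ (o v).S then (o v).ccol else (o v).color := by
    intro v
    simp only [Setup.finished, finish, if_pos hj, Loc.core, ← ho, and_self]
  simp only [hf]
  have hS : ∀ v, (o v).S → (o v).act := hc.act_of_S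
  have hcu := hc.ccol_eq u
  have hcv := hc.ccol_eq v
  have hbig : E.D * 2 ^ E.J ≤ 2 ^ p.j * (4 * 2 ^ E.J * N.len s(u, v)) := by
    have h1 := h.growth_le_pow.trans card_pow_le_two_pow
    have h2 := h.len_pos huv
    rw [hj]
    calc E.D * 2 ^ E.J ≤ 2 ^ E.J * 2 ^ E.J := Nat.mul_le_mul_right _ h1
      _ ≤ 2 ^ E.J * (4 * 2 ^ E.J * N.len s(u, v)) := by
        apply Nat.mul_le_mul_left
        have : 0 < 2 ^ E.J := by positivity
        nlinarith
  have hu := hS u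
  have hv := hS v
  by_cases hlab : (o u).core.label ≠ (o v).core.label
  · simp only [if_pos hlab]; exact le_rfl
  simp only [if_neg hlab]
  refine Nat.add_le_add_left ?_ _
  simp only [levelCost, kind_eq_one]
  generalize E.D * 2 ^ E.J = n at *
  generalize 2 ^ p.j * (4 * 2 ^ E.J * N.len s(u, v)) = w at *
  generalize stepCost E.J E.D (p.t + 1) (N.len s(u, v)) = X at *
  simp only [Loc.core]
  by_cases a1 : (o u).act <;> by_cases a2 : (o v).act <;> by_cases a3 : (o u).S <;>
    by_cases a4 : (o v).S <;> simp_all <;> split_ifs <;> omega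

/-- Inside a step this is an equality. At the end of a phase, an edge that is still undecided has
potential at least `D * 2 ^ J`, enough for a cut by the last coloring, and the reserve releases one
`stepCost` for the next phase. -/
theorem Inv.potential_next_le (h : E.Good η) {p : Pos} {s : V → Loc} (hs : E.Inv η p s)
    (hi : p.i < E.J) (t : ℕ) (b : Bool) {u v : V} (huv : E.I.sub.Adj u v) :
    E.potential (p.next E.J) (E.step t p s b) u v ≤ E.optionPotential t p s b u v := by
  have hjle := hs.j_le
  have htlt := hs.t_lt
  by_cases hj : p.j < E.J
  · rw [Setup.step, ended_of_not (by omega), finished_of_lt (by omega), Pos.next, if_pos hj]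
    have hcore : ∀ v, (E.option t p s b v).core = (s v).core := fun v => core_candidate _ _ _ _
    simp only [potential, optionPotential, hcore, Nat.add_eq_zero_iff, one_ne_zero, and_false,
      if_false, Nat.add_sub_cancel]
    exact le_rfl
  · have hj' : p.j = E.J := by omega
    have hle := hs.finished_potential_le h hi t b hj' huv
    refine le_trans ?_ hle
    rw [Pos.next, if_neg hj]
    by_cases ht : p.t + 1 < E.J
    · rw [Setup.step, ended_of_not (by omega), if_pos ht]
      exact le_rfl
    · have ht' : p.t + 1 = E.J := by omega
      rw [if_neg ht, Setup.step]
      have hf := hs.finished h hi t b hj'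
      set f := E.finished t p s b with hfdef
      set col : V → Bool := fun v => lastColor (f v) (E.mainResult (t + 5) f v) with hcol
      have he : ∀ v, (E.ended (t + 5) p f v).core.label =
          (f v).core.label + 2 ^ p.i * (col v).toNat ∧
          ((E.ended (t + 5) p f v).core.act ↔ v ∈ E.I.sub.verts) := by
        intro v
        simp only [ended, endPhase, if_pos (And.intro hj' ht')]
        exact ⟨rfl, Iff.rfl⟩
      have hu : u ∈ E.I.sub.verts := E.I.sub.edge_vert huv
      have hv : v ∈ E.I.sub.verts := E.I.sub.edge_vert huv.symm
      simp only [potential, potentialAt, he, hu, hv, and_self, if_true]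
      simp only [ne_eq, label_eq_iff (hf.label_lt u) (hf.label_lt v)]
      have hX : E.D * 2 ^ E.J ≤ stepCost E.J E.D (p.t + 1) (N.len s(u, v)) := by
        rw [ht', stepCost]
        omega
      have hJ : (E.J - p.i) * stepCost E.J E.D 0 (N.len s(u, v)) =
          (E.J - (p.i + 1)) * stepCost E.J E.D 0 (N.len s(u, v)) +
            stepCost E.J E.D 0 (N.len s(u, v)) := by
        rw [← Nat.succ_mul]
        congr 1
        omega
      rw [hJ]
      have hcu : ¬ (f u).core.act → col u = (f u).core.color := fun h => if_neg h
      have hcv : ¬ (f v).core.act → col v = (f v).core.color := fun h => if_neg h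
      clear hJ
      generalize (E.J - (p.i + 1)) * stepCost E.J E.D 0 (N.len s(u, v)) = Y at *
      generalize stepCost E.J E.D 0 (N.len s(u, v)) = X0 at *
      generalize stepCost E.J E.D (p.t + 1) (N.len s(u, v)) = X at *
      generalize E.D * 2 ^ E.J = n at *
      by_cases hlab : (f u).core.label = (f v).core.label
      swap
      · have h1 : ¬ ((f u).core.label = (f v).core.label ∧ col u = col v) := fun h => hlab h.1
        rw [if_pos h1, if_pos hlab]
      · have h2 : ¬ (f u).core.label ≠ (f v).core.label := fun h => h hlab
        rw [if_neg h2]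
        by_cases hcc : col u = col v
        · rw [if_neg (not_not.2 ⟨hlab, hcc⟩)]
          omega
        · rw [if_pos (fun h => hcc h.2)]
          by_cases a1 : (f u).core.act <;> by_cases a2 : (f v).core.act <;>
            simp only [a1, a2, and_true, true_and, and_false, false_and, if_true, if_false,
              not_true_eq_false, not_false_eq_true]
          · omega
          · omega
          · omega
          -- Both ends were decided with different colors, so the full price has been paid earlier.
          · rw [if_neg (fun h => hcc (by rw [hcu a1, hcv a2, h]))]
            omega

end Setup

/-! ### Positions -/

/-- Positions are the digits of `k` in a mixed-radix system: `J + 1` decisions per step and `J`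
steps per phase. -/
theorem pos_spec {J : ℕ} (hJ : 0 < J) (k : ℕ) : (pos J k).t < J ∧ (pos J k).j ≤ J ∧
    ((pos J k).i * J + (pos J k).t) * (J + 1) + (pos J k).j = k := by
  induction k with
  | zero => simp [pos, hJ]
  | succ k ih =>
    obtain ⟨h1, h2, h3⟩ := ih
    rw [pos, Pos.next]
    split_ifs with h4 h5
    · exact ⟨h1, h4, by dsimp only; omega⟩
    · refine ⟨h5, Nat.zero_le _, ?_⟩
      have h6 : (pos J k).j = J := by omega
      have h7 : ((pos J k).i * J + ((pos J k).t + 1)) * (J + 1) =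
        ((pos J k).i * J + (pos J k).t) * (J + 1) + (J + 1) := by ring
      dsimp only
      omega
    · refine ⟨hJ, Nat.zero_le _, ?_⟩
      have h6 : (pos J k).j = J := by omega
      have h7 : J = (pos J k).t + 1 := by omega
      have h8 : ((pos J k).i + 1) * J + 0 = (pos J k).i * J + (pos J k).t + 1 := by
        rw [add_mul, one_mul]; omega
      have h9 : ((pos J k).i * J + (pos J k).t + 1) * (J + 1) =
        ((pos J k).i * J + (pos J k).t) * (J + 1) + (J + 1) := by ring
      dsimp only
      rw [h8]
      omega

theorem pos_i_lt {J k : ℕ} (hJ : 0 < J) (hk : k < J * J * (J + 1)) : (pos J k).i < J := by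
  obtain ⟨-, -, h3⟩ := pos_spec hJ k
  by_contra h
  have h4 : J * J ≤ (pos J k).i * J + (pos J k).t :=
    (Nat.mul_le_mul_right J (not_lt.1 h)).trans (Nat.le_add_right _ _)
  have h5 := Nat.mul_le_mul_right (J + 1) h4
  omega

theorem pos_last {J : ℕ} (hJ : 0 < J) : pos J (J * J * (J + 1)) = ⟨J, 0, 0⟩ := by
  obtain ⟨h1, h2, h3⟩ := pos_spec hJ (J * J * (J + 1))
  generalize pos J (J * J * (J + 1)) = p at *
  obtain ⟨i, t, j⟩ := p
  simp only at h1 h2 h3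
  have h4 : i * J + t = J * J := by
    have h5 := congrArg (fun x => x / (J + 1)) h3
    beta_reduce at h5
    rwa [Nat.mul_div_cancel _ (Nat.succ_pos _), mul_comm, Nat.mul_add_div (Nat.succ_pos _),
      Nat.div_eq_of_lt (by omega), add_zero] at h5
  have h6 : i = J := by
    have h5 := congrArg (fun x => x / J) h4
    beta_reduce at h5
    rwa [Nat.mul_div_cancel _ hJ, mul_comm, Nat.mul_add_div hJ, Nat.div_eq_of_lt h1,
      add_zero] at h5
  subst h6
  have h7 : t = 0 := by omega
  subst h7
  have h8 : j = 0 := by rw [h4] at h3; omega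
  subst h8
  rfl

/-- A node knows its neighbors only by identifiers and sums over all possible ones; here such a sum
becomes a sum over nodes. -/
theorem id_sum_range {ι : Type} [Fintype ι] {f : ι → ℕ} (hf : Function.Injective f) {m : ℕ}
    (hm : ∀ v, f v < m) (p : ι → Prop) (g : ℕ → ℕ) :
    (∑ k ∈ Finset.range m, if k ∈ f '' {u | p u} then g k else 0) =
      ∑ u, if p u then g (f u) else 0 := by
  rw [← Finset.sum_filter, ← Finset.sum_filter]
  symm
  refine Finset.sum_bij (fun u _ => f u) (fun u hu => ?_) (fun u _ w _ h => hf h) (fun k hk => ?_)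
    fun _ _ => rfl
  · simp only [Finset.mem_filter, Finset.mem_univ, true_and] at hu
    simp only [Finset.mem_filter, Finset.mem_range]
    exact ⟨hm u, u, hu, rfl⟩
  · simp only [Finset.mem_filter, Finset.mem_range] at hk
    obtain ⟨-, u, hu, rfl⟩ := hk
    exact ⟨u, by simpa using hu, rfl⟩

namespace Setup

variable [Fintype V] {N : Network V} {E : Setup V N} {η : ℝ}

/-! ### Clusterings -/

/-- A chosen center carries its own identifier as label, so there is at most one per cluster. A
monochromatic path to `v` supplies this center and stays inside the cluster of `v`, so its length
bounds the distance in the induced subgraph. -/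
theorem isClustering_of_reach (hid : Function.Injective N.id)
    (hfin : ∀ v ∈ E.I.sub.verts, N.delDistSet E.I.sub E.I.delay E.I.centers v ≠ ⊤)
    (hcen : E.I.centers ⊆ E.I.sub.verts) {label : V → ℕ} {Q' : Set V}
    (hQ : ∀ q ∈ Q', q ∈ E.I.centers ∧ N.id q = label q)
    (hreach : ∀ v ∈ E.I.sub.verts, ∃ q ∈ Q', ∃ d : ℕ,
      Reach (fun a b => E.I.sub.Adj a b ∧ label a = label b) N.len q v d ∧
      (E.I.delay q : ℝ) + d ≤ E.baseDist v + E.I.eps * E.I.radius) :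
    E.I.IsClustering label Q' := by
  have hlab : ∀ q v d, Reach (fun a b => E.I.sub.Adj a b ∧ label a = label b) N.len q v d →
      label v = label q := fun q v d h =>
    h.preserves (p := fun w => label w = label q) (fun a b hab ha => hab.2.symm.trans ha) rfl
  refine ⟨fun q hq => (hQ q hq).1, fun v hv => ?_⟩
  obtain ⟨q, hq, d, hd, -⟩ := hreach v hv
  refine ⟨q, ?_, fun u hu => ?_⟩
  · ext w
    simp only [Set.mem_inter_iff, Set.mem_singleton_iff, Input.cluster, Set.mem_ofPred_eq]
    constructor
    · rintro ⟨⟨-, h1⟩, h2⟩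
      apply hid
      rw [(hQ w h2).2, (hQ q hq).2, h1, hlab q v d hd]
    · rintro rfl
      exact ⟨⟨hcen (hQ w hq).1, (hlab w v d hd).symm⟩, hq⟩
  · obtain ⟨q', hq', d', hd', hle⟩ := hreach u hu.1
    have hqq : q' = q := by
      apply hid
      rw [(hQ q' hq').2, (hQ q hq).2, ← hlab q' u d' hd', ← hlab q v d hd]
      exact hu.2
    subst hqq
    have hmem : ∀ w e, Reach (fun a b => E.I.sub.Adj a b ∧ label a = label b) N.len q' w e →
        Reach (E.I.sub.induce (E.I.cluster label v)).Adj N.len q' w e := by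
      intro w e he
      induction he with
      | refl => exact .refl _
      | tail h hA ih =>
        have h1 := hlab _ _ _ h
        have h2 := hlab _ _ _ hd
        exact ih.tail ⟨⟨E.I.sub.edge_vert hA.1, h1.trans h2.symm⟩,
          ⟨E.I.sub.edge_vert hA.1.symm, hA.2.symm.trans (h1.trans h2.symm)⟩, hA.1⟩
    refine (add_le_add le_rfl (N.dist_le_of_reach (hmem u d' hd') fun _ _ h => h)).trans ?_
    rw [← ENNReal.toReal_le_toReal (by simp)
      (ENNReal.add_ne_top.2 ⟨hfin u hu.1, ENNReal.mul_ne_top (by simp) (by simp)⟩),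
      ENNReal.toReal_add (by simp) (by simp), ENNReal.toReal_add (hfin u hu.1)
        (ENNReal.mul_ne_top (by simp) (by simp))]
    simpa [baseDist] using hle

/-- Every node can be reached from an available center in the graph of the current phase. -/
theorem StepInv.exists_reach {i : ℕ} {x : ℝ} {k : V → Core}
    (hs : E.StepInv i x k) {v : V} (hv : v ∈ E.I.sub.verts) :
    ∃ q ∈ E.I.centers, N.id q % 2 ^ i = (k q).label ∧ ∃ d : ℕ, Reach (E.Adj k) N.len q v d ∧
      (E.I.delay q : ℝ) + d ≤ E.baseDist v + x := by
  by_cases hva : (k v).act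
  · obtain ⟨r, h1, h2, d, h3, h4⟩ := hs.act_reach v hva
    obtain ⟨q, d', h5, -, h6, h7⟩ := hs.entry_reach r h1 h2
    refine ⟨q, h5.1, h5.2.1, d' + d, (h6.mono fun a b hab => hab.1).trans
      (h3.mono fun a b hab => hab.1), ?_⟩
    push_cast
    linarith
  · obtain ⟨q, d, h1, -, h2, h3⟩ := hs.decided_reach v hv hva
    exact ⟨q, h1.1, h1.2.1, d, h2.mono fun a b hab => hab.1, h3⟩

/-- The rule `dec` is arbitrary: distances and connectivity never depend on which options are
chosen, only the number of cut edges does. -/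
theorem Inv.states (h : E.Good η) (dec : ℕ → (V → Loc) → Bool) (k : ℕ)
    (hk : k ≤ E.J * E.J * (E.J + 1)) : E.Inv η (pos E.J k) (E.states dec k) := by
  induction k with
  | zero =>
    refine ⟨h.levels_pos, Nat.zero_le _, fun _ => (StepInv.init h).mono ?_, fun h0 => absurd rfl h0⟩
    simp [growthAt, pos]
  | succ k ih =>
    exact (ih (by omega)).next h (pos_i_lt h.levels_pos (by omega)) _ _

theorem isClustering_states (h : E.Good η) (dec : ℕ → (V → Loc) → Bool) :
    E.I.IsClustering (fun v => (E.states dec (E.J * E.J * (E.J + 1)) v).label)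
      {v | v ∈ E.I.sub.verts ∧ v ∈ E.I.centers ∧
        N.id v = (E.states dec (E.J * E.J * (E.J + 1)) v).label} := by
  have hI := Inv.states h dec _ le_rfl
  set s := E.states dec (E.J * E.J * (E.J + 1)) with hs
  rw [pos_last h.levels_pos] at hI
  have hst := hI.step rfl
  refine isClustering_of_reach h.poly.id_injective (fun v => delDistSet_ne_top h.valid)
    h.valid.centers_subset (fun q hq => ⟨hq.2.1, hq.2.2⟩) fun v hv => ?_
  obtain ⟨q, hq, hql, d, hd, hle⟩ := hst.exists_reach hv
  -- After `J` phases the reduction modulo `2 ^ J` is void, and the label is the identifier itself.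
  have hidlt : N.id q < 2 ^ E.J := (h.poly.id_lt q).trans_le card_pow_le_two_pow
  rw [Nat.mod_eq_of_lt hidlt] at hql
  refine ⟨q, ⟨h.valid.centers_subset hq, hq, hql⟩, d, hd, hle.trans ?_⟩
  have h3 : (1 : ℝ) ≤ E.J := by exact_mod_cast h.levels_pos
  have h4 := h.one_le_growth
  have h5 := h.budget
  have h6 : E.growthAt E.J 0 ≤ 7 * (E.J : ℝ) ^ 2 * E.D := by
    rw [growthAt]
    push_cast
    have : 1 + 6 * (E.J : ℝ) * E.J + 5 * 0 ≤ 7 * (E.J : ℝ) ^ 2 := by nlinarith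
    nlinarith
  linarith

/-- The clusters in the case that `ε R` is small. -/
theorem isClustering_tree (hO : E.O.Correct η (2 * E.I.radius)) (h0 : 0 ≤ η)
    (hpoly : N.PolyBounded E.C) (hvalid : E.I.Valid E.C) (hle : η ≤ E.I.eps)
    (hB : E.B = Fintype.card V ^ (5 * E.C + 6)) (hcard : 2 ≤ Fintype.card V)
    {r : V → Option ℕ × ℕ}
    (hr : r = queryResult E.O E.B 0 fun v => ⟨(E.inp v).inSub, (E.inp v).subNbrs,
      (E.inp v).isCenter, (E.inp v).delay, fun k => k.elim (E.inp v).id fun _ => 0⟩) :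
    E.I.IsClustering (fun v => (r v).2) {v | v ∈ E.I.sub.verts ∧ (r v).1 = none} := by
  have hsub : ∀ u v, E.I.sub.Adj u v ↔ N.graph.Adj u v ∧ (u ∈ E.I.sub.verts ∧ v ∈ E.I.sub.verts) ∧
      (N.id v ∈ N.id '' {w | E.I.sub.Adj u w} ∧ N.id u ∈ N.id '' {w | E.I.sub.Adj v w}) := by
    intro u v
    rw [hpoly.id_injective.mem_set_image, hpoly.id_injective.mem_set_image]
    exact ⟨fun h => ⟨E.I.sub.adj_sub h, ⟨E.I.sub.edge_vert h, E.I.sub.edge_vert h.symm⟩, h, h.symm⟩,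
      fun h => h.2.2.1⟩
  have heps : (E.I.eps : ℝ) ≤ 1 := by exact_mod_cast hvalid.eps_le
  have hR0 := NNReal.coe_nonneg E.I.radius
  have hBle : Fintype.card V ^ E.C ≤ E.B := by
    rw [hB]; exact Nat.pow_le_pow_right (by omega) (by omega)
  have hη1 : η ≤ 1 := hle.trans heps
  obtain ⟨par, root, dep, hF, hpar, hnone, hsome⟩ := queryResult_spec (B := E.B) (A := E.I.sub.Adj)
    hO h0 hpoly.id_injective hpoly.len_pos 0 (fun v => ⟨(E.inp v).inSub, (E.inp v).subNbrs,
      (E.inp v).isCenter, (E.inp v).delay, fun k => k.elim (E.inp v).id fun _ => 0⟩)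
    hsub (fun v hv => hvalid.centers_subset hv)
    (fun v hv => by
      obtain ⟨q, hq, d, hd, hqd⟩ := exists_reach_baseDist hvalid hv
      refine ⟨q, hq, d, hd, ?_⟩
      have h1 : (E.I.delay q : ℝ) + d ≤ E.I.radius := hqd.trans (baseDist_le hvalid hv)
      have h2 : (0 : ℝ) ≤ E.I.delay q + d := by positivity
      show (1 + η) * ((E.I.delay q : ℝ) + d) ≤ ((2 * E.I.radius : ℝ≥0) : ℝ)
      push_cast
      nlinarith)
    (fun v hv => ⟨fun _ _ => (hpoly.id_lt v).trans_le hBle, fun p _ => by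
      simp only [Option.elim_some]
      rw [hB]; positivity⟩)
  rw [← hr] at hpar hnone hsome
  have hlabel : ∀ v ∈ E.I.sub.verts, (r v).2 = N.id (root v) := by
    refine hF.induct (fun v hv hn => ?_) fun v hv p hp hvp ih => ?_
    · rw [hnone v hv hn, (hF.of_none v hv hn).1]; rfl
    · rw [hsome v hv p hvp, ih, (hF.of_some v hv p hvp).2.2.1]
      simp
  have hmem : ∀ v ∈ E.I.sub.verts, root v ∈ E.I.sub.verts := fun v hv =>
    hvalid.centers_subset (hF.root_mem v hv)
  refine isClustering_of_reach hpoly.id_injective (fun v => delDistSet_ne_top hvalid)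
    hvalid.centers_subset (fun q hq => ?_) fun v hv => ?_
  · have hn : par q = none := by
      have := hq.2
      rw [hpar] at this
      simpa using this
    have h1 := (hF.of_none q hq.1 hn).1
    refine ⟨?_, by rw [hlabel q hq.1, h1]⟩
    have h2 := hF.root_mem q hq.1
    rwa [h1] at h2
  · refine ⟨root v, ⟨hmem v hv, by rw [hpar, hF.par_root v hv]; rfl⟩, dep v,
      (hF.reach (fun a b h => h.symm) v hv).mono fun a b hab => ⟨hab.1, ?_⟩, ?_⟩
    · rw [hlabel a (E.I.sub.edge_vert hab.1), hlabel b (E.I.sub.edge_vert hab.1.symm), hab.2]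
    · obtain ⟨q, hq, d, hd, hqd⟩ := exists_reach_baseDist hvalid hv
      have h1 : (E.I.delay (root v) : ℝ) + dep v ≤ (1 + η) * (E.I.delay q + d) :=
        hF.acc v hv q hq d hd
      have h2 := hqd.trans (baseDist_le hvalid hv)
      have h3 : (0 : ℝ) ≤ E.I.delay q + d := by positivity
      -- The error `η (del q + d)` is at most `ε R`, since the precision is at most `ε`.
      have h4 := mul_le_mul hle h2 h3 (NNReal.coe_nonneg _)
      linarith

end Setup

/-! ### Sums over edges and over coins -/

theorem sum_adj_eq_two_mul [Fintype V] {G : SimpleGraph V} (H : G.Subgraph) (f : Sym2 V → ℕ) :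
    (∑ v, ∑ u, if H.Adj v u then f s(v, u) else 0) =
      2 * ∑ e : Sym2 V with e ∈ H.edgeSet, f e := by
  rw [← Fintype.sum_prod_type', ← Finset.sum_fiberwise Finset.univ (fun x : V × V => s(x.1, x.2)),
    Finset.sum_filter, Finset.mul_sum]
  refine Finset.sum_congr rfl fun e _ => ?_
  induction e with
  | h a b =>
    rw [SimpleGraph.Subgraph.mem_edgeSet]
    by_cases hab : H.Adj a b
    · have hne : (a, b) ≠ (b, a) := fun h => hab.ne (Prod.ext_iff.1 h).1
      have hs : (Finset.univ.filter fun x : V × V => s(x.1, x.2) = s(a, b)) = {(a, b), (b, a)} := by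
        ext ⟨x, y⟩
        simp
      have h2 : s(b, a) = s(a, b) := Sym2.eq_swap
      rw [hs, Finset.sum_pair hne]
      simp only [hab, hab.symm, if_true, h2, two_mul]
    · rw [if_neg hab, mul_zero]
      refine Finset.sum_eq_zero fun x hx => if_neg fun hx' => hab ?_
      have h1 : s(x.1, x.2) ∈ H.edgeSet := hx'
      rwa [(Finset.mem_filter.1 hx).2] at h1

/-- The sequence of coins that starts with `c`. -/
def extendCoins {K : ℕ} (c : Fin K → Bool) (k : ℕ) : Bool := if h : k < K then c ⟨k, h⟩ else false

/-- Change coin `k` of node `v`. -/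
def flipCoin {K : ℕ} (v : V) (k : Fin K) (c : V → Fin K → Bool) : V → Fin K → Bool :=
  fun w m => if w = v ∧ m = k then !c w m else c w m

theorem flipCoin_involutive {K : ℕ} (v : V) (k : Fin K) :
    Function.Involutive (flipCoin v k) := by
  intro c
  funext w m
  simp only [flipCoin]
  split_ifs <;> simp

theorem extendCoins_flipCoin {K : ℕ} (v : V) (k : Fin K) (c : V → Fin K → Bool) (w : V) (m : ℕ) :
    extendCoins (flipCoin v k c w) m =
      if w = v ∧ m = k then !extendCoins (c w) m else extendCoins (c w) m := by
  simp only [extendCoins, flipCoin]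
  by_cases hm : m < K
  · simp only [dif_pos hm, Fin.ext_iff]
  · have : m ≠ k := by omega
    simp [dif_neg hm, this]

/-! ### From potentials to bounds for cut edges -/

namespace Setup

variable [Fintype V] {N : Network V} {E : Setup V N} {η : ℝ}

theorem states_congr {dec dec' : ℕ → (V → Loc) → Bool} {k : ℕ}
    (h : ∀ m < k, ∀ s, dec m s = dec' m s) : E.states dec k = E.states dec' k := by
  induction k with
  | zero => rfl
  | succ k ih =>
    simp only [states]
    rw [ih fun m hm => h m (by omega), h k (by omega)]

/-- The decisions made with given coins. -/
def decisions (E : Setup V N) (det : Bool) (coin : V → ℕ → Bool) (k : ℕ) (s : V → Loc) : Bool :=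
  E.decide det (fun v => coin v k) (8 * k) (pos E.J k) s

/-- The bound for the potential at the beginning. -/
theorem potential_zero {u v : V} (huv : E.I.sub.Adj u v) (dec : ℕ → (V → Loc) → Bool) :
    E.potential (pos E.J 0) (E.states dec 0) u v =
      (E.J + 1) * stepCost E.J E.D 0 (N.len s(u, v)) := by
  have hu : u ∈ E.I.sub.verts := E.I.sub.edge_vert huv
  have hv : v ∈ E.I.sub.verts := E.I.sub.edge_vert huv.symm
  simp only [potential, potentialAt, pos, states, startPhase, Loc.core, ne_eq, not_true_eq_false,
    if_false, Nat.sub_zero, if_true, inp, Input.localInput, hu, hv, and_self]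
  ring

/-- Since `D ≤ 2 ^ J` and lengths are at least 1, `stepCost` at step 0 is at most `9 * 2 ^ J * ℓ`.
There are `J + 1 ≤ 2 J` such terms, whence 18. -/
theorem Good.potential_zero_le (h : E.Good η) {u v : V} (huv : E.I.sub.Adj u v)
    (dec : ℕ → (V → Loc) → Bool) : E.potential (pos E.J 0) (E.states dec 0) u v ≤
      18 * E.J * 2 ^ E.J * N.len s(u, v) := by
  rw [potential_zero huv]
  have h1 := h.growth_le_pow.trans card_pow_le_two_pow
  have h2 := h.len_pos huv
  have h3 := h.levels_pos
  have h4 : stepCost E.J E.D 0 (N.len s(u, v)) ≤ 9 * (2 ^ E.J * N.len s(u, v)) := by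
    have : 2 ^ E.J * 1 ≤ 2 ^ E.J * N.len s(u, v) := Nat.mul_le_mul_left _ h2
    simp only [stepCost, pow_zero, mul_one, mul_assoc]
    omega
  calc _ ≤ (2 * E.J) * (9 * (2 ^ E.J * N.len s(u, v))) := Nat.mul_le_mul (by omega) h4
    _ = _ := by ring

/-- The final cluster names. -/
def finalName (E : Setup V N) (dec : ℕ → (V → Loc) → Bool) (v : V) : ℕ :=
  (E.states dec (E.J * E.J * (E.J + 1)) v).label

theorem le_potential_final {u v : V} {dec : ℕ → (V → Loc) → Bool}
    (hne : E.finalName dec u ≠ E.finalName dec v) : E.D * 2 ^ E.J ≤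
      E.potential (pos E.J (E.J * E.J * (E.J + 1))) (E.states dec (E.J * E.J * (E.J + 1))) u v := by
  simp only [potential, potentialAt]
  exact (if_pos hne).ge

theorem Good.two_le_bandwidth (h : E.Good η) : 2 ≤ E.B := by
  have h1 := h.le_bandwidth
  have h2 : 1 ≤ Fintype.card V ^ E.C := Nat.one_le_pow _ _ (by have := h.two_le; omega)
  omega

/-! ### The randomized algorithm -/

theorem testBit_zero_sum_flip {f g : V → ℕ} {w : V} (hw : f w + g w = 1)
    (h : ∀ v, v ≠ w → f v = g v) : (∑ v, f v).testBit 0 = !(∑ v, g v).testBit 0 := by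
  rw [← Finset.add_sum_erase _ f (Finset.mem_univ w), ← Finset.add_sum_erase _ g (Finset.mem_univ w),
    Finset.sum_congr rfl fun v hv => h v (Finset.ne_of_mem_erase hv)]
  simp only [Nat.testBit_zero]
  generalize (∑ v ∈ Finset.univ.erase w, g v) = z
  rcases Nat.mod_two_eq_zero_or_one (g w + z) with h1 | h1
  · have : (f w + z) % 2 = 1 := by omega
    simp [h1, this]
  · have : (f w + z) % 2 = 0 := by omega
    simp [h1, this]

/-- A random decision is the parity of the number of heads among the coins of all nodes, obtained
from one global sum. Flipping a single coin reverses it. -/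
theorem Good.decisions_flip (h : E.Good η) {K : ℕ} (w : V) (k : Fin K) (c : V → Fin K → Bool)
    (s : V → Loc) :
    E.decisions false (fun v => extendCoins (flipCoin w k c v)) k s =
      !E.decisions false (fun v => extendCoins (c v)) k s := by
  have hB := h.two_le_bandwidth
  have hmod : ∀ b : Bool, b.toNat % E.B = b.toNat := fun b => Nat.mod_eq_of_lt (by
    have := Bool.toNat_le b
    omega)
  have key : ∀ c' : V → Fin K → Bool, E.decisions false (fun v => extendCoins (c' v)) k s =
      (∑ v, (extendCoins (c' v) k).toNat).testBit 0 := by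
    intro c'
    simp only [decisions, decide, decision, firstValue, Bool.false_eq_true, if_false, hmod]
  rw [key, key]
  refine testBit_zero_sum_flip (w := w) ?_ fun v hv => ?_
  · rw [extendCoins_flipCoin, if_pos ⟨rfl, rfl⟩]
    cases extendCoins (c w) k <;> rfl
  · rw [extendCoins_flipCoin, if_neg fun h => hv h.1]

theorem decisions_flip_of_ne {K : ℕ} (w : V) (k : Fin K) (c : V → Fin K → Bool)
    (s : V → Loc) {m : ℕ} (hm : m ≠ k) :
    E.decisions false (fun v => extendCoins (flipCoin w k c v)) m s =
      E.decisions false (fun v => extendCoins (c v)) m s := by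
  simp only [decisions, extendCoins_flipCoin, hm, and_false, if_false]

/-- Flipping coin `k` of `u` pairs the coin sequences. The runs in a pair agree up to decision `k`,
because oracle answers do not depend on coins, and then take opposite options; so their potentials
after it sum to at most twice the common potential before. -/
theorem Good.sum_potential_le (h : E.Good η) {u v : V} (huv : E.I.sub.Adj u v) {K : ℕ}
    (hK : K = E.J * E.J * (E.J + 1)) (k : ℕ) (hk : k ≤ K) :
    ∑ c : V → Fin K → Bool, E.potential (pos E.J k)
        (E.states (E.decisions false fun v => extendCoins (c v)) k) u v ≤
      Fintype.card (V → Fin K → Bool) * (18 * E.J * 2 ^ E.J * N.len s(u, v)) := by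
  induction k with
  | zero =>
    rw [← smul_eq_mul, ← Finset.card_univ]
    exact Finset.sum_le_card_nsmul _ _ _ fun c _ => h.potential_zero_le huv _
  | succ k ih =>
    refine le_trans ?_ (ih (by omega))
    set F : (V → Fin K → Bool) → ℕ := fun c => E.potential (pos E.J (k + 1))
        (E.states (E.decisions false fun v => extendCoins (c v)) (k + 1)) u v with hF
    set τ := flipCoin u (⟨k, hk⟩ : Fin K) with hτ
    have hsum : ∑ c, F (τ c) = ∑ c, F c :=
      Equiv.sum_comp ((flipCoin_involutive u (⟨k, hk⟩ : Fin K)).toPerm) F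
    have hle : ∑ c, (F c + F (τ c)) ≤ ∑ c : V → Fin K → Bool, 2 * E.potential (pos E.J k)
        (E.states (E.decisions false fun v => extendCoins (c v)) k) u v := by
      refine Finset.sum_le_sum fun c _ => ?_
      have hI := Inv.states h (E.decisions false fun v => extendCoins (c v)) k (by omega)
      have hi := pos_i_lt h.levels_pos (by omega : k < E.J * E.J * (E.J + 1))
      have hst : E.states (E.decisions false fun v => extendCoins (τ c v)) k =
          E.states (E.decisions false fun v => extendCoins (c v)) k :=
        states_congr fun m hm s => decisions_flip_of_ne _ _ _ _ (by simp; omega)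
      simp only [hF, states, hst]
      rw [h.decisions_flip u ⟨k, hk⟩ c]
      set s := E.states (E.decisions false fun v => extendCoins (c v)) k
      refine le_trans (add_le_add (hI.potential_next_le h hi _ _ huv)
        (hI.potential_next_le h hi _ _ huv)) (le_trans ?_ (hI.optionPotential_add_le h (8 * k) huv))
      cases E.decisions false (fun v => extendCoins (c v)) k s
      · exact le_rfl
      · exact (add_comm _ _).le
    rw [Finset.sum_add_distrib, hsum, ← Finset.mul_sum, ← two_mul] at hle
    exact Nat.le_of_mul_le_mul_left hle two_pos

/-- This is Markov's inequality: each outcome that separates `u` and `v` contributes at least `D * 2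
^ J` to the sum of the final potentials. -/
theorem Good.card_mul_le (h : E.Good η) {u v : V} (huv : E.I.sub.Adj u v) {K : ℕ}
    (hK : K = E.J * E.J * (E.J + 1)) :
    E.D * (Finset.univ.filter fun c : V → Fin K → Bool =>
      E.finalName (E.decisions false fun v => extendCoins (c v)) u ≠
        E.finalName (E.decisions false fun v => extendCoins (c v)) v).card ≤
      Fintype.card (V → Fin K → Bool) * (18 * E.J * N.len s(u, v)) := by
  have h1 := h.sum_potential_le huv hK K le_rfl
  have h2 : (Finset.univ.filter fun c : V → Fin K → Bool =>
      E.finalName (E.decisions false fun v => extendCoins (c v)) u ≠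
        E.finalName (E.decisions false fun v => extendCoins (c v)) v).card * (E.D * 2 ^ E.J) ≤
      ∑ c : V → Fin K → Bool, E.potential (pos E.J K)
        (E.states (E.decisions false fun v => extendCoins (c v)) K) u v := by
    rw [← smul_eq_mul, ← Finset.sum_const]
    refine le_trans (Finset.sum_le_sum fun c hc => ?_)
      (Finset.sum_le_sum_of_subset (Finset.filter_subset _ _))
    subst hK
    exact le_potential_final (Finset.mem_filter.1 hc).2
  refine Nat.le_of_mul_le_mul_right (c := 2 ^ E.J) ?_ (by positivity)
  calc _ = _ := by ring
    _ ≤ _ := h2.trans h1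
    _ = _ := by ring

/-! ### The deterministic algorithm -/

theorem Inv.stepInv {p : Pos} {s : V → Loc} (hs : E.Inv η p s) :
    E.StepInv p.i (E.growthAt p.i p.t) fun v => (s v).core := by
  by_cases hj : p.j = 0
  · exact hs.step hj
  · obtain ⟨c, hc⟩ := hs.level hj
    exact hc.step

/-- The contribution of the pair `vu` to the weighted potential of an option. -/
def pairCost (E : Setup V N) (t : ℕ) (p : Pos) (s : V → Loc) (b : Bool) (v u : V) : ℕ :=
  if E.Adj (fun v => (s v).core) v u then
    (if (s v).act ∧ (s u).act then
      E.μ s(v, u) * levelCost E.J E.D p.t p.j (N.len s(v, u)) (kind (E.option t p s b v))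
        (kind (E.option t p s b u)) else 0) else 0

theorem Inv.contribution_eq (h : E.Good η) {p : Pos} {s : V → Loc} (hs : E.Inv η p s) (t : ℕ)
    (b : Bool) (v : V) :
    contribution E.C E.J E.D p (E.inp v) (E.option t p s b v) (readKind b (E.kindMsg t p s v)) =
      ∑ u, E.pairCost t p s b v u := by
  have hst := hs.stepInv
  have hcore : ∀ v, (E.option t p s b v).core = (s v).core := fun v => core_candidate _ _ _ _
  have hact : ∀ v, (E.option t p s b v).act = (s v).act := fun v => congrArg Core.act (hcore v)
  have hlive : (E.option t p s b v).live = (s v).live := congrArg Core.live (hcore v)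
  by_cases hv : v ∈ E.I.sub.verts
  · have h1 : (s v).live = _ := hst.live v hv
    rw [contribution, hlive, h1]
    refine (id_sum_range h.poly.id_injective h.poly.id_lt _ _).trans ?_
    refine Finset.sum_congr rfl fun u _ => ?_
    rw [pairCost]
    by_cases huv : E.Adj (fun v => (s v).core) v u
    · rw [if_pos huv, if_pos huv, h.readKind huv.1, h.inp_len huv.1, h.inp_weight huv.1]
      simp only [kind_eq_zero, hact]
      by_cases a1 : (s v).act <;> by_cases a2 : (s u).act <;> simp [a1, a2]
    · rw [if_neg huv, if_neg huv]
  · have h1 : ¬ (s v).act := fun ha => hv (hst.act_mem v ha)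
    have h2 : kind (E.option t p s b v) = 0 := by rw [kind_eq_zero, hact]; exact h1
    rw [contribution, Finset.sum_eq_zero, Finset.sum_eq_zero]
    · intro u _
      rw [pairCost, if_neg]
      exact fun h => hv (E.I.sub.edge_vert h.1)
    · intro l _
      simp [h2]

theorem two_pow_levels_le (hcard : 2 ≤ Fintype.card V) :
    2 ^ E.J ≤ 2 * Fintype.card V ^ (2 * E.C) := by
  rw [J, levels, pow_succ, mul_comm E.C, pow_mul, mul_comm _ 2, pow_mul (Fintype.card V)]
  refine Nat.mul_le_mul_left 2 (Nat.pow_le_pow_left ?_ _)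
  have h1 := Nat.pow_log_le_self 2 (by omega : Fintype.card V ≠ 0)
  rw [pow_succ, pow_two]
  calc _ ≤ Fintype.card V * 2 := Nat.mul_le_mul_right _ h1
    _ ≤ _ := Nat.mul_le_mul_left _ hcard

theorem levelCost_le {J D t j l a b : ℕ} (ht : t < J) :
    levelCost J D t j l a b ≤ 2 * (D * 2 ^ J) + 8 * 2 ^ J * l := by
  have h1 : stepCost J D (t + 1) l ≤ D * 2 ^ J + 8 * 2 ^ J * l := by
    have := Nat.mul_le_mul_left D (Nat.pow_le_pow_right two_pos (Nat.succ_le_of_lt ht))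
    rw [stepCost]
    exact Nat.add_le_add_right this _
  unfold levelCost
  split_ifs <;> omega

/-- The submitted numbers fit into the bandwidth, so the global sums compare the true potentials.
The exponent is made up of `C` for the number of neighbors, `C` for weights, `3 C` for `levelCost`,
and 6 for the constant 20. -/
theorem Inv.contribution_lt (h : E.Good η) (hμ : ∀ e ∈ E.I.sub.edgeSet, E.μ e ≤ Fintype.card V ^ E.C)
    {p : Pos} {s : V → Loc} (hs : E.Inv η p s) (t : ℕ) (b : Bool) (v : V) :
    contribution E.C E.J E.D p (E.inp v) (E.option t p s b v) (readKind b (E.kindMsg t p s v)) <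
      E.B := by
  set n := Fintype.card V with hn
  have h2 := h.two_le
  have hC : 0 < n ^ E.C := Nat.pow_pos (by omega)
  have hterm : ∀ u, E.pairCost t p s b v u ≤ n ^ E.C * (20 * n ^ (3 * E.C)) := by
    intro u
    rw [pairCost]
    split_ifs with h3 h4
    · refine Nat.mul_le_mul (hμ _ h3.1) ((levelCost_le hs.t_lt).trans ?_)
      have h5 := h.growth_le_pow
      have h6 := h.len_le h3.1
      have h7 := two_pow_levels_le (E := E) h2
      calc 2 * (E.D * 2 ^ E.J) + 8 * 2 ^ E.J * N.len s(v, u)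
          ≤ 2 * (n ^ E.C * (2 * n ^ (2 * E.C))) + 8 * (2 * n ^ (2 * E.C)) * n ^ E.C := by gcongr
        _ = 20 * n ^ (3 * E.C) := by ring
    · positivity
    · positivity
  -- The nodes have `n` distinct identifiers below `n ^ C`; this also covers small values of `C`.
  have hcardle : n ≤ n ^ E.C := by
    have h3 := Fintype.card_le_of_injective (fun v => (⟨N.id v, h.poly.id_lt v⟩ : Fin (n ^ E.C)))
      fun a b hab => h.poly.id_injective (Fin.ext_iff.1 hab)
    simpa using h3
  rw [hs.contribution_eq h]
  calc ∑ u, E.pairCost t p s b v u ≤ ∑ _u : V, n ^ E.C * (20 * n ^ (3 * E.C)) :=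
        Finset.sum_le_sum fun u _ => hterm u
    _ = n * (n ^ E.C * (20 * n ^ (3 * E.C))) := by simp [hn]
    _ ≤ n ^ E.C * (n ^ E.C * (20 * n ^ (3 * E.C))) := Nat.mul_le_mul_right _ hcardle
    _ = 20 * n ^ (5 * E.C) := by ring
    _ < 2 ^ 6 * n ^ (5 * E.C) := Nat.mul_lt_mul_of_pos_right (by norm_num) (Nat.pow_pos (by omega))
    _ ≤ n ^ 6 * n ^ (5 * E.C) := Nat.mul_le_mul_right _ (Nat.pow_le_pow_left h2 6)
    _ = E.B := by rw [h.bandwidth, ← pow_add, add_comm]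

/-- The weighted potential of an option. -/
def totalOption (E : Setup V N) (t : ℕ) (p : Pos) (s : V → Loc) (b : Bool) : ℕ :=
  ∑ v, ∑ u, if E.I.sub.Adj v u then E.μ s(v, u) * E.optionPotential t p s b v u else 0

def total (E : Setup V N) (p : Pos) (s : V → Loc) : ℕ :=
  ∑ v, ∑ u, if E.I.sub.Adj v u then E.μ s(v, u) * E.potential p s v u else 0

/-- Reserves, cut edges and decided nodes contribute the same to both options, so comparing the
parts that the nodes can compute compares the whole potentials. -/
theorem exists_totalOption_eq (t : ℕ) (p : Pos) (s : V → Loc) :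
    ∃ x, ∀ b, E.totalOption t p s b = x + ∑ v, ∑ u, E.pairCost t p s b v u := by
  refine ⟨∑ v, ∑ u, if E.I.sub.Adj v u then E.μ s(v, u) *
    E.potentialAt p.i (fun v => (s v).core) v u 0 else 0, fun b => ?_⟩
  rw [totalOption, ← Finset.sum_add_distrib]
  refine Finset.sum_congr rfl fun v _ => ?_
  rw [← Finset.sum_add_distrib]
  refine Finset.sum_congr rfl fun u _ => ?_
  by_cases huv : E.I.sub.Adj v u
  · simp only [huv, if_true, optionPotential, pairCost, potentialAt, Adj, true_and, Loc.core]
    by_cases hl : (s v).label = (s u).label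
    · simp only [hl, ne_eq, not_true_eq_false, if_false, if_true]
      by_cases ha : (s v).act ∧ (s u).act
      · simp only [ha.1, ha.2, and_self, if_true]; ring
      · simp only [ha, if_false]; ring
    · simp only [hl, ne_eq, not_false_eq_true, if_true, if_false, add_zero]
  · simp only [pairCost, Adj, huv, false_and, if_false]

/-- The cheaper option costs at most the average of both, hence at most the current total. -/
theorem Good.total_next_le (h : E.Good η)
    (hμ : ∀ e ∈ E.I.sub.edgeSet, E.μ e ≤ Fintype.card V ^ E.C) {p : Pos} {s : V → Loc}
    (hs : E.Inv η p s) (hi : p.i < E.J) (t : ℕ) (coin : V → Bool) :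
    E.total (p.next E.J) (E.step t p s (E.decide true coin t p s)) ≤ E.total p s := by
  set b := E.decide true coin t p s with hb
  have h1 : E.total (p.next E.J) (E.step t p s b) ≤ E.totalOption t p s b := by
    refine Finset.sum_le_sum fun v _ => Finset.sum_le_sum fun u _ => ?_
    split_ifs with huv
    · exact Nat.mul_le_mul_left _ (hs.potential_next_le h hi t b huv)
    · exact le_rfl
  have h2 : E.totalOption t p s false + E.totalOption t p s true ≤ 2 * E.total p s := by
    simp only [totalOption, total, Finset.mul_sum, ← Finset.sum_add_distrib]
    refine Finset.sum_le_sum fun v _ => Finset.sum_le_sum fun u _ => ?_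
    split_ifs with huv
    · rw [← mul_add, mul_left_comm]
      exact Nat.mul_le_mul_left _ (hs.optionPotential_add_le h t huv)
    · exact le_rfl
  have h3 : b = Decidable.decide (∑ v, ∑ u, E.pairCost t p s true v u ≤
      ∑ v, ∑ u, E.pairCost t p s false v u) := by
    have key : ∀ b', ∑ v, contribution E.C E.J E.D p (E.inp v) (E.option t p s b' v)
        (EdgeCutting.readKind b' (E.kindMsg t p s v)) % E.B = ∑ v, ∑ u, E.pairCost t p s b' v u := fun b' =>
      Finset.sum_congr rfl fun v _ => by
        rw [Nat.mod_eq_of_lt (hs.contribution_lt h hμ t b' v), hs.contribution_eq h]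
    rw [← key, ← key]
    rfl
  obtain ⟨x, hx⟩ := E.exists_totalOption_eq t p s
  have h4 := hx false
  have h5 := hx true
  have h6 := hx b
  by_cases hle : ∑ v, ∑ u, E.pairCost t p s true v u ≤ ∑ v, ∑ u, E.pairCost t p s false v u
  · rw [decide_eq_true hle] at h3
    rw [h3] at h6 h1
    rw [h3]
    omega
  · rw [decide_eq_false hle] at h3
    rw [h3] at h6 h1
    rw [h3]
    omega

theorem Good.sum_badEdges_le (h : E.Good η)
    (hμ : ∀ e ∈ E.I.sub.edgeSet, E.μ e ≤ Fintype.card V ^ E.C) (coin : V → ℕ → Bool) :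
    E.D * ∑ e : Sym2 V with e ∈ E.I.badEdges (E.finalName (E.decisions true coin)), E.μ e ≤
      18 * E.J * ∑ e : Sym2 V with e ∈ E.I.sub.edgeSet, E.μ e * N.len e := by
  have hstep : ∀ k ≤ E.J * E.J * (E.J + 1),
      E.total (pos E.J k) (E.states (E.decisions true coin) k) ≤
        E.total (pos E.J 0) (E.states (E.decisions true coin) 0) := by
    intro k hk
    induction k with
    | zero => exact le_rfl
    | succ k ih =>
      refine le_trans ?_ (ih (by omega))
      exact h.total_next_le hμ (Inv.states h _ k (by omega)) (pos_i_lt h.levels_pos (by omega)) _ _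
  have h1 := hstep _ le_rfl
  set dec := E.decisions true coin with hdec
  set K := E.J * E.J * (E.J + 1) with hK
  have h2 : E.total (pos E.J 0) (E.states dec 0) ≤
      2 * ((18 * E.J * 2 ^ E.J) * ∑ e : Sym2 V with e ∈ E.I.sub.edgeSet, E.μ e * N.len e) := by
    rw [Finset.mul_sum, ← sum_adj_eq_two_mul]
    refine Finset.sum_le_sum fun v _ => Finset.sum_le_sum fun u _ => ?_
    split_ifs with huv
    · rw [mul_left_comm]
      exact Nat.mul_le_mul_left _ (h.potential_zero_le huv _)
    · exact le_rfl
  have hbad : (Finset.univ.filter fun e => e ∈ E.I.badEdges (E.finalName dec)) =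
      (Finset.univ.filter fun e => e ∈ E.I.sub.edgeSet).filter
        fun e => e ∈ E.I.badEdges (E.finalName dec) := by
    ext e
    simp only [Finset.mem_filter, Finset.mem_univ, true_and]
    exact ⟨fun h => ⟨h.1, h⟩, fun h => h.2⟩
  -- Sums over ordered pairs count each edge twice; this factor 2 appears at the beginning and at
  -- the end of the run and cancels.
  have h3 : 2 * (E.D * 2 ^ E.J * ∑ e : Sym2 V with e ∈ E.I.badEdges (E.finalName dec), E.μ e) ≤
      E.total (pos E.J K) (E.states dec K) := by
    rw [hbad, Finset.sum_filter, Finset.mul_sum, ← sum_adj_eq_two_mul]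
    refine Finset.sum_le_sum fun v _ => Finset.sum_le_sum fun u _ => ?_
    split_ifs with huv hb
    · rw [mul_comm]
      refine Nat.mul_le_mul_left _ (le_potential_final ?_)
      obtain ⟨-, a, b, hab, hne⟩ := hb
      rcases Sym2.eq_iff.1 hab with ⟨rfl, rfl⟩ | ⟨rfl, rfl⟩
      · exact hne
      · exact hne.symm
    · simp
    · exact le_rfl
  have h4 := h3.trans (h1.trans h2)
  refine Nat.le_of_mul_le_mul_right (c := 2 * 2 ^ E.J) ?_ (by positivity)
  calc _ = _ := by ring
    _ ≤ _ := h4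
    _ = _ := by ring

end Setup

/-! ### The algorithms and their parameters -/

def numSteps (C n : ℕ) : ℕ := 8 * numDecisions C n + 2

/-- The algorithm, in its deterministic and its randomized version. -/
def clusteringAlgorithm (C : ℕ) (det : Bool) (coins : ℕ → ℕ) : Algorithm :=
  Proc.toAlgorithm (5 * C + 6) (numSteps C) coins fun i c => program C det i (extendCoins c)

/-- The ratio between the number of levels and `log n`. -/
def levelRatio (C : ℕ) : ℝ := 4 * C + 2

/-- The constant 128 makes `128 η J² ≤ ε`. This yields `η ≤ 1 / (3 J)` for the levels and `4 η R ≤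
D` for single uses of the oracle. -/
def precisionFactor (C : ℕ) : ℝ := 1 / (128 * levelRatio C ^ 2)

theorem half_le_log_two : (1 / 2 : ℝ) ≤ Real.log 2 := by
  have := Real.log_two_gt_d9
  linarith

theorem half_le_log {n : ℕ} (hn : 2 ≤ n) : (1 / 2 : ℝ) ≤ Real.log n :=
  half_le_log_two.trans (Real.log_le_log (by norm_num) (by exact_mod_cast hn))

theorem levels_le_mul_log (C : ℕ) {n : ℕ} (hn : 2 ≤ n) :
    (levels C n : ℝ) ≤ levelRatio C * Real.log n := by
  have h1 := half_le_log hn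
  have h2 : (Nat.log 2 n : ℝ) * Real.log 2 ≤ Real.log n := by
    rw [← Real.log_pow]
    refine Real.log_le_log (by positivity) ?_
    exact_mod_cast Nat.pow_log_le_self 2 (by omega)
  have h3 : (Nat.log 2 n : ℝ) ≤ 2 * Real.log n := by
    have := mul_le_mul_of_nonneg_left half_le_log_two (Nat.cast_nonneg (α := ℝ) (Nat.log 2 n))
    linarith
  have h4 := mul_le_mul_of_nonneg_left (by linarith : (Nat.log 2 n : ℝ) + 1 ≤ 4 * Real.log n)
    (Nat.cast_nonneg (α := ℝ) C)
  rw [levels, levelRatio]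
  push_cast
  linarith

theorem one_le_levels (C n : ℕ) : 1 ≤ levels C n := Nat.le_add_left _ _

theorem levels_pow_three_le (C : ℕ) {n : ℕ} (hn : 2 ≤ n) :
    (levels C n : ℝ) ^ 3 ≤ levelRatio C ^ 3 * Real.log n ^ 3 := by
  rw [← mul_pow]
  exact pow_le_pow_left₀ (Nat.cast_nonneg _) (levels_le_mul_log C hn) 3

theorem numSteps_le (C : ℕ) {n : ℕ} (hn : 2 ≤ n) :
    (numSteps C n : ℝ) ≤ 288 * levelRatio C ^ 3 * Real.log n ^ 3 := by
  have h1 : (1 : ℝ) ≤ levels C n := by exact_mod_cast one_le_levels C n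
  have h2 := levels_pow_three_le C hn
  have h3 : (1 : ℝ) ≤ (levels C n : ℝ) ^ 2 := one_le_pow₀ h1
  have h4 : (levels C n : ℝ) ^ 2 ≤ (levels C n : ℝ) ^ 3 := pow_le_pow_right₀ h1 (by norm_num)
  rw [numSteps, numDecisions]
  push_cast
  nlinarith

/-! ### Choice of the precision, and passage from `D` to `ε R` -/

namespace Setup

variable [Fintype V] {N : Network V} {E : Setup V N}

theorem one_le_J (E : Setup V N) : (1 : ℝ) ≤ E.J := by
  exact_mod_cast one_le_levels E.C (Fintype.card V)

theorem J_pow_three_le (hcard : 2 ≤ Fintype.card V) :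
    (E.J : ℝ) ^ 3 ≤ levelRatio E.C ^ 3 * Real.log (Fintype.card V) ^ 3 :=
  levels_pow_three_le E.C hcard

theorem precision_mul_le (hcard : 2 ≤ Fintype.card V) :
    E.I.precision (precisionFactor E.C) * (128 * (E.J : ℝ) ^ 2) ≤ E.I.eps := by
  have h1 := half_le_log hcard
  have h2 : (E.J : ℝ) ^ 2 ≤ levelRatio E.C ^ 2 * Real.log (Fintype.card V) ^ 2 := by
    rw [← mul_pow]
    exact pow_le_pow_left₀ (Nat.cast_nonneg _) (levels_le_mul_log E.C hcard) 2
  have h3 : 0 < levelRatio E.C := by rw [levelRatio]; positivity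
  have h4 : 0 < Real.log (Fintype.card V) := by linarith
  have h5 := NNReal.coe_nonneg E.I.eps
  have h6 : E.I.precision (precisionFactor E.C) =
      E.I.eps / (128 * (levelRatio E.C ^ 2 * Real.log (Fintype.card V) ^ 2)) := by
    rw [Input.precision, precisionFactor]
    field_simp
  rw [h6, div_mul_eq_mul_div]
  refine div_le_of_le_mul₀ (by positivity) h5 ?_
  gcongr

theorem precision_nonneg (E : Setup V N) :
    0 ≤ E.I.precision (precisionFactor E.C) := by
  rw [Input.precision, precisionFactor]
  positivity

theorem precision_le_eps (hcard : 2 ≤ Fintype.card V) :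
    E.I.precision (precisionFactor E.C) ≤ E.I.eps := by
  have h1 := E.precision_mul_le hcard
  have h2 := E.precision_nonneg
  have h3 : (1 : ℝ) ≤ (E.J : ℝ) ^ 2 := one_le_pow₀ E.one_le_J
  nlinarith

theorem growth_mul_le (E : Setup V N) : (E.D : ℝ) * (8 * (E.J : ℝ) ^ 2) ≤ E.I.eps * E.I.radius := by
  have h1 : (E.D : ℝ≥0) ≤ E.I.eps * E.I.radius / (8 * (E.J : ℝ≥0) ^ 2) := Nat.floor_le (zero_le)
  have h2 : (E.D : ℝ) ≤ E.I.eps * E.I.radius / (8 * (E.J : ℝ) ^ 2) := by exact_mod_cast h1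
  have h3 := E.one_le_J
  rwa [le_div_iff₀ (by positivity)] at h2

theorem lt_growth_mul (E : Setup V N) :
    (E.I.eps : ℝ) * E.I.radius < (E.D + 1) * (8 * (E.J : ℝ) ^ 2) := by
  have h1 : E.I.eps * E.I.radius / (8 * (E.J : ℝ≥0) ^ 2) < (E.D : ℝ≥0) + 1 := Nat.lt_floor_add_one _
  have h2 : (E.I.eps : ℝ) * E.I.radius / (8 * (E.J : ℝ) ^ 2) < E.D + 1 := by exact_mod_cast h1
  have h3 := E.one_le_J
  rwa [div_lt_iff₀ (by positivity)] at h2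

/-- The assumptions of the theorem. -/
structure Admissible (E : Setup V N) : Prop where
  correct : E.O.Correct (E.I.precision (precisionFactor E.C)) (2 * E.I.radius)
  poly : N.PolyBounded E.C
  valid : E.I.Valid E.C
  two_le : 2 ≤ Fintype.card V
  bandwidth : E.B = Fintype.card V ^ (5 * E.C + 6)

theorem Admissible.good (h : E.Admissible) (hD : E.D ≠ 0) :
    E.Good (E.I.precision (precisionFactor E.C)) where
  correct := h.correct
  nonneg := E.precision_nonneg
  poly := h.poly
  valid := h.valid
  two_le := h.two_le
  growth_pos := Nat.pos_of_ne_zero hD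
  le_third := by
    have h1 := E.precision_mul_le h.two_le
    have h2 := E.one_le_J
    have h3 : (E.I.eps : ℝ) ≤ 1 := by exact_mod_cast h.valid.eps_le
    have h4 := E.precision_nonneg
    rw [le_div_iff₀ (by positivity)]
    have h5 : 3 * (E.J : ℝ) ≤ 128 * (E.J : ℝ) ^ 2 := by nlinarith
    have h6 := mul_le_mul_of_nonneg_left h5 h4
    linarith
  mul_le := by
    have h1 := mul_le_mul_of_nonneg_right (E.precision_mul_le h.two_le)
      (NNReal.coe_nonneg E.I.radius)
    have h2 := E.lt_growth_mul
    have h3 := E.one_le_J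
    have h4 : (1 : ℝ) ≤ E.D := by exact_mod_cast Nat.pos_of_ne_zero hD
    have h5 : 0 < (E.J : ℝ) ^ 2 := by positivity
    -- From `128 η J² R ≤ ε R < 8 J² (D + 1)` it follows that `4 η R ≤ (D + 1) / 4`, which is at
    -- most `D` because `D ≥ 1`.
    have h6 : (E.I.precision (precisionFactor E.C) * (4 * E.I.radius)) * (32 * (E.J : ℝ) ^ 2) ≤
        ((E.D + 1) / 4) * (32 * (E.J : ℝ) ^ 2) := by linarith
    have h7 := le_of_mul_le_mul_right h6 (by positivity)
    linarith
  budget := by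
    have h1 := E.growth_mul_le
    have h2 : 0 ≤ (E.D : ℝ) * (E.J : ℝ) ^ 2 := by positivity
    linarith
  bandwidth := h.bandwidth

theorem final_eq (hB : E.B = Fintype.card V ^ (5 * E.C + 6)) {det : Bool} {coins : ℕ → ℕ}
    {coin : V → Fin (coins (Fintype.card V)) → Bool} {t : ℕ} {a : V → ℕ × Prop}
    (h : Exec E.O E.B 0 (fun v => program E.C det (E.inp v) (extendCoins (coin v))) t a)
    (ht : t ≤ numSteps E.C (Fintype.card V)) :
    (clusteringAlgorithm E.C det coins).finalLabel E.O E.I E.μ coin = (fun v => (a v).1) ∧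
      (clusteringAlgorithm E.C det coins).finalCenters E.O E.I E.μ coin =
        {v | v ∈ E.I.sub.verts ∧ (a v).2} := by
  rw [hB] at h
  have h1 := run_toAlgorithm (bandwidth := 5 * E.C + 6) (steps := numSteps E.C) (coins := coins)
    (prog := fun i c => program E.C det i (extendCoins c)) (I := E.I) (μ := E.μ) (coin := coin)
    h rfl _ ht
  have h2 : (clusteringAlgorithm E.C det coins).run E.O E.I E.μ coin
      ((clusteringAlgorithm E.C det coins).steps (Fintype.card V)) = fun v => .ret (a v) := h1
  exact ⟨funext fun v => congrArg (fun s => (Proc.output (0, False) s).1) (congrFun h2 v),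
    Set.ext fun v => and_congr_right fun _ =>
      iff_of_eq (congrArg (fun s => (Proc.output (0, False) s).2) (congrFun h2 v))⟩

theorem Admissible.finalLabel_eq (h : E.Admissible) (hD : E.D ≠ 0) (det : Bool) {coins : ℕ → ℕ}
    (coin : V → Fin (coins (Fintype.card V)) → Bool) :
    (clusteringAlgorithm E.C det coins).finalLabel E.O E.I E.μ coin =
      E.finalName (E.decisions det fun v => extendCoins (coin v)) :=
  (final_eq h.bandwidth (E.exec_program det (fun v => extendCoins (coin v)) hD)
    (Nat.le_add_right _ _)).1

theorem Admissible.isClustering (h : E.Admissible) (det : Bool) {coins : ℕ → ℕ}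
    (coin : V → Fin (coins (Fintype.card V)) → Bool) :
    E.I.IsClustering ((clusteringAlgorithm E.C det coins).finalLabel E.O E.I E.μ coin)
      ((clusteringAlgorithm E.C det coins).finalCenters E.O E.I E.μ coin) := by
  by_cases hD : E.D = 0
  · obtain ⟨h1, h2⟩ := final_eq h.bandwidth
      (E.exec_treeProgram det (fun v => extendCoins (coin v)) hD) (Nat.le_add_left _ _)
    rw [h1, h2]
    exact isClustering_tree h.correct E.precision_nonneg h.poly h.valid
      (precision_le_eps h.two_le) h.bandwidth h.two_le rfl
  · obtain ⟨h1, h2⟩ := final_eq h.bandwidth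
      (E.exec_program det (fun v => extendCoins (coin v)) hD) (Nat.le_add_right _ _)
    rw [h1, h2]
    exact isClustering_states (h.good hD) _

/-- A bound in terms of the growth is a bound in terms of `ε R`. -/
theorem Admissible.mul_le_of_growth_mul_le (h : E.Admissible) {x y : ℝ} (hx : 0 ≤ x) (hy : 0 ≤ y)
    (hxy : x ≤ y) (hD : E.D ≠ 0 → E.D * x ≤ 18 * E.J * y) :
    (E.I.eps : ℝ) * E.I.radius * x ≤
      288 * levelRatio E.C ^ 3 * Real.log (Fintype.card V) ^ 3 * y := by
  have h1 := E.lt_growth_mul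
  have h2 := E.one_le_J
  have h3 := E.J_pow_three_le h.two_le
  have h5 : (E.J : ℝ) ^ 2 ≤ (E.J : ℝ) ^ 3 := pow_le_pow_right₀ h2 (by norm_num)
  have h6 : 0 ≤ (E.J : ℝ) ^ 2 := by positivity
  have h7 : (E.I.eps : ℝ) * E.I.radius * x ≤ 288 * (E.J : ℝ) ^ 3 * y := by
    refine (mul_le_mul_of_nonneg_right h1.le hx).trans ?_
    -- For `D = 0` the bound `ε R < 8 J²` and `x ≤ y` suffice. Otherwise `D + 1 ≤ 2 D`, and the
    -- constant is `16 * 18 = 288`.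
    by_cases h0 : E.D = 0
    · rw [h0]
      have h8 : 8 * (E.J : ℝ) ^ 2 * x ≤ 288 * (E.J : ℝ) ^ 3 * y := by gcongr; norm_num
      simpa using h8
    · have h8 : (1 : ℝ) ≤ E.D := by exact_mod_cast Nat.pos_of_ne_zero h0
      have h9 := mul_le_mul_of_nonneg_left (hD h0) (by positivity : 0 ≤ 16 * (E.J : ℝ) ^ 2)
      have h10 : ((E.D : ℝ) + 1) * (8 * (E.J : ℝ) ^ 2) * x ≤
          (E.D + E.D) * (8 * (E.J : ℝ) ^ 2) * x := by gcongr
      refine h10.trans ?_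
      calc _ = 16 * (E.J : ℝ) ^ 2 * (E.D * x) := by ring
        _ ≤ _ := h9
        _ = _ := by ring
  refine h7.trans (mul_le_mul_of_nonneg_right ?_ hy)
  linarith

theorem Admissible.sum_badEdges_le (h : E.Admissible)
    (hμ : ∀ e ∈ E.I.sub.edgeSet, E.μ e ≤ Fintype.card V ^ E.C) {coins : ℕ → ℕ}
    (coin : V → Fin (coins (Fintype.card V)) → Bool) :
    (E.I.eps : ℝ) * E.I.radius * ∑ e : Sym2 V with e ∈ E.I.badEdges
        ((clusteringAlgorithm E.C true coins).finalLabel E.O E.I E.μ coin), (E.μ e : ℝ) ≤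
      288 * levelRatio E.C ^ 3 * Real.log (Fintype.card V) ^ 3 *
        ∑ e : Sym2 V with e ∈ E.I.sub.edgeSet, (E.μ e : ℝ) * (N.len e : ℝ) := by
  refine h.mul_le_of_growth_mul_le (Finset.sum_nonneg fun _ _ => Nat.cast_nonneg _)
    (Finset.sum_nonneg fun _ _ => by positivity) ?_ fun hD => ?_
  · refine (Finset.sum_le_sum_of_subset_of_nonneg (t := Finset.univ.filter fun e =>
      e ∈ E.I.sub.edgeSet) ?_ fun _ _ _ => Nat.cast_nonneg _).trans (Finset.sum_le_sum ?_)
    · intro e he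
      rw [Finset.mem_filter] at he ⊢
      exact ⟨he.1, he.2.1⟩
    · intro e he
      have h1 : (1 : ℝ) ≤ N.len e := by
        exact_mod_cast h.poly.len_pos e (E.I.sub.edgeSet_subset (Finset.mem_filter.1 he).2)
      exact le_mul_of_one_le_right (Nat.cast_nonneg _) h1
  · rw [h.finalLabel_eq hD]
    have h1 := (h.good hD).sum_badEdges_le hμ fun v => extendCoins (coin v)
    exact_mod_cast h1

/-- For `D = 0` no property of the clusters is used: a probability is at most 1 and lengths are at
least 1. For `D > 0` the bound is `Good.card_mul_le` divided by the number of outcomes. -/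
theorem Admissible.cutProb_le (h : E.Admissible) {e : Sym2 V} (he : e ∈ E.I.sub.edgeSet) :
    (E.I.eps : ℝ) * E.I.radius *
        (clusteringAlgorithm E.C false (numDecisions E.C)).cutProb E.O E.I E.μ e ≤
      288 * levelRatio E.C ^ 3 * Real.log (Fintype.card V) ^ 3 * (N.len e : ℝ) := by
  have hpos : (0 : ℝ) < Fintype.card (V → Fin (numDecisions E.C (Fintype.card V)) → Bool) := by
    exact_mod_cast Fintype.card_pos
  have h1 : (1 : ℝ) ≤ N.len e := by exact_mod_cast h.poly.len_pos e (E.I.sub.edgeSet_subset he)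
  refine h.mul_le_of_growth_mul_le (by rw [Algorithm.cutProb]; positivity) (Nat.cast_nonneg _)
    (le_trans ?_ h1) fun hD => ?_
  · rw [Algorithm.cutProb]
    refine div_le_one_of_le₀ ?_ (Nat.cast_nonneg _)
    exact_mod_cast Finset.card_le_univ _
  · induction e with
    | h u v =>
      have huv : E.I.sub.Adj u v := he
      have h2 := (h.good hD).card_mul_le huv (K := numDecisions E.C (Fintype.card V)) rfl
      have h3 : ∀ c : V → Fin (numDecisions E.C (Fintype.card V)) → Bool,
          s(u, v) ∈ E.I.badEdges ((clusteringAlgorithm E.C false (numDecisions E.C)).finalLabel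
            E.O E.I E.μ c) ↔ E.finalName (E.decisions false fun v => extendCoins (c v)) u ≠
              E.finalName (E.decisions false fun v => extendCoins (c v)) v := by
        intro c
        rw [h.finalLabel_eq hD]
        constructor
        · rintro ⟨-, a, b, hab, hne⟩
          rcases Sym2.eq_iff.1 hab with ⟨rfl, rfl⟩ | ⟨rfl, rfl⟩
          · exact hne
          · exact hne.symm
        · exact fun hne => ⟨he, u, v, rfl, hne⟩
      have h4 : (E.D : ℝ) * (Finset.univ.filter fun c : V → Fin (numDecisions E.C
            (Fintype.card V)) → Bool => s(u, v) ∈ E.I.badEdges ((clusteringAlgorithm E.C false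
              (numDecisions E.C)).finalLabel E.O E.I E.μ c)).card ≤
          Fintype.card (V → Fin (numDecisions E.C (Fintype.card V)) → Bool) *
            (18 * E.J * N.len s(u, v)) := by
        simp only [h3]
        exact_mod_cast h2
      rw [Algorithm.cutProb, ← mul_div_assoc]
      refine div_le_of_le_mul₀ (Nat.cast_nonneg _) (by positivity) ?_
      rw [mul_comm _ ((Fintype.card _ : ℕ) : ℝ)]
      exact h4

end Setup

theorem precisionFactor_pos (C : ℕ) : 0 < precisionFactor C := by
  rw [precisionFactor, levelRatio]
  positivity

end EdgeCutting

end

open Classical in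
open EdgeCutting in
theorem mainTheorem3 (C : ℕ) :
    -- deterministic version
    (∃ (A : Algorithm) (K c : ℝ), 0 < c ∧
      (∀ n, A.coins n = 0) ∧
      (∀ n : ℕ, 2 ≤ n → (A.steps n : ℝ) ≤ K * Real.log n ^ 3) ∧
      ∀ (V : Type) [Fintype V] (N : Network V) (I : Input N) (μ : Sym2 V → ℕ) (O : Oracles N)
        (coin : V → Fin (A.coins (Fintype.card V)) → Bool),
        2 ≤ Fintype.card V → N.PolyBounded C → I.Valid C →
        (∀ e ∈ I.sub.edgeSet, μ e ≤ Fintype.card V ^ C) →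
        O.Correct (I.precision c) (2 * I.radius) →
        I.IsClustering (A.finalLabel O I μ coin) (A.finalCenters O I μ coin) ∧
        (I.eps : ℝ) * I.radius *
            ∑ e : Sym2 V with e ∈ I.badEdges (A.finalLabel O I μ coin), (μ e : ℝ) ≤
          K * Real.log (Fintype.card V) ^ 3 *
            ∑ e : Sym2 V with e ∈ I.sub.edgeSet, (μ e : ℝ) * (N.len e : ℝ)) ∧
    -- randomized version
    (∃ (A : Algorithm) (K c : ℝ), 0 < c ∧
      (∀ n : ℕ, 2 ≤ n → (A.steps n : ℝ) ≤ K * Real.log n ^ 3) ∧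
      ∀ (V : Type) [Fintype V] (N : Network V) (I : Input N) (O : Oracles N),
        2 ≤ Fintype.card V → N.PolyBounded C → I.Valid C →
        O.Correct (I.precision c) (2 * I.radius) →
        (∀ coin, I.IsClustering (A.finalLabel O I 0 coin) (A.finalCenters O I 0 coin)) ∧
        ∀ e ∈ I.sub.edgeSet,
          (I.eps : ℝ) * I.radius * A.cutProb O I 0 e ≤
            K * Real.log (Fintype.card V) ^ 3 * (N.len e : ℝ)) := by
  refine ⟨⟨clusteringAlgorithm C true fun _ => 0, 288 * levelRatio C ^ 3, precisionFactor C,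
      precisionFactor_pos C, fun _ => rfl, fun n hn => numSteps_le C hn, ?_⟩,
    ⟨clusteringAlgorithm C false (numDecisions C), 288 * levelRatio C ^ 3, precisionFactor C,
      precisionFactor_pos C, fun n hn => numSteps_le C hn, ?_⟩⟩
  · intro V _ N I μ O coin hcard hpoly hvalid hμ hO
    have h : (⟨O, Fintype.card V ^ (5 * C + 6), C, I, μ⟩ : Setup V N).Admissible :=
      ⟨hO, hpoly, hvalid, hcard, rfl⟩
    exact ⟨h.isClustering true coin, h.sum_badEdges_le hμ coin⟩
  · intro V _ N I O hcard hpoly hvalid hO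
    have h : (⟨O, Fintype.card V ^ (5 * C + 6), C, I, 0⟩ : Setup V N).Admissible :=
      ⟨hO, hpoly, hvalid, hcard, rfl⟩
    exact ⟨fun coin => h.isClustering false coin, fun e he => h.cutProb_le he⟩
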